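/- Setting. An instance of 1-FTP is a finite graph $G=(V,E)$ (undirected or directed, loops and parallel edges allowed) with edge weights $w:E\to\mathbb{R}_{\ge 0}$, two vertices $s,t\in V$ and a set $M\subseteq E$ of faulty edges; the edges in $E\setminus M$ are called secure. A set $S\subseteq E$ is feasible if, for every $F\subseteq M$ with $|F|\le 1$, the set $S\setminus F$ contains an $s$-$t$ path. The task is to find a feasible set $S$ of minimum cost $w(S)=\sum_{e\in S}w(e)$, or to report that there is no feasible set. A robust bipath is a set $Q=P_1\cup P_2$, where $P_1,P_2$ are (edge sets of) $s$-$t$ paths such that any two vertices that lie on both paths appear in the same order on $P_1$ and on $P_2$ (traversed from $s$ to $t$), and $P_1\cap P_2\cap M=\emptyset$. For $u,v\in V$ let $\ell_1(u,v)$ be the minimum cost of a $u$-$v$ path in $(V,E\setminus M)$, let $\ell_2(u,v)$ be the minimum of $w(P)+w(P')$ over all pairs of edge-disjoint $u$-$v$ paths $P,P'$ in $G$ (both values are $+\infty$ if there is no such object), and let $\ell(u,v)=\min\{\ell_1(u,v),\ell_2(u,v)\}$. Theorem. (1) There is an algorithm that solves 1-FTP with a number of elementary operations that is polynomial in $|V|+|E|$,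 where the weights are only added, subtracted and compared; the model is a random access machine with unit-cost addition, subtraction and comparison of natural and of real numbers and without multiplication. In particular, 1-FTP is solvable in polynomial time. (2) Every inclusion-wise minimal feasible set is a robust bipath, and every robust bipath is feasible. (3) The minimum cost of a feasible set and the minimum cost of a robust bipath are both equal to the length of a shortest $s$-$t$ path with respect to $\ell$ in the complete graph on $V$ (all three are $+\infty$ if there is no feasible set). If a feasible set exists, then a shortest path $s=v_0,v_1,\dots,v_r=t$ exists, and for every such path there is a set $Q$ that is obtained as follows: $Q$ is the union, over all $i$, of a shortest $v_i$-$v_{i+1}$ path in $(V,E\setminus M)$ if $\ell(v_i,v_{i+1})=\ell_1(v_i,v_{i+1})$, and of a cheapest pair of edge-disjoint $v_i$-$v_{i+1}$ paths in $G$ otherwise. Every set $Q$ obtained in this way is a minimum-cost feasible set and contains a robust bipath of the same minimum cost. -/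

import Mathlib

open scoped NNReal ENNReal

namespace FTP

/-! ### Instances, paths, feasible solutions -/

/-- An instance of the fault-tolerant path problem without the fault bound `k`: a finite
edge-weighted multigraph with vertices `Fin n` and edges `Fin m` (undirected or directed,
according to `directed`), the set `faulty` of edges that may fail, and two terminals. -/
structure Instance where
  /-- number of vertices -/
  n : ℕ
  /-- number of edges -/
  m : ℕ
  /-- `false`: undirected graph, `true`: directed graph -/
  directed : Bool
  /-- first endpoint (the tail, in the directed case) -/
  src : Fin m → Fin n
  /-- second endpoint (the head, in the directed case) -/
  dst : Fin m → Fin n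
  /-- the nonnegative real edge weights -/
  weight : Fin m → ℝ≥0
  /-- the edges that may fail; all other edges are secure -/
  faulty : Finset (Fin m)
  /-- the first terminal -/
  s : Fin n
  /-- the second terminal -/
  t : Fin n

namespace Instance

variable (I : Instance)

/-- The edge `e` can be traversed from `u` to `v`. -/
def Joins (e : Fin I.m) (u v : Fin I.n) : Prop :=
  (I.src e = u ∧ I.dst e = v) ∨ (I.directed = false ∧ I.src e = v ∧ I.dst e = u)

/-- `p` is a walk from `u` to `v`. A walk is recorded as the list of its traversed edges, each
together with the vertex that is reached by it. -/
def IsWalk : Fin I.n → List (Fin I.m × Fin I.n) → Fin I.n → Prop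
  | u, [], v => u = v
  | u, (e, x) :: p, v => I.Joins e u x ∧ IsWalk x p v

/-- The vertices of the walk `p` that starts in `u`, in the order of traversal. -/
def support (u : Fin I.n) (p : List (Fin I.m × Fin I.n)) : List (Fin I.n) :=
  u :: p.map Prod.snd

/-- The set of edges of a walk. -/
def edges (p : List (Fin I.m × Fin I.n)) : Finset (Fin I.m) :=
  (p.map Prod.fst).toFinset

/-- `p` is a `u`-`v` path: a walk that repeats no vertex. -/
def IsPath (u : Fin I.n) (p : List (Fin I.m × Fin I.n)) (v : Fin I.n) : Prop :=
  I.IsWalk u p v ∧ (I.support u p).Nodup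

/-- The cost of a set of edges. -/
def cost (S : Finset (Fin I.m)) : ℝ≥0 :=
  ∑ e ∈ S, I.weight e

/-- `S` is feasible for fault bound `k`: `S \ F` contains an `s`-`t` path for every set `F` of at
most `k` faulty edges. -/
def IsFeasible (k : ℕ) (S : Finset (Fin I.m)) : Prop :=
  ∀ F ⊆ I.faulty, F.card ≤ k → ∃ p, I.IsPath I.s p I.t ∧ I.edges p ⊆ S \ F

/-- `S` is a feasible solution of minimum cost. -/
def IsOptimal (k : ℕ) (S : Finset (Fin I.m)) : Prop :=
  I.IsFeasible k S ∧ ∀ T, I.IsFeasible k T → I.cost S ≤ I.cost T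

/-- The edge set `Q` is a robust `s`-`t` bipath: the union of two `s`-`t` paths `p`, `q` that
traverse the vertices they have in common in the same order and that share no faulty edge. -/
def IsRobustBipath (Q : Finset (Fin I.m)) : Prop :=
  ∃ p q, I.IsPath I.s p I.t ∧ I.IsPath I.s q I.t ∧ Q = I.edges p ∪ I.edges q ∧
    (∀ u v, u ∈ I.support I.s p → u ∈ I.support I.s q →
      v ∈ I.support I.s p → v ∈ I.support I.s q →
      ((I.support I.s p).idxOf u < (I.support I.s p).idxOf v ↔
        (I.support I.s q).idxOf u < (I.support I.s q).idxOf v)) ∧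
    I.edges p ∩ I.edges q ∩ I.faulty = ∅

/-! ### The pairwise length function -/

/-- The edges of `p` form a `u`-`v` path that consists of secure edges. -/
def IsSecurePath (u : Fin I.n) (p : List (Fin I.m × Fin I.n)) (v : Fin I.n) : Prop :=
  I.IsPath u p v ∧ Disjoint (I.edges p) I.faulty

/-- `p` and `q` are two edge-disjoint `u`-`v` paths. -/
def IsDisjointPair (u : Fin I.n) (p q : List (Fin I.m × Fin I.n)) (v : Fin I.n) : Prop :=
  I.IsPath u p v ∧ I.IsPath u q v ∧ Disjoint (I.edges p) (I.edges q)

/-- The distance from `u` to `v` in the graph of secure edges (`⊤` if there is no path). -/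
noncomputable def secureDist (u v : Fin I.n) : ℝ≥0∞ :=
  ⨅ (p) (_ : I.IsSecurePath u p v), (I.cost (I.edges p) : ℝ≥0∞)

/-- The least cost of two edge-disjoint `u`-`v` paths (`⊤` if there are none). -/
noncomputable def pairDist (u v : Fin I.n) : ℝ≥0∞ :=
  ⨅ (p) (q) (_ : I.IsDisjointPair u p q v),
    (I.cost (I.edges p) : ℝ≥0∞) + (I.cost (I.edges q) : ℝ≥0∞)

/-- The length function on the complete graph over the vertex set. -/
noncomputable def len (u v : Fin I.n) : ℝ≥0∞ :=
  min (I.secureDist u v) (I.pairDist u v)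

/-- The vertices `u :: vs` form a path from `u` to `t` in the complete graph. -/
def IsCompletePath (u : Fin I.n) (vs : List (Fin I.n)) (t : Fin I.n) : Prop :=
  (u :: vs).Nodup ∧ (u :: vs).getLast (List.cons_ne_nil u vs) = t

/-- The length of the path `u :: vs` of the complete graph with respect to `len`. -/
noncomputable def pathLen : Fin I.n → List (Fin I.n) → ℝ≥0∞
  | _, [] => 0
  | u, v :: vs => I.len u v + pathLen v vs

/-- The distance of the terminals in the complete graph with respect to `len`. -/
noncomputable def lenDist : ℝ≥0∞ :=
  ⨅ (vs) (_ : I.IsCompletePath I.s vs I.t), I.pathLen I.s vs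

/-- `vs` (with `s` in front) is a shortest `s`-`t` path with respect to `len`. -/
def IsShortest (vs : List (Fin I.n)) : Prop :=
  I.IsCompletePath I.s vs I.t ∧ I.pathLen I.s vs = I.lenDist

/-- `R` realizes the edge `uv` of the complete graph: it is the edge set of a shortest secure
`u`-`v` path if `len u v` is the secure distance, and otherwise the union of a cheapest pair of
edge-disjoint `u`-`v` paths. -/
def RealizesEdge (u v : Fin I.n) (R : Finset (Fin I.m)) : Prop :=
  (I.len u v = I.secureDist u v ∧ ∃ p, I.IsSecurePath u p v ∧
      (I.cost (I.edges p) : ℝ≥0∞) = I.secureDist u v ∧ R = I.edges p) ∨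
  (I.len u v ≠ I.secureDist u v ∧ ∃ p q, I.IsDisjointPair u p q v ∧
      (I.cost (I.edges p) : ℝ≥0∞) + (I.cost (I.edges q) : ℝ≥0∞) = I.pairDist u v ∧
      R = I.edges p ∪ I.edges q)

/-- `Q` is a union of edge sets that realize the successive edges of the path `u :: vs`. -/
def Realizes : Fin I.n → List (Fin I.n) → Finset (Fin I.m) → Prop
  | _, [], Q => Q = ∅
  | u, v :: vs, Q => ∃ R Q', I.RealizesEdge u v R ∧ Realizes v vs Q' ∧ Q = R ∪ Q'

end Instance

/-! ### Machine model

Structured programs for a unit-cost random access machine with two kinds of memory cells,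
natural numbers and real numbers, each organized in arrays with fixed names. Numbers can only be
added, subtracted and compared, the only real constant is `0`, and there is no multiplication and
no conversion between the two kinds. Hence every elementary operation lengthens the numbers in
memory by at most one bit (rational weights being written over a common denominator), and for
rational weights a polynomial number of operations amounts to polynomial time on a Turing
machine. -/

/-- A memory state: `nat a i` and `wt a i` are the `i`-th cells of the arrays with name `a`. -/
structure State where
  /-- the cells that hold natural numbers -/
  nat : ℕ → ℕ → ℕ
  /-- the cells that hold real numbers -/
  wt : ℕ → ℕ → ℝ

/-- Expressions for natural numbers. -/
inductive NExpr where
  | const (c : ℕ)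
  | read (a : ℕ) (i : NExpr)
  | add (x y : NExpr)
  | sub (x y : NExpr)

namespace NExpr

/-- The value of an expression; `sub` is truncated subtraction. -/
def eval (σ : State) : NExpr → ℕ
  | const c => c
  | read a i => σ.nat a (i.eval σ)
  | add x y => x.eval σ + y.eval σ
  | sub x y => x.eval σ - y.eval σ

/-- The number of operations in the evaluation of an expression. -/
def steps : NExpr → ℕ
  | const _ => 1
  | read _ i => i.steps + 1
  | add x y => x.steps + y.steps + 1
  | sub x y => x.steps + y.steps + 1

end NExpr

/-- Expressions for real numbers. -/
inductive WExpr where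
  | zero
  | read (a : ℕ) (i : NExpr)
  | add (x y : WExpr)
  | sub (x y : WExpr)

namespace WExpr

/-- The value of an expression. -/
noncomputable def eval (σ : State) : WExpr → ℝ
  | zero => 0
  | read a i => σ.wt a (i.eval σ)
  | add x y => x.eval σ + y.eval σ
  | sub x y => x.eval σ - y.eval σ

/-- The number of operations in the evaluation of an expression. -/
def steps : WExpr → ℕ
  | zero => 1
  | read _ i => i.steps + 1
  | add x y => x.steps + y.steps + 1
  | sub x y => x.steps + y.steps + 1

end WExpr

/-- Comparisons. -/
inductive Test where
  | natLt (x y : NExpr)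
  | natEq (x y : NExpr)
  | wtLt (x y : WExpr)

namespace Test

/-- The comparison succeeds. -/
def Holds (σ : State) : Test → Prop
  | natLt x y => x.eval σ < y.eval σ
  | natEq x y => x.eval σ = y.eval σ
  | wtLt x y => x.eval σ < y.eval σ

/-- The number of operations in a comparison. -/
def steps : Test → ℕ
  | natLt x y => x.steps + y.steps + 1
  | natEq x y => x.steps + y.steps + 1
  | wtLt x y => x.steps + y.steps + 1

end Test

namespace State

/-- Write `x` to the cell `i` of the array `a` of natural numbers. -/
def setNat (σ : State) (a i x : ℕ) : State :=
  { σ with nat := Function.update σ.nat a (Function.update (σ.nat a) i x) }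

/-- Write `x` to the cell `i` of the array `a` of real numbers. -/
noncomputable def setWt (σ : State) (a i : ℕ) (x : ℝ) : State :=
  { σ with wt := Function.update σ.wt a (Function.update (σ.wt a) i x) }

end State

/-- Programs. -/
inductive Prog where
  | skip
  | setNat (a : ℕ) (i x : NExpr)
  | setWt (a : ℕ) (i : NExpr) (x : WExpr)
  | seq (P Q : Prog)
  | ite (b : Test) (P Q : Prog)
  | loop (b : Test) (P : Prog)

/-- `Run P σ c τ`: the program `P`, started in the state `σ`, halts in the state `τ` after exactly
`c` elementary operations. -/
inductive Run : Prog → State → ℕ → State → Prop where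
  | skip (σ : State) : Run .skip σ 1 σ
  | setNat (σ : State) (a : ℕ) (i x : NExpr) :
      Run (.setNat a i x) σ (i.steps + x.steps + 1) (σ.setNat a (i.eval σ) (x.eval σ))
  | setWt (σ : State) (a : ℕ) (i : NExpr) (x : WExpr) :
      Run (.setWt a i x) σ (i.steps + x.steps + 1) (σ.setWt a (i.eval σ) (x.eval σ))
  | seq {P Q : Prog} {σ τ ρ : State} {c d : ℕ} (hP : Run P σ c τ) (hQ : Run Q τ d ρ) :
      Run (.seq P Q) σ (c + d) ρ
  | ite_true {b : Test} {P Q : Prog} {σ τ : State} {c : ℕ} (hb : b.Holds σ) (hP : Run P σ c τ) :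
      Run (.ite b P Q) σ (b.steps + c) τ
  | ite_false {b : Test} {P Q : Prog} {σ τ : State} {c : ℕ} (hb : ¬ b.Holds σ)
      (hQ : Run Q σ c τ) : Run (.ite b P Q) σ (b.steps + c) τ
  | loop_true {b : Test} {P : Prog} {σ τ ρ : State} {c d : ℕ} (hb : b.Holds σ)
      (hP : Run P σ c τ) (hL : Run (.loop b P) τ d ρ) : Run (.loop b P) σ (b.steps + c + d) ρ
  | loop_false {b : Test} {P : Prog} {σ : State} (hb : ¬ b.Holds σ) :
      Run (.loop b P) σ b.steps σ

/-! ### Input and output -/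

/-- The initial memory for the instance `I`: array `0` of natural numbers holds the number of
vertices, the number of edges, the terminals and the orientation flag; arrays `1`, `2`, `3` hold
the first endpoint, the second endpoint and the fault flag of every edge; array `0` of real
numbers holds the weights. All other cells are zero. -/
noncomputable def Instance.input (I : Instance) : State where
  nat a i :=
    match a with
    | 0 => [I.n, I.m, I.s.val, I.t.val, I.directed.toNat].getD i 0
    | 1 => if h : i < I.m then (I.src ⟨i, h⟩).val else 0
    | 2 => if h : i < I.m then (I.dst ⟨i, h⟩).val else 0
    | 3 => if h : i < I.m then (if (⟨i, h⟩ : Fin I.m) ∈ I.faulty then 1 else 0) else 0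
    | _ => 0
  wt a i :=
    match a with
    | 0 => if h : i < I.m then (I.weight ⟨i, h⟩ : ℝ) else 0
    | _ => 0

/-- The answer of a halted program: cell `0` of the array `4` tells whether a solution is returned,
and the array `5` holds the indicator vector of the returned edge set. -/
def Instance.output (I : Instance) (τ : State) : Option (Finset (Fin I.m)) :=
  if τ.nat 4 0 = 1 then some (Finset.univ.filter fun e => τ.nat 5 e.val = 1) else none

/-- The program `P` solves the fault-tolerant path problem with fault bound `k`, for all instances,
in a number of elementary operations that is polynomial in the size of the graph: it returns a
minimum-cost feasible solution if there is a feasible solution, and reports infeasibility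
otherwise. -/
def SolvesInPolyTime (k : ℕ) (P : Prog) : Prop :=
  ∃ poly : Polynomial ℕ, ∀ I : Instance, ∃ (c : ℕ) (τ : State),
    Run P I.input c τ ∧ c ≤ poly.eval (I.n + I.m) ∧
      (∀ S, I.output τ = some S → I.IsOptimal k S) ∧
      (I.output τ = none → ¬ ∃ S, I.IsFeasible k S)

end FTP

namespace FTP

/-! Feasibility is a statement about flows. Represent every edge by one arc for each direction in
which it can be traversed, and give the arcs of secure edges a second parallel copy. If an edge set
still connects `s` to `t` after any one failure, its arcs carry a flow of value two: route one path
and augment once (`RobConn.exists_isFlow`). A flow of value two with fewest arcs contains no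
circulation. It yields two arc-disjoint paths, and two common vertices in opposite orders, or a
faulty edge used by both paths, would close a circulation. Hence every feasible set contains a
robust bipath (`RobConn.exists_isRobustBipath`), and a minimal one equals it. Conversely, a single
failure can hit only one of the two paths of a bipath.

For the lengths, cut a bipath at its common vertices. Two consecutive segments are either
edge-disjoint or share a secure edge that joins their ends, so each costs at least its link;
different segments share no edge, so the costs add up (`LeLinks.exists_completePath`). In the other
direction, the links of a shortest path in the complete graph are unaffected by one failure, this
property is transitive, and costs of unions are subadditive (`Realizes.robConn_and_cost_le`). The
two bounds meet.

The algorithm evaluates the same shortest path within a given edge set `A`. Secure distances come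
from Bellman-Ford. The cheapest flow of value two comes from a shortest path followed by a shortest
augmenting path with respect to reduced costs (`Arcs.pairVal_eq`), and a last Bellman-Ford runs on
the complete graph. Such a flow may use an undirected edge in both directions, so `linkVal` is not
identified with the length function of the subgraph; it suffices that it is bounded by every link in
`A` and is attained by a set that survives one failure. No predecessors are stored: edges are
deleted greedily as long as the optimal value stays the same, and an inclusion-minimal set with that
value is itself optimal (`isOptimal_of_minimal`). The shortest path needed for augmentation is found
by the same deletion scheme. -/

/-- A directed multigraph: arcs of type `α` with a tail and a head. -/
structure Arcs (V α : Type*) where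
  /-- the tail of an arc -/
  tl : α → V
  /-- the head of an arc -/
  hd : α → V

/-! ### Walks, cuts and flows in directed multigraphs -/

namespace Arcs

variable {V α : Type*} (G : Arcs V α)

/-- The list `l` of arcs is a walk from `u` to `v`. -/
def Walk : V → List α → V → Prop
  | u, [], v => u = v
  | u, a :: l, v => G.tl a = u ∧ Walk (G.hd a) l v

variable {G}

theorem Walk.append {u x v : V} {l l' : List α} (h : G.Walk u l x) (h' : G.Walk x l' v) :
    G.Walk u (l ++ l') v := by
  induction l generalizing u with
  | nil => cases h; exact h'
  | cons a l ih => exact ⟨h.1, ih h.2⟩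

theorem Walk.split {u v : V} {l l' : List α} (h : G.Walk u (l ++ l') v) :
    ∃ x, G.Walk u l x ∧ G.Walk x l' v := by
  induction l generalizing u with
  | nil => exact ⟨u, rfl, h⟩
  | cons a l ih =>
    obtain ⟨x, h1, h2⟩ := ih h.2
    exact ⟨x, ⟨h.1, h1⟩, h2⟩

theorem Walk.exists_suffix {x z v : V} {l : List α} (h : G.Walk x l v)
    (hz : z ∈ x :: l.map G.hd) :
    ∃ l', l' <:+ l ∧ G.Walk z l' v ∧ (z :: l'.map G.hd) <:+ (x :: l.map G.hd) := by
  induction l generalizing x with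
  | nil =>
    simp only [List.map_nil, List.mem_singleton] at hz
    subst hz
    exact ⟨[], List.suffix_rfl, h, List.suffix_rfl⟩
  | cons a l ih =>
    rcases List.mem_cons.1 hz with rfl | hz
    · exact ⟨a :: l, List.suffix_rfl, h, List.suffix_rfl⟩
    · obtain ⟨l', h1, h2, h3⟩ := ih h.2 hz
      exact ⟨l', h1.trans (List.suffix_cons _ _), h2, h3.trans (List.suffix_cons _ _)⟩

/-- Built from the back: if the new initial vertex is already on the path, only the suffix from
there is kept. The conclusion is a sublist, not mere containment, so that sums of nonnegative costs
can be compared. -/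
theorem Walk.exists_path {u v : V} {l : List α} (h : G.Walk u l v) :
    ∃ l', l'.Sublist l ∧ G.Walk u l' v ∧ (u :: l'.map G.hd).Nodup := by
  induction l generalizing u with
  | nil => exact ⟨[], .slnil, h, by simp⟩
  | cons a l ih =>
    obtain ⟨l1, h1, h2, h3⟩ := ih h.2
    by_cases hu : u ∈ G.hd a :: l1.map G.hd
    · obtain ⟨l2, g1, g2, g3⟩ := h2.exists_suffix hu
      exact ⟨l2, (g1.sublist.trans h1).trans (List.sublist_cons_self _ _), g2,
        h3.sublist g3.sublist⟩
    · exact ⟨a :: l1, h1.cons_cons a, ⟨h.1, h2⟩, List.nodup_cons.2 ⟨hu, h3⟩⟩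

theorem Walk.sum_telescope {u v : V} {l : List α} (h : G.Walk u l v) (y : V → ℝ) :
    (l.map fun a => y (G.hd a) - y (G.tl a)).sum = y v - y u := by
  induction l generalizing u with
  | nil => cases h; simp
  | cons a l ih =>
    rw [List.map_cons, List.sum_cons, ih h.2, h.1]; ring

variable (G) in
/-- The set `B` of arcs is a flow of value `k` from `u` to `v`: its net outflow is `k` in `u`, `-k`
in `v` and `0` elsewhere (expressed by testing against potentials). -/
def IsFlow (B : Finset α) (k : ℕ) (u v : V) : Prop :=
  ∀ y : V → ℝ, ∑ a ∈ B, (y (G.hd a) - y (G.tl a)) = k * (y v - y u)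

theorem Walk.isFlow [DecidableEq α] {u v : V} {l : List α} (h : G.Walk u l v) (hl : l.Nodup) :
    G.IsFlow l.toFinset 1 u v := by
  intro y
  rw [List.sum_toFinset _ hl, h.sum_telescope]; simp

theorem IsFlow.sdiff [DecidableEq α] {B C : Finset α} {k j : ℕ} {u v : V}
    (hB : G.IsFlow B (k + j) u v) (hC : G.IsFlow C j u v) (h : C ⊆ B) :
    G.IsFlow (B \ C) k u v := by
  intro y
  have := Finset.sum_sdiff (f := fun a => y (G.hd a) - y (G.tl a)) h
  rw [hB y, hC y] at this
  push_cast at this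
  linarith

theorem IsFlow.union [DecidableEq α] {B C : Finset α} {k j : ℕ} {u v : V}
    (hB : G.IsFlow B k u v) (hC : G.IsFlow C j u v) (h : Disjoint B C) :
    G.IsFlow (B ∪ C) (k + j) u v := by
  intro y
  rw [Finset.sum_union h, hB y, hC y]
  push_cast
  ring

open Classical in
-- Test the flow against the indicator of the complement of `X`: leaving arcs contribute `1`,
-- entering arcs `-1`, all others `0`.
theorem IsFlow.le_card_cut {B : Finset α} {k : ℕ} {u v : V} (hB : G.IsFlow B k u v)
    (X : Set V) (hu : u ∈ X) (hv : v ∉ X) :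
    k ≤ (B.filter fun a => G.tl a ∈ X ∧ G.hd a ∉ X).card := by
  have h := hB fun x => if x ∈ X then 0 else 1
  simp only [hu, hv, if_true, if_false, sub_zero, mul_one] at h
  have h2 : (k : ℝ) ≤ ∑ a ∈ B, (if G.tl a ∈ X ∧ G.hd a ∉ X then (1 : ℝ) else 0) := by
    rw [← h]
    apply Finset.sum_le_sum
    intro a _
    by_cases h1 : G.tl a ∈ X <;> by_cases h2 : G.hd a ∈ X <;> simp [h1, h2]
  rw [← Finset.sum_filter, Finset.sum_const, nsmul_eq_mul, mul_one] at h2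
  exact_mod_cast h2

/-- No arc of `A` leaves the set of vertices reachable through `A`, so this set cannot separate `u`
from `v`. -/
theorem exists_walk_of_cuts {A : Set α} {u v : V}
    (h : ∀ X : Set V, u ∈ X → v ∉ X → ∃ a ∈ A, G.tl a ∈ X ∧ G.hd a ∉ X) :
    ∃ l, G.Walk u l v ∧ ∀ a ∈ l, a ∈ A := by
  by_contra hc
  obtain ⟨a, ha, ⟨l, hl, hlA⟩, h2⟩ := h {x | ∃ l, G.Walk u l x ∧ ∀ a ∈ l, a ∈ A}
    ⟨[], rfl, by simp⟩ hc
  refine h2 ⟨l ++ [a], hl.append ⟨rfl, rfl⟩, ?_⟩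
  intro b hb
  rcases List.mem_append.1 hb with hb | hb
  · exact hlA b hb
  · rw [List.mem_singleton.1 hb]; exact ha

theorem IsFlow.exists_path {B : Finset α} {k : ℕ} {u v : V} (hB : G.IsFlow B (k + 1) u v) :
    ∃ l, G.Walk u l v ∧ (∀ a ∈ l, a ∈ B) ∧ (u :: l.map G.hd).Nodup := by
  classical
  obtain ⟨l, hl, hlB⟩ : ∃ l, G.Walk u l v ∧ ∀ a ∈ l, a ∈ (B : Set α) := by
    apply exists_walk_of_cuts
    intro X hu hv
    have := hB.le_card_cut X hu hv
    obtain ⟨a, ha⟩ := Finset.card_pos.1 (lt_of_lt_of_le k.succ_pos this)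
    rw [Finset.mem_filter] at ha
    exact ⟨a, ha⟩
  obtain ⟨l', h1, h2, h3⟩ := hl.exists_path
  exact ⟨l', h2, fun a ha => hlB a (h1.subset ha), h3⟩

/-! ### Distances -/

variable (G) in
/-- The least cost of a walk. -/
noncomputable def dist (c : α → ℝ≥0∞) (u v : V) : ℝ≥0∞ :=
  ⨅ (l) (_ : G.Walk u l v), (l.map c).sum

variable {c : α → ℝ≥0∞}

theorem dist_le {u v : V} {l : List α} (h : G.Walk u l v) : G.dist c u v ≤ (l.map c).sum :=
  iInf₂_le l h

theorem dist_self (u : V) : G.dist c u u = 0 := by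
  have : G.dist c u u ≤ _ := dist_le (l := []) rfl
  simpa using this

theorem dist_hd_le (u : V) (a : α) : G.dist c u (G.hd a) ≤ G.dist c u (G.tl a) + c a := by
  conv_rhs => unfold dist
  simp only [ENNReal.iInf_add]
  refine le_iInf₂ fun l hl => ?_
  refine (dist_le (hl.append (l' := [a]) ⟨rfl, rfl⟩)).trans ?_
  simp

/-- Infinitely many walks compete, but each one of finite cost is dominated by a path, and only
finitely many arc sets consist of arcs of finite cost. The arc type itself may be infinite. -/
theorem exists_dist_eq (hc : {a | c a ≠ ⊤}.Finite) {u v : V} (h : G.dist c u v ≠ ⊤) :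
    ∃ l, G.Walk u l v ∧ (u :: l.map G.hd).Nodup ∧ (l.map c).sum = G.dist c u v := by
  classical
  let P : Finset α → Prop := fun B => ∃ l, G.Walk u l v ∧ (u :: l.map G.hd).Nodup ∧
    l.toFinset = B ∧ l.Nodup
  let T := hc.toFinset.powerset.filter P
  have key : ∀ l, G.Walk u l v → (l.map c).sum ≠ ⊤ → ∃ B ∈ T, ∑ a ∈ B, c a ≤ (l.map c).sum := by
    intro l hl hs
    obtain ⟨l', h1, h2, h3⟩ := hl.exists_path
    have hle : (l'.map c).sum ≤ (l.map c).sum := (h1.map c).sum_le_sum (fun _ _ => zero_le)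
    have hn : l'.Nodup := (List.nodup_cons.1 h3).2.of_map
    refine ⟨l'.toFinset, ?_, ?_⟩
    · simp only [T, Finset.mem_filter, Finset.mem_powerset]
      refine ⟨fun a ha => ?_, l', h2, h3, rfl, hn⟩
      simp only [Set.Finite.mem_toFinset, Set.mem_ofPred_eq]
      intro hat
      apply hs
      have : c a ≤ (l'.map c).sum :=
        List.single_le_sum (fun _ _ => zero_le) _ (List.mem_map_of_mem (List.mem_toFinset.1 ha))
      rw [hat, top_le_iff] at this
      rw [this] at hle
      exact top_le_iff.1 hle
    · rwa [List.sum_toFinset _ hn]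
  have hT : T.Nonempty := by
    have : ∃ l, G.Walk u l v ∧ (l.map c).sum ≠ ⊤ := by
      by_contra! hcon
      exact h (by simpa [dist, iInf_eq_top] using hcon)
    obtain ⟨l, hl, hs⟩ := this
    obtain ⟨B, hB, _⟩ := key l hl hs
    exact ⟨B, hB⟩
  obtain ⟨B, hB, hmin⟩ := T.exists_min_image (fun B => ∑ a ∈ B, c a) hT
  obtain ⟨l, hl, hn, hlB, hln⟩ := (Finset.mem_filter.1 hB).2
  refine ⟨l, hl, hn, le_antisymm (le_iInf₂ fun l' hl' => ?_) (dist_le hl)⟩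
  by_cases hs : (l'.map c).sum = ⊤
  · rw [hs]; exact le_top
  · obtain ⟨B', hB', hle⟩ := key l' hl' hs
    refine le_trans ?_ hle
    rw [← List.sum_toFinset _ hln, hlB]
    exact hmin B' hB'

/-! ### Cheapest flows of value two -/

variable (G) in
/-- The least cost of a flow of value two. -/
noncomputable def pairVal (c : α → ℝ≥0∞) (u v : V) : ℝ≥0∞ :=
  ⨅ (B : Finset α) (_ : G.IsFlow B 2 u v), ∑ a ∈ B, c a

theorem pairVal_eq_top_of_dist {u v : V} (h : G.dist c u v = ⊤) : G.pairVal c u v = ⊤ := by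
  classical
  simp only [pairVal, iInf_eq_top]
  intro B hB
  obtain ⟨l, hl, hlB, hn⟩ := hB.exists_path (k := 1)
  have hln : l.Nodup := (List.nodup_cons.1 hn).2.of_map
  have h1 : G.dist c u v ≤ _ := dist_le hl
  rw [h, ← List.sum_toFinset _ hln] at h1
  refine top_le_iff.1 (h1.trans (Finset.sum_le_sum_of_subset fun a ha => ?_))
  exact hlB a (List.mem_toFinset.1 ha)

theorem exists_pairVal_eq (hc : {a | c a ≠ ⊤}.Finite) {u v : V} (h : G.pairVal c u v ≠ ⊤) :
    ∃ B : Finset α, G.IsFlow B 2 u v ∧ ∑ a ∈ B, c a = G.pairVal c u v := by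
  classical
  let T := hc.toFinset.powerset.filter fun B : Finset α => G.IsFlow B 2 u v
  have key : ∀ B, G.IsFlow B 2 u v → ∑ a ∈ B, c a ≠ ⊤ → B ∈ T := by
    intro B hB hs
    refine Finset.mem_filter.2 ⟨Finset.mem_powerset.2 fun a ha => ?_, hB⟩
    simp only [Set.Finite.mem_toFinset, Set.mem_ofPred_eq]
    exact ne_top_of_le_ne_top hs (Finset.single_le_sum (f := c) (fun _ _ => zero_le) ha)
  have hne : T.Nonempty := by
    by_contra hcon
    refine h (iInf₂_eq_top.2 fun B hB => ?_)
    by_contra hs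
    exact hcon ⟨B, key B hB hs⟩
  obtain ⟨B, hB, hmin⟩ := T.exists_min_image (fun B => ∑ a ∈ B, c a) hne
  refine ⟨B, (Finset.mem_filter.1 hB).2, le_antisymm (le_iInf₂ fun B' hB' => ?_)
    (iInf₂_le B (Finset.mem_filter.1 hB).2)⟩
  by_cases hs : ∑ a ∈ B', c a = ⊤
  · rw [hs]; exact le_top
  · exact hmin B' (key B' hB' hs)

variable (G) in
/-- The distance from `u`, truncated at the distance of `v`. -/
noncomputable def pot (c : α → ℝ≥0∞) (u v x : V) : ℝ≥0∞ := min (G.dist c u x) (G.dist c u v)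

/-- Capping by a constant preserves the triangle inequality for distances. The cap makes the
potential finite at unreachable vertices too, provided that `v` is reachable at finite cost. -/
theorem pot_hd_le (u v : V) (a : α) :
    G.pot c u v (G.hd a) ≤ c a + G.pot c u v (G.tl a) := by
  unfold pot
  rw [← min_add_add_left]
  refine le_min ((min_le_left _ _).trans ?_) ((min_le_right _ _).trans le_add_self)
  rw [add_comm]; exact dist_hd_le u a

/-! ### Augmentation and reduced costs -/

variable [DecidableEq α]

variable (G) in
/-- Reverse the arcs of `p`. -/
def flip (p : Finset α) : Arcs V α where
  tl a := if a ∈ p then G.hd a else G.tl a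
  hd a := if a ∈ p then G.tl a else G.hd a

/-- The arcs of `r` inside `p` are run backwards, so their terms change sign and cancel against
those of `p`. -/
theorem sum_symmDiff_flip (p r : Finset α) (y : V → ℝ) :
    ∑ a ∈ symmDiff p r, (y (G.hd a) - y (G.tl a)) =
      ∑ a ∈ p, (y (G.hd a) - y (G.tl a)) +
        ∑ a ∈ r, (y ((G.flip p).hd a) - y ((G.flip p).tl a)) := by
  have h1 : ∑ a ∈ r, (y ((G.flip p).hd a) - y ((G.flip p).tl a)) =
      ∑ a ∈ r \ p, (y (G.hd a) - y (G.tl a)) - ∑ a ∈ r ∩ p, (y (G.hd a) - y (G.tl a)) := by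
    rw [← Finset.sum_sdiff (s₁ := r ∩ p) (s₂ := r) Finset.inter_subset_left,
      Finset.sdiff_inter_self_left, sub_eq_add_neg, ← Finset.sum_neg_distrib]
    congr 1
    · refine Finset.sum_congr rfl fun a ha => ?_
      simp [flip, (Finset.mem_sdiff.1 ha).2]
    · refine Finset.sum_congr rfl fun a ha => ?_
      simp [flip, (Finset.mem_inter.1 ha).2]
  have h2 : ∑ a ∈ p, (y (G.hd a) - y (G.tl a)) =
      ∑ a ∈ p \ r, (y (G.hd a) - y (G.tl a)) + ∑ a ∈ r ∩ p, (y (G.hd a) - y (G.tl a)) := by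
    rw [← Finset.sum_sdiff (s₁ := r ∩ p) (s₂ := p) Finset.inter_subset_right,
      Finset.sdiff_inter_self_right]
  rw [symmDiff, Finset.sup_eq_union, Finset.sum_union disjoint_sdiff_sdiff, h1, h2]
  ring

theorem IsFlow.augment {p r : Finset α} {u v : V} (hp : G.IsFlow p 1 u v)
    (hr : (G.flip p).IsFlow r 1 u v) : G.IsFlow (symmDiff p r) 2 u v := by
  intro y
  rw [sum_symmDiff_flip, hp y, hr y]
  push_cast; ring

variable (G) in
/-- The reduced costs for the residual graph of the flow `p`. -/
noncomputable def redCost (c : α → ℝ≥0∞) (u v : V) (p : Finset α) (a : α) : ℝ≥0∞ :=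
  if a ∈ p then 0 else c a + G.pot c u v (G.tl a) - G.pot c u v (G.hd a)

/-- One round of successive shortest paths, with linear programming duality for the lower bound. On
a flow of value two, cost and reduced cost differ by the constant `2 * D`, and the arcs of `p` have
reduced cost zero. Augmenting `p` along a shortest residual path gives the upper bound; for the
lower bound, the difference between any competitor and `p` is tested against residual distances. -/
theorem pairVal_eq {u v : V} (hc : {a | c a ≠ ⊤}.Finite) (hD : G.dist c u v ≠ ⊤) {p : Finset α}
    (hp : G.IsFlow p 1 u v) (hpc : ∑ a ∈ p, c a = G.dist c u v) :
    G.pairVal c u v =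
      G.dist c u v + G.dist c u v + (G.flip p).dist (G.redCost c u v p) u v := by
  set D := G.dist c u v with hDdef
  set π : V → ℝ := fun x => (G.pot c u v x).toReal with hπ
  have hpot : ∀ x, G.pot c u v x ≠ ⊤ := fun x =>
    ne_top_of_le_ne_top hD (min_le_right _ _)
  have hπu : π u = 0 := by simp [hπ, pot, dist_self]
  have hπv : π v = D.toReal := by simp [hπ, pot, hDdef]
  set rc : α → ℝ := fun a => (c a).toReal + π (G.tl a) - π (G.hd a) with hrc
  have hrc0 : ∀ a, c a ≠ ⊤ → 0 ≤ rc a := by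
    intro a ha
    have := ENNReal.toReal_mono (ENNReal.add_ne_top.2 ⟨ha, hpot _⟩) (pot_hd_le (c := c) u v a)
    rw [ENNReal.toReal_add ha (hpot _)] at this
    simp only [hrc, hπ]; linarith
  have hred : ∀ a, a ∉ p → c a ≠ ⊤ → G.redCost c u v p a = ENNReal.ofReal (rc a) := by
    intro a hap ha
    rw [redCost, if_neg hap, hrc, ENNReal.ofReal_sub _ ENNReal.toReal_nonneg,
      ENNReal.ofReal_add ENNReal.toReal_nonneg ENNReal.toReal_nonneg,
      ENNReal.ofReal_toReal ha, ENNReal.ofReal_toReal (hpot _), ENNReal.ofReal_toReal (hpot _)]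
  have hpfin : ∀ a ∈ p, c a ≠ ⊤ := fun a ha =>
    ne_top_of_le_ne_top (hpc ▸ hD) (Finset.single_le_sum (f := c) (fun _ _ => zero_le) ha)
  -- costs and reduced costs of flows
  have hsum : ∀ (B : Finset α) (k : ℕ), G.IsFlow B k u v →
      ∑ a ∈ B, (c a).toReal = ∑ a ∈ B, rc a + k * D.toReal := by
    intro B k hB
    have := hB π
    rw [hπu, hπv, sub_zero] at this
    rw [← this, ← Finset.sum_add_distrib]
    refine Finset.sum_congr rfl fun a _ => ?_
    simp only [hrc]; ring
  -- The reduced costs on `p` are nonnegative and sum to the cost of `p` minus `D`, which is zero.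
  -- This justifies cost zero for the reversed arcs in `redCost`.
  have hptight : ∀ a ∈ p, rc a = 0 := by
    have h1 := hsum p 1 hp
    rw [← ENNReal.toReal_sum hpfin, hpc] at h1
    have h2 : ∑ a ∈ p, rc a = 0 := by push_cast at h1; linarith
    exact (Finset.sum_eq_zero_iff_of_nonneg fun a ha => hrc0 a (hpfin a ha)).1 h2
  have hoff : ∀ B : Finset α, ∑ a ∈ B, rc a = ∑ a ∈ B \ p, rc a := by
    intro B
    rw [← Finset.sum_sdiff (s₁ := B ∩ p) (s₂ := B) Finset.inter_subset_left,
      Finset.sdiff_inter_self_left]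
    rw [Finset.sum_eq_zero (s := B ∩ p) fun a ha => hptight a (Finset.mem_inter.1 ha).2, add_zero]
  set D' := (G.flip p).dist (G.redCost c u v p) u v with hD'
  apply le_antisymm
  · -- an augmenting path yields a flow
    by_cases hD't : D' = ⊤
    · rw [hD't, add_top]; exact le_top
    have hfin : {a | G.redCost c u v p a ≠ ⊤}.Finite := by
      refine (hc.union p.finite_toSet).subset fun a ha => ?_
      by_cases hap : a ∈ p
      · exact Or.inr hap
      · left
        intro hat
        apply ha
        rw [redCost, if_neg hap, hat, top_add, ENNReal.top_sub (hpot _)]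
    obtain ⟨l, hl, hln, hls⟩ := exists_dist_eq hfin hD't
    have hlnd : l.Nodup := (List.nodup_cons.1 hln).2.of_map
    have hflow := hp.augment (hl.isFlow hlnd)
    set r := l.toFinset with hr
    have hrs : ∑ a ∈ r, G.redCost c u v p a = D' := by
      rw [hr, List.sum_toFinset _ hlnd, hls]
    have hrfin : ∀ a ∈ r, c a ≠ ⊤ := by
      intro a ha
      by_cases hap : a ∈ p
      · exact hpfin a hap
      intro hat
      have : G.redCost c u v p a ≤ ∑ a ∈ r, G.redCost c u v p a :=
        Finset.single_le_sum (f := G.redCost c u v p) (fun _ _ => zero_le) ha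
      rw [hrs, redCost, if_neg hap, hat, top_add, ENNReal.top_sub (hpot _), top_le_iff] at this
      exact hD't this
    have hBfin : ∀ a ∈ symmDiff p r, c a ≠ ⊤ := by
      intro a ha
      rcases Finset.mem_symmDiff.1 ha with h | h
      · exact hpfin a h.1
      · exact hrfin a h.1
    refine (iInf₂_le (symmDiff p r) hflow).trans ?_
    have h1 := hsum _ 2 hflow
    have h2 : symmDiff p r \ p = r \ p := by
      ext a; simp only [Finset.mem_sdiff, Finset.mem_symmDiff]; tauto
    rw [hoff, h2] at h1
    have h3 : ∑ a ∈ r \ p, rc a ≤ D'.toReal := by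
      rw [← hrs]
      have hfin2 : ∀ a ∈ r, G.redCost c u v p a ≠ ⊤ := fun a ha =>
        ne_top_of_le_ne_top (hrs ▸ hD't)
          (Finset.single_le_sum (f := G.redCost c u v p) (fun _ _ => zero_le) ha)
      rw [ENNReal.toReal_sum hfin2]
      refine le_trans (le_of_eq ?_) (Finset.sum_le_sum_of_subset_of_nonneg
        (Finset.sdiff_subset (t := p)) fun _ _ _ => ENNReal.toReal_nonneg)
      refine Finset.sum_congr rfl fun a ha => ?_
      rw [Finset.mem_sdiff] at ha
      rw [hred a ha.2 (hrfin a ha.1), ENNReal.toReal_ofReal (hrc0 a (hrfin a ha.1))]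
    rw [← ENNReal.toReal_le_toReal (ENNReal.sum_ne_top.2 hBfin)
      (ENNReal.add_ne_top.2 ⟨ENNReal.add_ne_top.2 ⟨hD, hD⟩, hD't⟩),
      ENNReal.toReal_add (ENNReal.add_ne_top.2 ⟨hD, hD⟩) hD't, ENNReal.toReal_add hD hD,
      ENNReal.toReal_sum hBfin, h1]
    push_cast
    linarith
  · refine le_iInf₂ fun B hB => ?_
    by_cases hBt : ∑ a ∈ B, c a = ⊤
    · rw [hBt]; exact le_top
    have hBfin : ∀ a ∈ B, c a ≠ ⊤ := fun a ha =>
      ne_top_of_le_ne_top hBt (Finset.single_le_sum (f := c) (fun _ _ => zero_le) ha)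
    -- The residual distance may be infinite, so it is capped at an arbitrary finite `K` to give a
    -- real dual potential `y`.
    have key : ∀ K : ℝ≥0, (K : ℝ≥0∞) ≤ D' →
        D.toReal + D.toReal + K ≤ (∑ a ∈ B, c a).toReal := by
      intro K hK
      set y : V → ℝ := fun x =>
        (min ((G.flip p).dist (G.redCost c u v p) u x) (K : ℝ≥0∞)).toReal with hy
      have hyu : y u = 0 := by simp [hy, dist_self]
      have hyv : y v = K := by simp [hy, ← hD', min_eq_right hK]
      have hstep : ∀ a, G.redCost c u v p a ≠ ⊤ →
          y ((G.flip p).hd a) ≤ y ((G.flip p).tl a) + (G.redCost c u v p a).toReal := by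
        intro a ha
        simp only [hy]
        have hf : ∀ z : ℝ≥0∞, min z (K : ℝ≥0∞) ≠ ⊤ := fun z =>
          ne_top_of_le_ne_top ENNReal.coe_ne_top (min_le_right _ _)
        rw [← ENNReal.toReal_add (hf _) ha]
        refine ENNReal.toReal_mono (ENNReal.add_ne_top.2 ⟨hf _, ha⟩) ?_
        rw [← min_add_add_right]
        exact min_le_min (dist_hd_le u a) le_self_add
      have h1 := hsum B 2 hB
      rw [hoff] at h1
      -- Arcs off `p` keep their direction in the residual network, so `y` rises along them by at
      -- most the reduced cost.
      have h2 : ∑ a ∈ B \ p, (y (G.hd a) - y (G.tl a)) ≤ ∑ a ∈ B \ p, rc a := by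
        refine Finset.sum_le_sum fun a ha => ?_
        rw [Finset.mem_sdiff] at ha
        have e := hred a ha.2 (hBfin a ha.1)
        have h := hstep a (by rw [e]; exact ENNReal.ofReal_ne_top)
        rw [e, ENNReal.toReal_ofReal (hrc0 a (hBfin a ha.1))] at h
        simp only [flip, ha.2, if_false] at h
        linarith
      -- Arcs of `p` are reversed at cost zero, so `y` cannot decrease along their original
      -- direction.
      have h3 : 0 ≤ ∑ a ∈ p \ B, (y (G.hd a) - y (G.tl a)) := by
        refine Finset.sum_nonneg fun a ha => ?_
        rw [Finset.mem_sdiff] at ha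
        have e : G.redCost c u v p a = 0 := by rw [redCost, if_pos ha.1]
        have h := hstep a (by rw [e]; exact ENNReal.zero_ne_top)
        simp only [flip, ha.1, if_true, e, ENNReal.toReal_zero] at h
        linarith
      have h4 : ∑ a ∈ B \ p, (y (G.hd a) - y (G.tl a)) -
          ∑ a ∈ p \ B, (y (G.hd a) - y (G.tl a)) =
          ∑ a ∈ B, (y (G.hd a) - y (G.tl a)) - ∑ a ∈ p, (y (G.hd a) - y (G.tl a)) := by
        have e1 := Finset.sum_inter_add_sum_sdiff B p fun a => y (G.hd a) - y (G.tl a)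
        have e2 := Finset.sum_inter_add_sum_sdiff p B fun a => y (G.hd a) - y (G.tl a)
        rw [Finset.inter_comm] at e2
        linarith
      rw [hB y, hp y, hyu, hyv] at h4
      rw [ENNReal.toReal_sum hBfin, h1]
      push_cast at h4 ⊢
      linarith
    -- Letting `K` grow also shows that `D'` is finite as soon as some competitor has finite cost.
    have h5 : D' ≤ ENNReal.ofReal ((∑ a ∈ B, c a).toReal - (D.toReal + D.toReal)) := by
      refine ENNReal.le_of_forall_nnreal_lt fun K hK => ?_
      have := key K hK.le
      rw [← ENNReal.ofReal_coe_nnreal]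
      exact ENNReal.ofReal_le_ofReal (by linarith)
    -- With `K = 0` the bound says that the difference inside `ENNReal.ofReal` is nonnegative, so
    -- nothing is truncated.
    have h6 := key 0 (by simp)
    rw [← ENNReal.ofReal_toReal hBt]
    calc D + D + D' ≤ ENNReal.ofReal (D.toReal + D.toReal) +
          ENNReal.ofReal ((∑ a ∈ B, c a).toReal - (D.toReal + D.toReal)) := by
          gcongr
          rw [ENNReal.ofReal_add ENNReal.toReal_nonneg ENNReal.toReal_nonneg,
            ENNReal.ofReal_toReal hD]
      _ = _ := by
          rw [← ENNReal.ofReal_add (by positivity) (by simp at h6; linarith)]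
          congr 1; ring

end Arcs

namespace Instance

variable {I : Instance}

/-! ### Walks -/

theorem Joins.eq_or_swap {e : Fin I.m} {u v x y : Fin I.n} (h : I.Joins e u v)
    (h' : I.Joins e x y) : (u = x ∧ v = y) ∨ (u = y ∧ v = x) := by
  unfold Joins at h h'
  rcases h with ⟨rfl, rfl⟩ | ⟨_, rfl, rfl⟩ <;> rcases h' with ⟨rfl, rfl⟩ | ⟨_, rfl, rfl⟩ <;> simp

theorem IsWalk.append {u x v : Fin I.n} {p q : List (Fin I.m × Fin I.n)} (h : I.IsWalk u p x)
    (h' : I.IsWalk x q v) : I.IsWalk u (p ++ q) v := by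
  induction p generalizing u with
  | nil => cases h; exact h'
  | cons a p ih => exact ⟨h.1, ih h.2⟩

theorem IsWalk.split {u v : Fin I.n} {p q : List (Fin I.m × Fin I.n)} (h : I.IsWalk u (p ++ q) v) :
    ∃ x, I.IsWalk u p x ∧ I.IsWalk x q v := by
  induction p generalizing u with
  | nil => exact ⟨u, rfl, h⟩
  | cons a p ih =>
    obtain ⟨x, h1, h2⟩ := ih h.2
    exact ⟨x, ⟨h.1, h1⟩, h2⟩

theorem IsWalk.mem_support {u v : Fin I.n} {p : List (Fin I.m × Fin I.n)} (h : I.IsWalk u p v) :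
    v ∈ I.support u p := by
  induction p generalizing u with
  | nil => cases h; simp [support]
  | cons a p ih => exact List.mem_cons_of_mem _ (ih h.2)

theorem IsWalk.exists_joins {u v : Fin I.n} {p : List (Fin I.m × Fin I.n)} (h : I.IsWalk u p v)
    {e : Fin I.m} (he : e ∈ I.edges p) :
    ∃ a x, I.Joins e a x ∧ a ∈ I.support u p ∧ x ∈ p.map Prod.snd ∧
      ((I.support u p).Nodup → a ≠ x) := by
  induction p generalizing u with
  | nil => simp [edges] at he
  | cons b p ih =>
    obtain ⟨f, y⟩ := b
    by_cases hef : e = f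
    · subst hef
      refine ⟨u, y, h.1, by simp [support], by simp, fun hn hu => ?_⟩
      simp [support, hu] at hn
    · have he' : e ∈ I.edges p := by
        simp only [edges, List.map_cons, List.toFinset_cons, Finset.mem_insert] at he
        exact he.resolve_left hef
      obtain ⟨a, x, h1, h2, h3, h4⟩ := ih h.2 he'
      exact ⟨a, x, h1, List.mem_cons_of_mem _ h2, List.mem_cons_of_mem _ h3,
        fun hn => h4 (List.nodup_cons.1 hn).2⟩

theorem IsWalk.mem_support_of_joins {u v a x : Fin I.n} {p : List (Fin I.m × Fin I.n)}
    (h : I.IsWalk u p v) {e : Fin I.m} (he : e ∈ I.edges p) (hj : I.Joins e a x) :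
    a ∈ I.support u p ∧ x ∈ I.support u p := by
  obtain ⟨b, y, h1, h2, h3, _⟩ := h.exists_joins he
  have h3' : y ∈ I.support u p := List.mem_cons_of_mem _ h3
  rcases hj.eq_or_swap h1 with ⟨rfl, rfl⟩ | ⟨rfl, rfl⟩
  · exact ⟨h2, h3'⟩
  · exact ⟨h3', h2⟩

/-- Traversing the first edge again would visit the initial vertex again. -/
theorem IsPath.nodup_fst {u v : Fin I.n} {p : List (Fin I.m × Fin I.n)} (h : I.IsPath u p v) :
    (p.map Prod.fst).Nodup := by
  obtain ⟨h, hn⟩ := h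
  induction p generalizing u with
  | nil => simp
  | cons b p ih =>
    have hn' := List.nodup_cons.1 hn
    rw [List.map_cons, List.nodup_cons]
    refine ⟨fun he => ?_, ih h.2 hn'.2⟩
    exact hn'.1 (h.2.mem_support_of_joins (List.mem_toFinset.2 he) h.1).1

theorem IsPath.cost_edges {u v : Fin I.n} {p : List (Fin I.m × Fin I.n)} (h : I.IsPath u p v) :
    I.cost (I.edges p) = (p.map fun b => I.weight b.1).sum := by
  rw [cost, edges, List.sum_toFinset _ h.nodup_fst, List.map_map]; rfl

theorem cost_mono {S T : Finset (Fin I.m)} (h : S ⊆ T) : I.cost S ≤ I.cost T :=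
  Finset.sum_le_sum_of_subset h

theorem cost_union_le (S T : Finset (Fin I.m)) : I.cost (S ∪ T) ≤ I.cost S + I.cost T := by
  rw [cost, cost, cost, ← Finset.sum_union_inter]; exact le_self_add

theorem edges_append (p q : List (Fin I.m × Fin I.n)) :
    I.edges (p ++ q) = I.edges p ∪ I.edges q := by
  simp [edges]

/-! ### Connectivity through cuts -/

variable (I) in
/-- The edge set `S` leaves every vertex set that contains `u` but not `v`. -/
def Conn (S : Finset (Fin I.m)) (u v : Fin I.n) : Prop :=
  ∀ X : Set (Fin I.n), u ∈ X → v ∉ X → ∃ e ∈ S, ∃ x ∈ X, ∃ y ∉ X, I.Joins e x y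

theorem Conn.trans {S : Finset (Fin I.m)} {u v x : Fin I.n} (h : I.Conn S u x)
    (h' : I.Conn S x v) : I.Conn S u v := fun X hu hv => by
  by_cases hx : x ∈ X
  · exact h' X hx hv
  · exact h X hu hx

theorem Conn.mono {S T : Finset (Fin I.m)} {u v : Fin I.n} (h : I.Conn S u v) (hST : S ⊆ T) :
    I.Conn T u v := fun X hu hv =>
  let ⟨e, he, hx⟩ := h X hu hv
  ⟨e, hST he, hx⟩

theorem IsWalk.conn {u v : Fin I.n} {p : List (Fin I.m × Fin I.n)} (h : I.IsWalk u p v) :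
    I.Conn (I.edges p) u v := by
  induction p generalizing u with
  | nil => cases h; exact fun X hu hv => (hv hu).elim
  | cons b p ih =>
    refine Conn.trans (x := b.2) (fun X hu hv => ?_) ((ih h.2).mono (by simp [edges]))
    exact ⟨b.1, by simp [edges], u, hu, b.2, hv, h.1⟩

variable (I) in
/-- Every vertex pair and every edge gives two parallel arcs. -/
def arcs : Arcs (Fin I.n) (Fin I.m × Fin I.n × Fin I.n × Bool) where
  tl a := a.2.1
  hd a := a.2.2.1

open Classical in
variable (I) in
/-- The arcs that represent the edges in `S`: one arc for each direction in which an edge can be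
traversed, and a second copy for secure edges. -/
noncomputable def arcsIn (S : Finset (Fin I.m)) : Finset (Fin I.m × Fin I.n × Fin I.n × Bool) :=
  Finset.univ.filter fun a =>
    a.1 ∈ S ∧ I.Joins a.1 a.2.1 a.2.2.1 ∧ (a.2.2.2 = true → a.1 ∉ I.faulty)

theorem mem_arcsIn {S : Finset (Fin I.m)} {a : Fin I.m × Fin I.n × Fin I.n × Bool} :
    a ∈ I.arcsIn S ↔
      a.1 ∈ S ∧ I.Joins a.1 a.2.1 a.2.2.1 ∧ (a.2.2.2 = true → a.1 ∉ I.faulty) := by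
  simp [arcsIn]

variable (I) in
/-- The walk of the instance that corresponds to a list of arcs. -/
def ofArcs (l : List (Fin I.m × Fin I.n × Fin I.n × Bool)) : List (Fin I.m × Fin I.n) :=
  l.map fun a => (a.1, a.2.2.1)

theorem support_ofArcs (u : Fin I.n) (l : List (Fin I.m × Fin I.n × Fin I.n × Bool)) :
    I.support u (I.ofArcs l) = u :: l.map I.arcs.hd := by
  simp [support, ofArcs, arcs]

theorem mem_edges_ofArcs {l : List (Fin I.m × Fin I.n × Fin I.n × Bool)} {e : Fin I.m} :
    e ∈ I.edges (I.ofArcs l) ↔ ∃ a ∈ l, a.1 = e := by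
  simp [edges, ofArcs]

theorem isWalk_ofArcs {u v : Fin I.n} {S : Finset (Fin I.m)}
    {l : List (Fin I.m × Fin I.n × Fin I.n × Bool)}
    (h : I.arcs.Walk u l v) (hl : ∀ a ∈ l, a ∈ I.arcsIn S) : I.IsWalk u (I.ofArcs l) v := by
  induction l generalizing u with
  | nil => exact h
  | cons a l ih =>
    refine ⟨?_, ih h.2 fun b hb => hl b (List.mem_cons_of_mem _ hb)⟩
    have := (mem_arcsIn.1 (hl a (by simp))).2.1
    rw [← h.1]; exact this

theorem edges_ofArcs_subset {S : Finset (Fin I.m)}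
    {l : List (Fin I.m × Fin I.n × Fin I.n × Bool)} (hl : ∀ a ∈ l, a ∈ I.arcsIn S) :
    I.edges (I.ofArcs l) ⊆ S := by
  intro e he
  obtain ⟨a, ha, rfl⟩ := mem_edges_ofArcs.1 he
  exact (mem_arcsIn.1 (hl a ha)).1

theorem Conn.exists_walk_arcs {S : Finset (Fin I.m)} {u v : Fin I.n} (h : I.Conn S u v) :
    ∃ l, I.arcs.Walk u l v ∧ (u :: l.map I.arcs.hd).Nodup ∧
      ∀ a ∈ l, a ∈ I.arcsIn S ∧ a.2.2.2 = false := by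
  obtain ⟨l, h1, h2⟩ := Arcs.exists_walk_of_cuts (G := I.arcs)
    (A := {a | a ∈ I.arcsIn S ∧ a.2.2.2 = false}) (u := u) (v := v) fun X hu hv => by
      obtain ⟨e, he, x, hx, y, hy, hj⟩ := h X hu hv
      exact ⟨(e, x, y, false), ⟨mem_arcsIn.2 ⟨he, hj, by simp⟩, rfl⟩, hx, hy⟩
  obtain ⟨l', h3, h4, h5⟩ := h1.exists_path
  exact ⟨l', h4, h5, fun a ha => h2 a (h3.subset ha)⟩

/-- The translation between paths and cuts. Cuts are preferred below because transitivity needs no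
gluing and shortcutting of paths. -/
theorem conn_iff {S : Finset (Fin I.m)} {u v : Fin I.n} :
    I.Conn S u v ↔ ∃ p, I.IsPath u p v ∧ I.edges p ⊆ S := by
  constructor
  · intro h
    obtain ⟨l, h1, h2, h3⟩ := h.exists_walk_arcs
    refine ⟨I.ofArcs l, ⟨isWalk_ofArcs h1 fun a ha => (h3 a ha).1, ?_⟩,
      edges_ofArcs_subset fun a ha => (h3 a ha).1⟩
    rwa [support_ofArcs]
  · rintro ⟨p, h, hp⟩
    exact h.1.conn.mono hp

variable (I) in
/-- `S` connects `u` to `v` after the failure of any one faulty edge. -/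
def RobConn (S : Finset (Fin I.m)) (u v : Fin I.n) : Prop :=
  ∀ F ⊆ I.faulty, F.card ≤ 1 → I.Conn (S \ F) u v

theorem isFeasible_iff {S : Finset (Fin I.m)} : I.IsFeasible 1 S ↔ I.RobConn S I.s I.t := by
  simp only [IsFeasible, RobConn, conn_iff]

theorem RobConn.trans {S : Finset (Fin I.m)} {u v x : Fin I.n} (h : I.RobConn S u x)
    (h' : I.RobConn S x v) : I.RobConn S u v :=
  fun F hF hc => (h F hF hc).trans (h' F hF hc)

theorem RobConn.mono {S T : Finset (Fin I.m)} {u v : Fin I.n} (h : I.RobConn S u v)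
    (hST : S ⊆ T) : I.RobConn T u v :=
  fun F hF hc => (h F hF hc).mono (Finset.sdiff_subset_sdiff hST le_rfl)

theorem robConn_self (S : Finset (Fin I.m)) (u : Fin I.n) : I.RobConn S u u :=
  fun _ _ _ _ hu hv => (hv hu).elim

/-- If the failure hits `p`, it is a single faulty edge of `p`, which by hypothesis is not on `q`.
-/
theorem robConn_of_walks {u v : Fin I.n} {p q : List (Fin I.m × Fin I.n)}
    (hp : I.IsWalk u p v) (hq : I.IsWalk u q v) (h : I.edges p ∩ I.edges q ∩ I.faulty = ∅) :
    I.RobConn (I.edges p ∪ I.edges q) u v := by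
  intro F hF hc
  by_cases hd : Disjoint (I.edges p) F
  · exact hp.conn.mono fun e he => Finset.mem_sdiff.2
      ⟨Finset.mem_union_left _ he, Finset.disjoint_left.1 hd he⟩
  · obtain ⟨f, hfp, hfF⟩ := Finset.not_disjoint_iff.1 hd
    refine hq.conn.mono fun e he => Finset.mem_sdiff.2 ⟨Finset.mem_union_right _ he, fun heF => ?_⟩
    have := Finset.card_le_one.1 hc e heF f hfF
    subst this
    have : e ∈ I.edges p ∩ I.edges q ∩ I.faulty := by simp [hfp, he, hF heF]
    rw [h] at this
    simp at this

theorem robConn_of_isSecurePath {u v : Fin I.n} {p : List (Fin I.m × Fin I.n)}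
    (h : I.IsSecurePath u p v) : I.RobConn (I.edges p) u v := by
  have := robConn_of_walks h.1.1 h.1.1 (by
    rw [Finset.inter_self]; exact Finset.disjoint_iff_inter_eq_empty.1 h.2)
  rwa [Finset.union_self] at this

theorem robConn_of_isDisjointPair {u v : Fin I.n} {p q : List (Fin I.m × Fin I.n)}
    (h : I.IsDisjointPair u p q v) : I.RobConn (I.edges p ∪ I.edges q) u v :=
  robConn_of_walks h.1.1 h.2.1.1 (by
    rw [Finset.disjoint_iff_inter_eq_empty.1 h.2.2, Finset.empty_inter])

/-! ### Robust bipaths -/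

theorem IsRobustBipath.isFeasible {Q : Finset (Fin I.m)} (h : I.IsRobustBipath Q) :
    I.IsFeasible 1 Q := by
  obtain ⟨p, q, hp, hq, rfl, -, hf⟩ := h
  exact isFeasible_iff.2 (robConn_of_walks hp.1 hq.1 hf)

/-- Max-flow min-cut for value two. A path `p` of first copies is augmented once; a residual cut
blocking the augmentation would be crossed by a single arc of `p`, and both a faulty and a secure
edge are impossible there. -/
theorem RobConn.exists_isFlow {S : Finset (Fin I.m)} {u v : Fin I.n} (h : I.RobConn S u v) :
    ∃ B ⊆ I.arcsIn S, I.arcs.IsFlow B 2 u v := by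
  classical
  obtain ⟨l, h1, h2, h3⟩ := ((h ∅ (by simp) (by simp)).mono (Finset.sdiff_subset)).exists_walk_arcs
  have hp := h1.isFlow (List.nodup_cons.1 h2).2.of_map
  have hpS : ∀ a ∈ l.toFinset, a ∈ I.arcsIn S ∧ a.2.2.2 = false := fun a ha =>
    h3 a (List.mem_toFinset.1 ha)
  set p := l.toFinset
  obtain ⟨r, g1, g2⟩ := Arcs.exists_walk_of_cuts (G := I.arcs.flip p)
    (A := {a | a ∈ I.arcsIn S}) (u := u) (v := v) fun X hu hv => by
      -- Suppose no residual arc leaves `X`: then arcs outside `p` do not leave `X`, and arcs of `p`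
      -- do not enter it.
      by_contra! hcon
      have hout : ∀ a ∈ I.arcsIn S, a ∉ p → a.2.1 ∈ X → a.2.2.1 ∈ X := by
        intro a ha hap hx
        have := hcon a ha
        simpa [Arcs.flip, hap, arcs, hx] using this
      have hin : ∀ a ∈ p, a.2.2.1 ∈ X → a.2.1 ∈ X := by
        intro a hap hx
        have := hcon a (hpS a hap).1
        simpa [Arcs.flip, hap, arcs, hx] using this
      -- As no arc of `p` enters `X`, the net flow `1` across the cut counts the leaving arcs.
      have hcard : (p.filter fun a => a.2.1 ∈ X ∧ a.2.2.1 ∉ X).card = 1 := by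
        have hy := hp fun x => if x ∈ X then 0 else 1
        simp only [hu, hv, if_true, if_false, sub_zero, mul_one, Nat.cast_one] at hy
        have : ∑ a ∈ p, (if a.2.1 ∈ X ∧ a.2.2.1 ∉ X then (1 : ℝ) else 0) = 1 := by
          refine Eq.trans (Finset.sum_congr rfl fun a ha => ?_) hy
          by_cases k1 : a.2.1 ∈ X <;> by_cases k2 : a.2.2.1 ∈ X
          · simp [arcs, k1, k2]
          · simp [arcs, k1, k2]
          · exact absurd (hin a ha k2) k1
          · simp [arcs, k1, k2]
        rw [← Finset.sum_filter, Finset.sum_const, nsmul_eq_mul, mul_one] at this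
        exact_mod_cast this
      obtain ⟨b, hb⟩ := Finset.card_eq_one.1 hcard
      have hbm : b ∈ p.filter fun a => a.2.1 ∈ X ∧ a.2.2.1 ∉ X := by rw [hb]; simp
      obtain ⟨hbp, hb1, hb2⟩ := Finset.mem_filter.1 hbm
      obtain ⟨hbS, hbc⟩ := hpS b hbp
      have hbS' := mem_arcsIn.1 hbS
      by_cases hbf : b.1 ∈ I.faulty
      -- When the edge of `b` fails, another edge still leaves `X`. Its first copy must lie on `p`,
      -- hence equals `b`, a contradiction.
      · obtain ⟨e, he, x, hx, y, hy, hj⟩ := h {b.1} (by simpa using hbf) (by simp) X hu hv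
        rw [Finset.mem_sdiff, Finset.mem_singleton] at he
        have ha : (e, x, y, false) ∈ I.arcsIn S := mem_arcsIn.2 ⟨he.1, hj, by simp⟩
        have hap : (e, x, y, false) ∈ p := by
          by_contra hap
          exact hy (hout _ ha hap hx)
        have : (e, x, y, false) ∈ p.filter fun a => a.2.1 ∈ X ∧ a.2.2.1 ∉ X :=
          Finset.mem_filter.2 ⟨hap, hx, hy⟩
        rw [hb, Finset.mem_singleton] at this
        exact he.2 (by rw [← this])
      -- For a secure edge the second copy of `b` leaves `X` as well, and it is not on `p`, which
      -- consists of first copies.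
      · refine hb2 (hout (b.1, b.2.1, b.2.2.1, true)
          (mem_arcsIn.2 ⟨hbS'.1, hbS'.2.1, fun _ => hbf⟩) (fun hap => ?_) hb1)
        simpa using (hpS _ hap).2
  obtain ⟨r', g3, g4, g5⟩ := g1.exists_path
  refine ⟨_, fun a ha => ?_, hp.augment (g4.isFlow (List.nodup_cons.1 g5).2.of_map)⟩
  rcases Finset.mem_symmDiff.1 ha with ha | ha
  · exact (hpS a ha.1).1
  · exact g2 a (g3.subset (List.mem_toFinset.1 ha.1))

end Instance

/-! ### From flows with fewest arcs to robust bipaths -/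

namespace Arcs

variable {V α : Type*} {G : Arcs V α} [DecidableEq V]

/-- Only the membership of `v` is assumed: the index of an absent element is the length of the list,
so the strict inequality already places `u` on the walk. -/
theorem Walk.exists_subwalk {u v x z : V} {l : List α} (h : G.Walk x l z)
    (hv : v ∈ x :: l.map G.hd)
    (huv : (x :: l.map G.hd).idxOf u < (x :: l.map G.hd).idxOf v) :
    ∃ l', G.Walk u l' v ∧ l'.Sublist l := by
  induction l generalizing x with
  | nil =>
    simp only [List.map_nil, List.mem_singleton] at hv
    subst hv
    simp at huv
  | cons a l ih =>
    have hvx : x ≠ v := by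
      rintro rfl
      simp at huv
    have hv' : v ∈ G.hd a :: l.map G.hd := by
      rcases List.mem_cons.1 hv with h | h
      · exact absurd h.symm hvx
      · exact h
    by_cases hux : x = u
    · subst hux
      have : ∀ (l : List α) (x z : V), G.Walk x l z → v ∈ x :: l.map G.hd →
          ∃ l', G.Walk x l' v ∧ l'.Sublist l := by
        intro l
        induction l with
        | nil =>
          intro x z h hv
          simp only [List.map_nil, List.mem_singleton] at hv
          exact ⟨[], hv.symm, .slnil⟩
        | cons a l ih =>
          intro x z h hv
          rcases List.mem_cons.1 hv with rfl | hv
          · exact ⟨[], rfl, List.nil_sublist _⟩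
          · obtain ⟨l', h1, h2⟩ := ih _ _ h.2 hv
            exact ⟨a :: l', ⟨h.1, h1⟩, h2.cons_cons a⟩
      exact this (a :: l) x z h hv
    · rw [List.idxOf_cons_ne _ hux, List.idxOf_cons_ne _ hvx, Nat.succ_lt_succ_iff] at huv
      obtain ⟨l', h1, h2⟩ := ih h.2 hv' huv
      exact ⟨l', h1, h2.cons a⟩

end Arcs

namespace Instance

variable {I : Instance}

/-- Removing a circulation from a flow leaves a flow of the same value, so a flow with fewest arcs
contains none. Both defining properties of a bipath follow, because a violation exhibits a
circulation made of arcs of the two peeled-off paths. -/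
theorem RobConn.exists_isRobustBipath {S : Finset (Fin I.m)} (h : I.RobConn S I.s I.t) :
    ∃ Q ⊆ S, I.IsRobustBipath Q := by
  classical
  obtain ⟨B₀, hB₀, hf₀⟩ := h.exists_isFlow
  obtain ⟨B, hB, hmin⟩ := Finset.exists_min_image
    ((I.arcsIn S).powerset.filter fun B => I.arcs.IsFlow B 2 I.s I.t) Finset.card
    ⟨B₀, Finset.mem_filter.2 ⟨Finset.mem_powerset.2 hB₀, hf₀⟩⟩
  obtain ⟨hBS, hB⟩ := Finset.mem_filter.1 hB
  rw [Finset.mem_powerset] at hBS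
  -- a minimal flow contains no circulation
  have hcirc : ∀ C ⊆ B, C.Nonempty → ¬ I.arcs.IsFlow C 0 I.s I.t := by
    intro C hC hne hfl
    have := hmin (B \ C) (Finset.mem_filter.2 ⟨Finset.mem_powerset.2
      (Finset.sdiff_subset.trans hBS), hB.sdiff (k := 2) hfl hC⟩)
    have h2 := Finset.card_lt_card (Finset.sdiff_ssubset hC hne)
    omega
  obtain ⟨p, hp, hpB, hpn⟩ := hB.exists_path (k := 1)
  have hpnd : p.Nodup := (List.nodup_cons.1 hpn).2.of_map
  have hB1 := hB.sdiff (k := 1) (j := 1) (hp.isFlow hpnd)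
    (fun a ha => hpB a (List.mem_toFinset.1 ha))
  obtain ⟨q, hq, hqB, hqn⟩ := hB1.exists_path (k := 0)
  have hqnd : q.Nodup := (List.nodup_cons.1 hqn).2.of_map
  have hqB' : ∀ a ∈ q, a ∈ B := fun a ha => (Finset.mem_sdiff.1 (hqB a ha)).1
  have hdisj : ∀ a ∈ p, a ∉ q := fun a ha haq =>
    (Finset.mem_sdiff.1 (hqB a haq)).2 (List.mem_toFinset.2 ha)
  have hpS : ∀ a ∈ p, a ∈ I.arcsIn S := fun a ha => hBS (hpB a ha)
  have hqS : ∀ a ∈ q, a ∈ I.arcsIn S := fun a ha => hBS (hqB' a ha)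
  -- opposite subwalks are a circulation
  have hopp : ∀ u v, u ≠ v → ∀ p' q', I.arcs.Walk u p' v → p'.Sublist p → I.arcs.Walk v q' u →
      q'.Sublist q → False := by
    intro u v huv p' q' hp' hpp hq' hqq
    have hd : Disjoint p'.toFinset q'.toFinset := by
      rw [Finset.disjoint_left]
      intro a ha hb
      exact hdisj a (hpp.subset (List.mem_toFinset.1 ha)) (hqq.subset (List.mem_toFinset.1 hb))
    refine hcirc (p'.toFinset ∪ q'.toFinset) ?_ ?_ ?_
    · intro a ha
      rcases Finset.mem_union.1 ha with ha | ha
      · exact hpB a (hpp.subset (List.mem_toFinset.1 ha))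
      · exact hqB' a (hqq.subset (List.mem_toFinset.1 ha))
    · rcases p' with _ | ⟨a, p'⟩
      · exact absurd hp' huv
      · exact ⟨a, by simp⟩
    · intro y
      rw [Finset.sum_union hd, hp'.isFlow (hpnd.sublist hpp) y, hq'.isFlow (hqnd.sublist hqq) y]
      push_cast; ring
  refine ⟨I.edges (I.ofArcs p) ∪ I.edges (I.ofArcs q),
    Finset.union_subset (edges_ofArcs_subset hpS) (edges_ofArcs_subset hqS),
    I.ofArcs p, I.ofArcs q, ⟨isWalk_ofArcs hp hpS, by rwa [support_ofArcs]⟩,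
    ⟨isWalk_ofArcs hq hqS, by rwa [support_ofArcs]⟩, rfl, ?_, ?_⟩
  -- An inverted pair of common vertices gives a subwalk of one path and an opposite subwalk of the
  -- other.
  · intro u v hup huq hvp hvq
    rw [support_ofArcs] at *
    rw [support_ofArcs] at *
    constructor
    · intro huv
      by_contra hcon
      have hne : u ≠ v := by rintro rfl; exact lt_irrefl _ huv
      have hlt := lt_of_le_of_ne (not_lt.1 hcon) fun heq => hne ((List.idxOf_inj hvq).1 heq).symm
      obtain ⟨p', h1, h2⟩ := hp.exists_subwalk hvp huv
      obtain ⟨q', h3, h4⟩ := hq.exists_subwalk huq hlt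
      exact hopp u v hne p' q' h1 h2 h3 h4
    · intro huv
      by_contra hcon
      have hne : u ≠ v := by rintro rfl; exact lt_irrefl _ huv
      have hlt := lt_of_le_of_ne (not_lt.1 hcon) fun heq => hne ((List.idxOf_inj hvp).1 heq).symm
      obtain ⟨q', h1, h2⟩ := hq.exists_subwalk hvq huv
      obtain ⟨p', h3, h4⟩ := hp.exists_subwalk hup hlt
      exact hopp v u hne.symm p' q' h3 h4 h1 h2
  -- Second copies exist for secure edges only, so both arcs of a shared faulty edge are first
  -- copies. They are distinct since the paths are arc-disjoint, hence they are opposite and form a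
  -- circulation of two arcs.
  · rw [Finset.eq_empty_iff_forall_notMem]
    intro e he
    simp only [Finset.mem_inter, mem_edges_ofArcs] at he
    obtain ⟨⟨⟨a, ha, rfl⟩, ⟨b, hb, hab⟩⟩, hef⟩ := he
    have ha' := mem_arcsIn.1 (hpS a ha)
    have hb' := mem_arcsIn.1 (hqS b hb)
    have ha2 : a.2.2.2 = false := by
      by_contra hc
      exact ha'.2.2 (by simpa using hc) hef
    have hb2 : b.2.2.2 = false := by
      by_contra hc
      exact hb'.2.2 (by simpa using hc) (hab ▸ hef)
    have hne : a ≠ b := by rintro rfl; exact hdisj a ha hb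
    rw [hab] at hb'
    rcases ha'.2.1.eq_or_swap hb'.2.1 with ⟨h1, h2⟩ | ⟨h1, h2⟩
    · refine hne (Prod.ext hab.symm (Prod.ext h1 (Prod.ext h2 ?_)))
      rw [ha2, hb2]
    · refine hcirc {a, b} ?_ ⟨a, by simp⟩ ?_
      · intro c hc
        rcases Finset.mem_insert.1 hc with rfl | hc
        · exact hpB _ ha
        · rw [Finset.mem_singleton.1 hc]; exact hqB' b hb
      · intro y
        rw [Finset.sum_pair hne]
        simp only [arcs, h1, h2]
        push_cast; ring

theorem isRobustBipath_of_minimal {S : Finset (Fin I.m)}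
    (h : Minimal (fun T => I.IsFeasible 1 T) S) : I.IsRobustBipath S := by
  obtain ⟨Q, hQS, hQ⟩ := (isFeasible_iff.1 h.1).exists_isRobustBipath
  rwa [← le_antisymm hQS (h.2 hQ.isFeasible hQS)]

end Instance

theorem _root_.List.exists_first {α : Type*} {P : α → Prop} {l : List α} (h : ∃ x ∈ l, P x) :
    ∃ l₁ x l₂, l = l₁ ++ x :: l₂ ∧ P x ∧ ∀ y ∈ l₁, ¬ P y := by
  induction l with
  | nil => simp at h
  | cons a l ih =>
    by_cases ha : P a
    · exact ⟨[], a, l, rfl, ha, by simp⟩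
    · obtain ⟨l₁, x, l₂, rfl, hx, hl⟩ := ih (by simpa [ha] using h)
      exact ⟨a :: l₁, x, l₂, rfl, hx, by simpa [ha] using hl⟩

namespace Instance

variable {I : Instance}

/-! ### Decomposition of bipaths -/

/-- The total length of the path `u :: vs` of the complete graph with respect to `L`. -/
noncomputable def pathSum (L : Fin I.n → Fin I.n → ℝ≥0∞) : Fin I.n → List (Fin I.n) → ℝ≥0∞
  | _, [] => 0
  | u, v :: vs => L u v + pathSum L v vs

theorem pathSum_len (u : Fin I.n) (vs : List (Fin I.n)) : pathSum I.len u vs = I.pathLen u vs := by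
  induction vs generalizing u with
  | nil => rfl
  | cons v vs ih => rw [pathSum, pathLen, ih]

variable (I) in
/-- The pair function `L` is at most the cost of each secure path and of each pair of
edge-disjoint paths in `A`. -/
structure LeLinks (A : Finset (Fin I.m)) (L : Fin I.n → Fin I.n → ℝ≥0∞) : Prop where
  secure : ∀ u v p, I.IsSecurePath u p v → I.edges p ⊆ A → L u v ≤ I.cost (I.edges p)
  pair : ∀ u v p q, I.IsDisjointPair u p q v → I.edges p ⊆ A → I.edges q ⊆ A →
    L u v ≤ (I.cost (I.edges p) : ℝ≥0∞) + (I.cost (I.edges q) : ℝ≥0∞)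

theorem leLinks_len : I.LeLinks Finset.univ I.len where
  secure _ _ p hp _ := (min_le_left _ _).trans (iInf₂_le p hp)
  pair _ _ p q h _ _ := (min_le_right _ _).trans (iInf_le_of_le p (iInf₂_le q h))

theorem exists_eq_append_of_mem_snd {z : Fin I.n} {p : List (Fin I.m × Fin I.n)}
    (hz : z ∈ p.map Prod.snd) :
    ∃ p₁ e p₂, p = p₁ ++ (e, z) :: p₂ := by
  obtain ⟨⟨e, z'⟩, h1, rfl⟩ := List.mem_map.1 hz
  obtain ⟨p₁, p₂, h2⟩ := List.append_of_mem h1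
  exact ⟨p₁, e, p₂, h2⟩

theorem IsWalk.split_concat {u v z : Fin I.n} {e : Fin I.m} {p q : List (Fin I.m × Fin I.n)}
    (h : I.IsWalk u (p ++ [(e, z)] ++ q) v) : I.IsWalk u (p ++ [(e, z)]) z ∧ I.IsWalk z q v := by
  obtain ⟨x, h1, h2⟩ := h.split
  obtain ⟨y, h3, h4⟩ := h1.split
  obtain rfl : z = x := h4.2
  exact ⟨h1, h2⟩

/-- The two ends of an edge on a path are distinct, and the ends of a common edge are common
vertices; a single common vertex leaves no room for both. -/
theorem disjoint_edges {u v w x z : Fin I.n} {p q : List (Fin I.m × Fin I.n)} (hp : I.IsPath u p v)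
    (hq : I.IsWalk w q x) (h : ∀ y ∈ I.support u p, y ∈ I.support w q → y = z) :
    Disjoint (I.edges p) (I.edges q) := by
  rw [Finset.disjoint_left]
  intro e hep heq
  obtain ⟨a, b, h1, h2, h3, h4⟩ := hp.1.exists_joins hep
  obtain ⟨h5, h6⟩ := hq.mem_support_of_joins heq h1
  exact h4 hp.2 ((h a h2 h5).trans (h b (List.mem_cons_of_mem _ h3) h6).symm)

/-- Induction along `p`, with `k` bounding its length: split off the part up to the first common
vertex after `u` and continue with the rest. The containment `vs ⊆ p.map Prod.snd` is carried along
to keep `u` from recurring. Stating this for any `L` below the links serves both `len` and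
`linkVal`. -/
theorem LeLinks.exists_completePath {A : Finset (Fin I.m)} {L : Fin I.n → Fin I.n → ℝ≥0∞}
    (hL : I.LeLinks A L) (k : ℕ) {u t : Fin I.n} {p q : List (Fin I.m × Fin I.n)}
    (hk : p.length ≤ k) (hp : I.IsPath u p t) (hq : I.IsPath u q t)
    (hpA : I.edges p ⊆ A) (hqA : I.edges q ⊆ A)
    (hord : ∀ a b, a ∈ I.support u p → a ∈ I.support u q →
      b ∈ I.support u p → b ∈ I.support u q →
      ((I.support u p).idxOf a < (I.support u p).idxOf b ↔
        (I.support u q).idxOf a < (I.support u q).idxOf b))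
    (hf : I.edges p ∩ I.edges q ∩ I.faulty = ∅) :
    ∃ vs, I.IsCompletePath u vs t ∧ vs ⊆ p.map Prod.snd ∧
      pathSum L u vs ≤ I.cost (I.edges p ∪ I.edges q) := by
  induction k generalizing u p q with
  | zero =>
    have : p = [] := List.length_eq_zero_iff.1 (Nat.le_zero.1 hk)
    subst this
    exact ⟨[], ⟨by simp, hp.1⟩, by simp, by simp [pathSum]⟩
  | succ k ih =>
    by_cases hpe : p = []
    · subst hpe
      exact ⟨[], ⟨by simp, hp.1⟩, by simp, by simp [pathSum]⟩
    have htp : t ∈ p.map Prod.snd := by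
      have h1 := hp.1.mem_support
      rcases List.mem_cons.1 h1 with h | h
      · obtain ⟨b, p', rfl⟩ := List.exists_cons_of_ne_nil hpe
        have h2 : t ∈ I.support b.2 p' := hp.1.2.mem_support
        have h3 := (List.nodup_cons.1 hp.2).1
        subst h
        exact absurd h2 h3
      · exact h
    -- The entries of `p` record the vertices after `u`, so `v` is the first common vertex other
    -- than `u`.
    obtain ⟨p₁, ⟨f, v⟩, p₂, rfl, hv, hp₁⟩ := List.exists_first (l := p)
      (P := fun b => b.2 ∈ I.support u q) (by
        obtain ⟨b, hb, hbt⟩ := List.mem_map.1 htp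
        exact ⟨b, hb, hbt ▸ hq.1.mem_support⟩)
    have hvu : v ≠ u := by
      rintro rfl
      have := (List.nodup_cons.1 hp.2).1
      simp at this
    have hvq : v ∈ q.map Prod.snd := (List.mem_cons.1 hv).resolve_left hvu
    obtain ⟨q₁, g, q₂, rfl⟩ := exists_eq_append_of_mem_snd hvq
    have ep : p₁ ++ (f, v) :: p₂ = p₁ ++ [(f, v)] ++ p₂ := by simp
    have eq : q₁ ++ (g, v) :: q₂ = q₁ ++ [(g, v)] ++ q₂ := by simp
    rw [ep] at hk hp hpA hord hf ⊢
    rw [eq] at hq hqA hord hf hp₁ ⊢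
    -- supports
    have hsp : I.support u (p₁ ++ [(f, v)] ++ p₂) = I.support u p₁ ++ I.support v p₂ := by
      simp [support]
    have hsq : I.support u (q₁ ++ [(g, v)] ++ q₂) = I.support u q₁ ++ I.support v q₂ := by
      simp [support]
    have hsP : I.support u (p₁ ++ [(f, v)]) = I.support u p₁ ++ [v] := by simp [support]
    have hsQ : I.support u (q₁ ++ [(g, v)]) = I.support u q₁ ++ [v] := by simp [support]
    obtain ⟨hP, hp₂⟩ := hp.1.split_concat
    obtain ⟨hQ, hq₂⟩ := hq.1.split_concat
    have hpn := hp.2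
    have hqn := hq.2
    rw [hsp] at hpn hord
    rw [hsq] at hqn hord hp₁
    have hpn' := List.nodup_append.1 hpn
    have hqn' := List.nodup_append.1 hqn
    have hvP : ∀ (p : List (Fin I.m × Fin I.n)), v ∈ I.support v p := fun p => by simp [support]
    have huP : ∀ (p : List (Fin I.m × Fin I.n)), u ∈ I.support u p := fun p => by simp [support]
    have hPn : (I.support u (p₁ ++ [(f, v)])).Nodup := by
      rw [hsP]
      exact hpn.sublist ((List.Sublist.refl _).append (by simp [support]))
    have hQn : (I.support u (q₁ ++ [(g, v)])).Nodup := by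
      rw [hsQ]
      exact hqn.sublist ((List.Sublist.refl _).append (by simp [support]))
    -- positions
    have hidx : ∀ (X Y : List (Fin I.n)), (X ++ Y).Nodup → ∀ a ∈ Y,
        (X ++ Y).idxOf a = X.length + Y.idxOf a := fun X Y h a ha =>
      List.idxOf_append_of_notMem fun hX => (List.nodup_append.1 h).2.2 a hX a ha rfl
    have hip : ∀ z ∈ I.support u p₁, z ∈ I.support u q₁ ++ I.support v q₂ → z = u := by
      intro z hz hzq
      rcases List.mem_cons.1 hz with h | h
      · exact h
      · obtain ⟨b, hb, rfl⟩ := List.mem_map.1 h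
        exact absurd hzq (hp₁ b hb)
    -- Here the common order enters: a common vertex before `v` on `q` is also before `v` on `p`, so
    -- it is `u`.
    have hiq : ∀ z ∈ I.support u q₁, z ∈ I.support u p₁ ++ I.support v p₂ → z = u := by
      intro z hz hzp
      refine hip z ?_ (List.mem_append_left _ hz)
      have h1 := (hord z v hzp (List.mem_append_left _ hz) (List.mem_append_right _ (hvP _))
        (List.mem_append_right _ (hvP _))).2 (by
          rw [hidx _ _ hqn v (hvP _), List.idxOf_append_of_mem hz]
          exact Nat.lt_add_right _ (List.idxOf_lt_length_iff.2 hz))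
      rw [hidx _ _ hpn v (hvP _)] at h1
      rcases List.mem_append.1 hzp with h | h
      · exact h
      · rw [hidx _ _ hpn z h] at h1
        simp [support] at h1
        omega
    have hup₂ : u ∉ I.support v p₂ := fun h => hpn'.2.2 u (huP _) u h rfl
    have huq₂ : u ∉ I.support v q₂ := fun h => hqn'.2.2 u (huP _) u h rfl
    -- disjointness of the two halves
    have hd1 : Disjoint (I.edges (p₁ ++ [(f, v)])) (I.edges p₂) := by
      refine disjoint_edges (z := v) ⟨hP, hPn⟩ hp₂ fun y h1 h2 => ?_
      rw [hsP] at h1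
      rcases List.mem_append.1 h1 with h | h
      · exact absurd rfl (hpn'.2.2 y h y h2)
      · simpa using h
    have hd2 : Disjoint (I.edges (p₁ ++ [(f, v)])) (I.edges q₂) := by
      refine disjoint_edges (z := v) ⟨hP, hPn⟩ hq₂ fun y h1 h2 => ?_
      rw [hsP] at h1
      rcases List.mem_append.1 h1 with h | h
      · exact absurd (hip y h (List.mem_append_right _ h2) ▸ h2) huq₂
      · simpa using h
    have hd3 : Disjoint (I.edges (q₁ ++ [(g, v)])) (I.edges q₂) := by
      refine disjoint_edges (z := v) ⟨hQ, hQn⟩ hq₂ fun y h1 h2 => ?_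
      rw [hsQ] at h1
      rcases List.mem_append.1 h1 with h | h
      · exact absurd rfl (hqn'.2.2 y h y h2)
      · simpa using h
    have hd4 : Disjoint (I.edges (q₁ ++ [(g, v)])) (I.edges p₂) := by
      refine disjoint_edges (z := v) ⟨hQ, hQn⟩ hp₂ fun y h1 h2 => ?_
      rw [hsQ] at h1
      rcases List.mem_append.1 h1 with h | h
      · exact absurd (hiq y h (List.mem_append_right _ h2) ▸ h2) hup₂
      · simpa using h
    have eP := I.edges_append (p₁ ++ [(f, v)]) p₂
    have eQ := I.edges_append (q₁ ++ [(g, v)]) q₂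
    rw [eP] at hpA hf ⊢
    rw [eQ] at hqA hf ⊢
    -- the first link
    have hlink : L u v ≤ I.cost (I.edges (p₁ ++ [(f, v)]) ∪ I.edges (q₁ ++ [(g, v)])) := by
      by_cases hd : Disjoint (I.edges (p₁ ++ [(f, v)])) (I.edges (q₁ ++ [(g, v)]))
      · refine (hL.pair _ _ _ _ ⟨⟨hP, hPn⟩, ⟨hQ, hQn⟩, hd⟩ (Finset.union_subset_left hpA)
          (Finset.union_subset_left hqA)).trans (le_of_eq ?_)
        rw [cost, cost, cost, Finset.sum_union hd, ENNReal.coe_add]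
      -- The first segments meet only in `u` and `v`. A shared edge therefore joins `u` to `v`, and
      -- being shared it is secure; alone it bounds the link.
      · obtain ⟨e, heP, heQ⟩ := Finset.not_disjoint_iff.1 hd
        obtain ⟨a, x, h1, h2, h3, h4⟩ := hP.exists_joins heP
        obtain ⟨h5, h6⟩ := hQ.mem_support_of_joins heQ h1
        have hends : ∀ z ∈ I.support u (p₁ ++ [(f, v)]), z ∈ I.support u (q₁ ++ [(g, v)]) →
            z = u ∨ z = v := by
          intro z hz hz'
          rw [hsP] at hz
          rw [hsQ] at hz'
          rcases List.mem_append.1 hz with h | h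
          · left
            rcases List.mem_append.1 hz' with h' | h'
            · exact hip z h (List.mem_append_left _ h')
            · rw [List.mem_singleton.1 h'] at h ⊢
              exact hip v h (List.mem_append_right _ (hvP _))
          · right; simpa using h
        have hxu : x ≠ u := by
          rintro rfl
          exact (List.nodup_cons.1 hPn).1 h3
        have hxv : x = v := (hends x (List.mem_cons_of_mem _ h3) h6).resolve_left hxu
        have hau : a = u := (hends a h2 h5).resolve_right fun h => h4 hPn (h.trans hxv.symm)
        subst hau hxv
        have hef : e ∉ I.faulty := fun hef => by
          have : e ∈ (∅ : Finset (Fin I.m)) := by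
            rw [← hf]
            simp only [Finset.mem_inter, Finset.mem_union]
            exact ⟨⟨Or.inl heP, Or.inl heQ⟩, hef⟩
          simp at this
        have hsec : I.IsSecurePath a [(e, x)] x :=
          ⟨⟨⟨h1, rfl⟩, by simpa [support] using hxu.symm⟩, by simpa [edges] using hef⟩
        have he1 : I.edges [(e, x)] = {e} := by simp [edges]
        refine (hL.secure _ _ _ hsec ?_).trans (ENNReal.coe_le_coe.2 (cost_mono ?_))
        · rw [he1, Finset.singleton_subset_iff]
          exact hpA (Finset.mem_union_left _ heP)
        · rw [he1, Finset.singleton_subset_iff]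
          exact Finset.mem_union_left _ heP
    obtain ⟨vs, hvs, hvsp, hvsL⟩ := ih (u := v) (p := p₂) (q := q₂) (by simp at hk; omega)
      ⟨hp₂, hpn'.2.1⟩ ⟨hq₂, hqn'.2.1⟩ (Finset.union_subset_right hpA)
      (Finset.union_subset_right hqA) (fun a b ha ha' hb hb' => by
        have := hord a b (List.mem_append_right _ ha) (List.mem_append_right _ ha')
          (List.mem_append_right _ hb) (List.mem_append_right _ hb')
        rwa [hidx _ _ hpn a ha, hidx _ _ hpn b hb, hidx _ _ hqn a ha', hidx _ _ hqn b hb',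
          Nat.add_lt_add_iff_left, Nat.add_lt_add_iff_left] at this) (by
        rw [Finset.eq_empty_iff_forall_notMem] at hf ⊢
        intro e he
        refine hf e ?_
        simp only [Finset.mem_inter, Finset.mem_union] at he ⊢
        exact ⟨⟨Or.inr he.1.1, Or.inr he.1.2⟩, he.2⟩)
    refine ⟨v :: vs, ⟨List.nodup_cons.2 ⟨?_, hvs.1⟩, ?_⟩, ?_, ?_⟩
    · intro hu
      rcases List.mem_cons.1 hu with h | h
      · exact hvu h.symm
      · exact hup₂ (List.mem_cons_of_mem _ (hvsp h))
    · rw [List.getLast_cons (List.cons_ne_nil _ _)]; exact hvs.2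
    · intro z hz
      rcases List.mem_cons.1 hz with rfl | h
      · simp
      · have := hvsp h
        rw [List.map_append]
        exact List.mem_append_right _ this
    · rw [pathSum]
      refine (add_le_add hlink hvsL).trans (le_of_eq ?_)
      rw [← ENNReal.coe_add]
      congr 1
      rw [cost, cost, cost, ← Finset.sum_union]
      · congr 1
        ext e; simp only [Finset.mem_union]; tauto
      · rw [Finset.disjoint_union_left, Finset.disjoint_union_right, Finset.disjoint_union_right]
        exact ⟨⟨hd1, hd2⟩, hd4, hd3⟩

theorem LeLinks.exists_completePath_of_isFeasible {A S : Finset (Fin I.m)}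
    {L : Fin I.n → Fin I.n → ℝ≥0∞} (hL : I.LeLinks A L) (hS : I.IsFeasible 1 S) (hSA : S ⊆ A) :
    ∃ vs, I.IsCompletePath I.s vs I.t ∧ pathSum L I.s vs ≤ I.cost S := by
  obtain ⟨Q, hQS, p, q, hp, hq, rfl, hord, hf⟩ := (isFeasible_iff.1 hS).exists_isRobustBipath
  have hA := hQS.trans hSA
  obtain ⟨vs, h1, -, h2⟩ := hL.exists_completePath p.length le_rfl hp hq
    (Finset.union_subset_left hA) (Finset.union_subset_right hA) hord hf
  exact ⟨vs, h1, h2.trans (ENNReal.coe_le_coe.2 (cost_mono hQS))⟩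

theorem lenDist_le_cost {S : Finset (Fin I.m)} (hS : I.IsFeasible 1 S) :
    I.lenDist ≤ I.cost S := by
  obtain ⟨vs, h1, h2⟩ := leLinks_len.exists_completePath_of_isFeasible hS (Finset.subset_univ S)
  rw [pathSum_len] at h2
  exact (iInf₂_le vs h1).trans h2

/-! ### Realizations of shortest paths -/

theorem RealizesEdge.robConn {u v : Fin I.n} {R : Finset (Fin I.m)} (h : I.RealizesEdge u v R) :
    I.RobConn R u v := by
  rcases h with ⟨-, p, hp, -, rfl⟩ | ⟨-, p, q, hp, -, rfl⟩
  · exact robConn_of_isSecurePath hp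
  · exact robConn_of_isDisjointPair hp

theorem RealizesEdge.cost_le {u v : Fin I.n} {R : Finset (Fin I.m)} (h : I.RealizesEdge u v R) :
    (I.cost R : ℝ≥0∞) ≤ I.len u v := by
  rcases h with ⟨h1, p, -, h2, rfl⟩ | ⟨h1, p, q, -, h2, rfl⟩
  · rw [h1, h2]
  · have : I.len u v = I.pairDist u v := (min_choice _ _).resolve_left h1
    rw [this, ← h2, ← ENNReal.coe_add]
    exact ENNReal.coe_le_coe.2 (cost_union_le _ _)

/-- Different links may overlap; this only lowers the cost of the union and does not affect
connectivity. -/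
theorem Realizes.robConn_and_cost_le {u t : Fin I.n} {vs : List (Fin I.n)}
    {Q : Finset (Fin I.m)} (h : I.Realizes u vs Q)
    (ht : (u :: vs).getLast (List.cons_ne_nil u vs) = t) :
    I.RobConn Q u t ∧ (I.cost Q : ℝ≥0∞) ≤ I.pathLen u vs := by
  induction vs generalizing u Q with
  | nil =>
    obtain rfl : Q = ∅ := h
    obtain rfl : u = t := ht
    exact ⟨robConn_self _ _, by simp [cost, pathLen]⟩
  | cons v vs ih =>
    obtain ⟨R, Q', hR, hQ', rfl⟩ := h
    rw [List.getLast_cons (List.cons_ne_nil _ _)] at ht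
    obtain ⟨h1, h2⟩ := ih hQ' ht
    refine ⟨(hR.robConn.mono Finset.subset_union_left).trans
      (h1.mono Finset.subset_union_right), ?_⟩
    refine (ENNReal.coe_le_coe.2 (cost_union_le _ _)).trans ?_
    rw [ENNReal.coe_add]
    exact add_le_add hR.cost_le h2

/-- The cost of `Q` is at most `lenDist`, which is at most the cost of any feasible set. The bipath
contained in `Q` is feasible and lies between the same bounds. -/
theorem IsShortest.realizes {vs : List (Fin I.n)} {Q : Finset (Fin I.m)} (h : I.IsShortest vs)
    (hQ : I.Realizes I.s vs Q) :
    I.IsOptimal 1 Q ∧ ∃ B ⊆ Q, I.IsRobustBipath B ∧ (I.cost B : ℝ≥0∞) = I.lenDist := by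
  obtain ⟨h1, h2⟩ := hQ.robConn_and_cost_le h.1.2
  rw [h.2] at h2
  obtain ⟨B, hBQ, hB⟩ := h1.exists_isRobustBipath
  refine ⟨⟨isFeasible_iff.2 h1, fun T hT => ?_⟩, B, hBQ, hB, le_antisymm ?_ ?_⟩
  · exact ENNReal.coe_le_coe.1 (h2.trans (lenDist_le_cost hT))
  · exact (ENNReal.coe_le_coe.2 (cost_mono hBQ)).trans h2
  · exact lenDist_le_cost hB.isFeasible

theorem _root_.exists_eq_iInf_of_finite_range {ι : Type*} [Nonempty ι] (f : ι → ℝ≥0∞)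
    (h : (Set.range f).Finite) : ∃ i, f i = ⨅ i, f i :=
  (Set.range_nonempty f).csInf_mem h

/-- The costs range over values on the finitely many edge sets, so the infimum is attained unless
there is no path. -/
theorem exists_secureDist_eq {u v : Fin I.n} (h : I.secureDist u v ≠ ⊤) :
    ∃ p, I.IsSecurePath u p v ∧ (I.cost (I.edges p) : ℝ≥0∞) = I.secureDist u v := by
  have : Nonempty {p // I.IsSecurePath u p v} := by
    by_contra hcon
    rw [nonempty_subtype, not_exists] at hcon
    exact h (iInf₂_eq_top.2 fun p hp => absurd hp (hcon p))
  obtain ⟨⟨p, hp⟩, h1⟩ := exists_eq_iInf_of_finite_range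
    (fun p : {p // I.IsSecurePath u p v} => (I.cost (I.edges p.1) : ℝ≥0∞))
    ((Set.finite_range fun S : Finset (Fin I.m) => (I.cost S : ℝ≥0∞)).subset
      (Set.range_subset_iff.2 fun p => ⟨I.edges p.1, rfl⟩))
  exact ⟨p, hp, h1.trans (iInf_subtype' (f := fun p (_ : I.IsSecurePath u p v) =>
    (I.cost (I.edges p) : ℝ≥0∞))).symm⟩

theorem exists_pairDist_eq {u v : Fin I.n} (h : I.pairDist u v ≠ ⊤) :
    ∃ p q, I.IsDisjointPair u p q v ∧
      (I.cost (I.edges p) : ℝ≥0∞) + (I.cost (I.edges q) : ℝ≥0∞) = I.pairDist u v := by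
  have e : I.pairDist u v = ⨅ x : {x : List (Fin I.m × Fin I.n) × List (Fin I.m × Fin I.n) //
      I.IsDisjointPair u x.1 x.2 v},
        ((I.cost (I.edges x.1.1) : ℝ≥0∞) + (I.cost (I.edges x.1.2) : ℝ≥0∞)) := by
    refine le_antisymm (le_iInf fun x => iInf_le_of_le x.1.1 (iInf₂_le x.1.2 x.2))
      (le_iInf fun p => le_iInf₂ fun q h => ?_)
    exact iInf_le_of_le ⟨(p, q), h⟩ le_rfl
  have : Nonempty {x : List (Fin I.m × Fin I.n) × List (Fin I.m × Fin I.n) //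
      I.IsDisjointPair u x.1 x.2 v} := by
    by_contra hcon
    rw [not_nonempty_iff] at hcon
    exact h (by rw [e, iInf_of_empty])
  obtain ⟨⟨x, hx⟩, h1⟩ := exists_eq_iInf_of_finite_range
    (fun x : {x : List (Fin I.m × Fin I.n) × List (Fin I.m × Fin I.n) //
      I.IsDisjointPair u x.1 x.2 v} =>
        ((I.cost (I.edges x.1.1) : ℝ≥0∞) + (I.cost (I.edges x.1.2) : ℝ≥0∞)))
    ((Set.finite_range fun S : Finset (Fin I.m) × Finset (Fin I.m) =>
      ((I.cost S.1 : ℝ≥0∞) + (I.cost S.2 : ℝ≥0∞))).subset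
      (Set.range_subset_iff.2 fun x => ⟨(I.edges x.1.1, I.edges x.1.2), rfl⟩))
  exact ⟨x.1, x.2, hx, h1.trans e.symm⟩

theorem exists_realizesEdge {u v : Fin I.n} (h : I.len u v ≠ ⊤) : ∃ R, I.RealizesEdge u v R := by
  by_cases h1 : I.len u v = I.secureDist u v
  · obtain ⟨p, hp, hc⟩ := exists_secureDist_eq (h1 ▸ h)
    exact ⟨_, Or.inl ⟨h1, p, hp, hc, rfl⟩⟩
  · have h2 : I.len u v = I.pairDist u v := (min_choice _ _).resolve_left h1
    obtain ⟨p, q, hp, hc⟩ := exists_pairDist_eq (h2 ▸ h)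
    exact ⟨_, Or.inr ⟨h1, p, q, hp, hc, rfl⟩⟩

theorem exists_realizes {u : Fin I.n} {vs : List (Fin I.n)} (h : I.pathLen u vs ≠ ⊤) :
    ∃ Q, I.Realizes u vs Q := by
  induction vs generalizing u with
  | nil => exact ⟨∅, rfl⟩
  | cons v vs ih =>
    rw [pathLen, ENNReal.add_ne_top] at h
    obtain ⟨R, hR⟩ := exists_realizesEdge h.1
    obtain ⟨Q, hQ⟩ := ih h.2
    exact ⟨_, R, Q, hR, hQ, rfl⟩

/-- Feasibility plays no role: the complete graph always has a path between the terminals, possibly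
of infinite length, and only finitely many paths. -/
theorem exists_isShortest : ∃ vs, I.IsShortest vs := by
  have : Nonempty {vs // I.IsCompletePath I.s vs I.t} := by
    by_cases h : I.s = I.t
    · exact ⟨⟨[], by simp, h⟩⟩
    · exact ⟨⟨[I.t], by simpa using h, rfl⟩⟩
  have hfin : Finite {vs // I.IsCompletePath I.s vs I.t} := by
    have : Finite {l : List (Fin I.n) // l.Nodup} := inferInstance
    exact Finite.of_injective
      (fun vs : {vs // I.IsCompletePath I.s vs I.t} =>
        (⟨I.s :: vs.1, vs.2.1⟩ : {l : List (Fin I.n) // l.Nodup}))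
      fun a b hab => by
        simp only [Subtype.mk.injEq, List.cons.injEq, true_and] at hab
        exact Subtype.ext hab
  obtain ⟨⟨vs, hvs⟩, h1⟩ := exists_eq_iInf_of_finite_range
    (fun vs : {vs // I.IsCompletePath I.s vs I.t} => I.pathLen I.s vs.1) (Set.finite_range _)
  exact ⟨vs, hvs, h1.trans (iInf_subtype' (f := fun vs (_ : I.IsCompletePath I.s vs I.t) =>
    I.pathLen I.s vs)).symm⟩

theorem lenDist_eq_top_or : I.lenDist = ⊤ ∨ ∃ vs Q, I.IsShortest vs ∧ I.Realizes I.s vs Q := by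
  obtain ⟨vs, hvs⟩ := I.exists_isShortest
  by_cases h : I.lenDist = ⊤
  · exact Or.inl h
  · rw [← hvs.2] at h
    obtain ⟨Q, hQ⟩ := exists_realizes h
    exact Or.inr ⟨vs, Q, hvs, hQ⟩

theorem iInf_feasible_eq : (⨅ (S) (_ : I.IsFeasible 1 S), (I.cost S : ℝ≥0∞)) = I.lenDist := by
  refine le_antisymm ?_ (le_iInf₂ fun S hS => lenDist_le_cost hS)
  rcases I.lenDist_eq_top_or with h | ⟨vs, Q, h1, h2⟩
  · rw [h]; exact le_top
  · obtain ⟨-, B, -, hB, hc⟩ := h1.realizes h2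
    rw [← hc]
    exact iInf₂_le B hB.isFeasible

theorem iInf_robustBipath_eq :
    (⨅ (Q) (_ : I.IsRobustBipath Q), (I.cost Q : ℝ≥0∞)) = I.lenDist := by
  refine le_antisymm ?_ (le_iInf₂ fun S hS => lenDist_le_cost hS.isFeasible)
  rcases I.lenDist_eq_top_or with h | ⟨vs, Q, h1, h2⟩
  · rw [h]; exact le_top
  · obtain ⟨-, B, -, hB, hc⟩ := h1.realizes h2
    rw [← hc]
    exact iInf₂_le B hB

theorem IsShortest.exists_realizes {S : Finset (Fin I.m)} (hS : I.IsFeasible 1 S)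
    {vs : List (Fin I.n)} (h : I.IsShortest vs) : ∃ Q, I.Realizes I.s vs Q := by
  refine Instance.exists_realizes (ne_top_of_le_ne_top (ENNReal.coe_ne_top (r := I.cost S)) ?_)
  rw [h.2]; exact lenDist_le_cost hS

end Instance

namespace Instance

variable (I : Instance)

/-! ### The network of an instance -/

/-- The arcs that the algorithm works with: arc `j < m` is the edge `j` in its given direction, arc
`m + j` is the edge `j` in the opposite direction. -/
noncomputable def net : Arcs ℕ ℕ where
  tl j := if j < I.m then I.input.nat 1 j else I.input.nat 2 (j - I.m)
  hd j := if j < I.m then I.input.nat 2 j else I.input.nat 1 (j - I.m)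

/-- The edge of an arc. -/
def arcEdge (j : ℕ) : ℕ := if j < I.m then j else j - I.m

/-- The arc `j` can be used, and its edge is in `A`. -/
def ArcIn (A : Finset (Fin I.m)) (j : ℕ) : Prop :=
  (∃ e ∈ A, e.val = I.arcEdge j) ∧ (j < I.m ∨ I.directed = false)

open Classical in
/-- The cost of an arc; it is infinite if the arc is not present. -/
noncomputable def netCost (A : Finset (Fin I.m)) (j : ℕ) : ℝ≥0∞ :=
  if I.ArcIn A j then ENNReal.ofReal (I.input.wt 0 (I.arcEdge j)) else ⊤

variable {I}

theorem input_src (e : Fin I.m) : I.input.nat 1 e = I.src e := by simp [input]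

theorem input_dst (e : Fin I.m) : I.input.nat 2 e = I.dst e := by simp [input]

theorem input_weight (e : Fin I.m) : I.input.wt 0 e = I.weight e := by simp [input]

theorem Joins.exists_arc {e : Fin I.m} {u v : Fin I.n} (h : I.Joins e u v)
    {A : Finset (Fin I.m)} (he : e ∈ A) :
    ∃ j, I.net.tl j = u ∧ I.net.hd j = v ∧ I.arcEdge j = e ∧ I.netCost A j = I.weight e := by
  rcases h with ⟨rfl, rfl⟩ | ⟨hd, rfl, rfl⟩
  · have h1 : I.arcEdge e = e := by simp [arcEdge]
    refine ⟨e, by simp [net, input_src], by simp [net, input_dst], h1, ?_⟩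
    rw [netCost, if_pos ⟨⟨e, he, h1.symm⟩, Or.inl e.2⟩, h1, input_weight]
    exact ENNReal.ofReal_coe_nnreal
  · have h1 : I.arcEdge (I.m + e) = e := by simp [arcEdge]
    refine ⟨I.m + e, by simp [net, input_dst], by simp [net, input_src], h1, ?_⟩
    rw [netCost, if_pos ⟨⟨e, he, h1.symm⟩, Or.inr hd⟩, h1, input_weight]
    exact ENNReal.ofReal_coe_nnreal

theorem exists_joins_of_netCost {A : Finset (Fin I.m)} {j : ℕ} (h : I.netCost A j ≠ ⊤) :
    ∃ e ∈ A, ∃ u v, I.Joins e u v ∧ I.net.tl j = u ∧ I.net.hd j = v ∧ I.arcEdge j = e ∧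
      I.netCost A j = I.weight e := by
  have hj : I.ArcIn A j := by
    by_contra hc
    exact h (if_neg hc)
  obtain ⟨e, he, hej⟩ := hj.1
  have hw : I.netCost A j = I.weight e := by
    rw [netCost, if_pos hj, ← hej, input_weight]; exact ENNReal.ofReal_coe_nnreal
  by_cases hm : j < I.m
  · have : j = e.val := by rw [hej, arcEdge, if_pos hm]
    subst this
    exact ⟨e, he, I.src e, I.dst e, Or.inl ⟨rfl, rfl⟩, by simp [net, input_src],
      by simp [net, input_dst], hej.symm, hw⟩
  · have : j - I.m = e.val := by rw [hej, arcEdge, if_neg hm]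
    exact ⟨e, he, I.dst e, I.src e, Or.inr ⟨hj.2.resolve_left hm, rfl, rfl⟩,
      by simp [net, hm, this, input_dst], by simp [net, hm, this, input_src], hej.symm, hw⟩

theorem finite_netCost (A : Finset (Fin I.m)) : {j | I.netCost A j ≠ ⊤}.Finite := by
  refine (Set.finite_lt_nat (I.m + I.m)).subset fun j hj => ?_
  obtain ⟨e, -, u, v, -, -, -, he, -⟩ := exists_joins_of_netCost hj
  have := e.2
  simp only [arcEdge] at he
  simp only [Set.mem_ofPred_eq]
  split_ifs at he <;> omega

theorem IsWalk.exists_net_walk {A : Finset (Fin I.m)} {u v : Fin I.n}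
    {p : List (Fin I.m × Fin I.n)} (h : I.IsWalk u p v) (hA : I.edges p ⊆ A) :
    ∃ l, I.net.Walk u l v ∧ l.map I.arcEdge = p.map (fun b => b.1.val) ∧
      l.map (I.netCost A) = p.map fun b => (I.weight b.1 : ℝ≥0∞) := by
  induction p generalizing u with
  | nil => cases h; exact ⟨[], rfl, rfl, rfl⟩
  | cons b p ih =>
    obtain ⟨l, h1, h2, h3⟩ := ih h.2 ((by simp [edges] : I.edges p ⊆ I.edges (b :: p)).trans hA)
    obtain ⟨j, g1, g2, g3, g4⟩ := Joins.exists_arc h.1 (hA (by simp [edges] : b.1 ∈ _))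
    exact ⟨j :: l, ⟨g1, by rwa [g2]⟩, by simp [g3, h2], by simp [g4, h3]⟩

theorem IsPath.coe_cost_edges {u v : Fin I.n} {p : List (Fin I.m × Fin I.n)} (h : I.IsPath u p v) :
    (I.cost (I.edges p) : ℝ≥0∞) = (p.map fun b => (I.weight b.1 : ℝ≥0∞)).sum := by
  rw [h.cost_edges]
  generalize p = q
  induction q with
  | nil => simp
  | cons b q ih => simp [ih]

theorem IsPath.nodup_val {u v : Fin I.n} {p : List (Fin I.m × Fin I.n)} (h : I.IsPath u p v) :
    (p.map fun b => b.1.val).Nodup := by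
  have := h.nodup_fst.map Fin.val_injective
  rwa [List.map_map] at this

theorem net_dist_le {A : Finset (Fin I.m)} {u v : Fin I.n} {p : List (Fin I.m × Fin I.n)}
    (h : I.IsPath u p v) (hA : I.edges p ⊆ A) :
    I.net.dist (I.netCost A) u v ≤ I.cost (I.edges p) := by
  obtain ⟨l, h1, h2, h3⟩ := h.1.exists_net_walk hA
  rw [h.coe_cost_edges, ← h3]
  exact Arcs.dist_le h1

/-- An arc determines its edge, so edge-disjoint paths become disjoint arc sets, whose unit flows
add to a flow of value two. -/
theorem net_pairVal_le {A : Finset (Fin I.m)} {u v : Fin I.n} {p q : List (Fin I.m × Fin I.n)}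
    (h : I.IsDisjointPair u p q v) (hp : I.edges p ⊆ A) (hq : I.edges q ⊆ A) :
    I.net.pairVal (I.netCost A) u v ≤
      (I.cost (I.edges p) : ℝ≥0∞) + (I.cost (I.edges q) : ℝ≥0∞) := by
  obtain ⟨k, h1, h2, h3⟩ := h.1.1.exists_net_walk hp
  obtain ⟨l, g1, g2, g3⟩ := h.2.1.1.exists_net_walk hq
  have hkn : k.Nodup := List.Nodup.of_map I.arcEdge (h2 ▸ h.1.nodup_val)
  have hln : l.Nodup := List.Nodup.of_map I.arcEdge (g2 ▸ h.2.1.nodup_val)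
  have hd : Disjoint k.toFinset l.toFinset := by
    rw [Finset.disjoint_left]
    intro j hj hj'
    have e1 : I.arcEdge j ∈ p.map fun b => b.1.val :=
      h2 ▸ List.mem_map_of_mem (List.mem_toFinset.1 hj)
    have e2 : I.arcEdge j ∈ q.map fun b => b.1.val :=
      g2 ▸ List.mem_map_of_mem (List.mem_toFinset.1 hj')
    obtain ⟨b, hb, hb'⟩ := List.mem_map.1 e1
    obtain ⟨c, hc, hc'⟩ := List.mem_map.1 e2
    have : b.1 = c.1 := Fin.ext (hb'.trans hc'.symm)
    have hbp : b.1 ∈ I.edges p := List.mem_toFinset.2 (List.mem_map_of_mem hb)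
    have hbq : b.1 ∈ I.edges q := this ▸ List.mem_toFinset.2 (List.mem_map_of_mem hc)
    exact Finset.disjoint_left.1 h.2.2 hbp hbq
  refine (iInf₂_le (k.toFinset ∪ l.toFinset) ((h1.isFlow hkn).union (g1.isFlow hln) hd)).trans (le_of_eq ?_)
  rw [Finset.sum_union hd, List.sum_toFinset _ hkn, List.sum_toFinset _ hln, h3, g3,
    h.1.coe_cost_edges, h.2.1.coe_cost_edges]

/-- Only an inequality for the cost: the two opposite arcs of an edge collapse to one edge. -/
theorem exists_edgeSet {A : Finset (Fin I.m)} (B : Finset ℕ) (h : ∀ j ∈ B, I.netCost A j ≠ ⊤) :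
    ∃ R ⊆ A, (I.cost R : ℝ≥0∞) ≤ ∑ j ∈ B, I.netCost A j ∧
      ∀ j ∈ B, ∃ e ∈ R, ∃ u v, I.Joins e u v ∧ I.net.tl j = u ∧ I.net.hd j = v ∧
        I.arcEdge j = e := by
  induction B using Finset.induction_on with
  | empty => exact ⟨∅, by simp, by simp [cost], by simp⟩
  | insert j B hj ih =>
    obtain ⟨R, h1, h2, h3⟩ := ih fun k hk => h k (Finset.mem_insert_of_mem hk)
    obtain ⟨e, he, u, v, g1, g2, g3, g4, g5⟩ :=
      exists_joins_of_netCost (h j (Finset.mem_insert_self _ _))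
    refine ⟨{e} ∪ R, Finset.union_subset (by simpa using he) h1, ?_, ?_⟩
    · rw [Finset.sum_insert hj, g5]
      refine (ENNReal.coe_le_coe.2 (cost_union_le _ _)).trans ?_
      rw [ENNReal.coe_add]
      exact add_le_add (by simp [cost]) h2
    · intro k hk
      rcases Finset.mem_insert.1 hk with rfl | hk
      · exact ⟨e, by simp, u, v, g1, g2, g3, g4⟩
      · obtain ⟨f, hf, hr⟩ := h3 k hk
        exact ⟨f, Finset.mem_union_right _ hf, hr⟩

theorem conn_of_net_walk {R : Finset (Fin I.m)} {u v : Fin I.n} {l : List ℕ}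
    (h : I.net.Walk u l v) (hl : ∀ j ∈ l, ∃ e ∈ R, ∃ x y, I.Joins e x y ∧ I.net.tl j = x ∧
      I.net.hd j = y) : I.Conn R u v := by
  induction l generalizing u with
  | nil =>
    obtain rfl : u = v := Fin.ext h
    exact fun X hu hv => (hv hu).elim
  | cons j l ih =>
    obtain ⟨e, he, x, y, h1, h2, h3⟩ := hl j (by simp)
    obtain rfl : x = u := Fin.ext (h2.symm.trans h.1)
    refine Conn.trans (x := y) (fun X hu hv => ⟨e, he, _, hu, _, hv, h1⟩) (ih ?_ fun k hk =>
      hl k (List.mem_cons_of_mem _ hk))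
    rw [← h3]; exact h.2

theorem exists_robConn_of_dist {A : Finset (Fin I.m)} {u v : Fin I.n}
    (h : I.net.dist (I.netCost (A \ I.faulty)) u v ≠ ⊤) :
    ∃ R ⊆ A, I.RobConn R u v ∧
      (I.cost R : ℝ≥0∞) ≤ I.net.dist (I.netCost (A \ I.faulty)) u v := by
  obtain ⟨l, h1, h2, h3⟩ := Arcs.exists_dist_eq (finite_netCost _) h
  have hl : l.Nodup := (List.nodup_cons.1 h2).2.of_map
  obtain ⟨R, hR, hc, hj⟩ := exists_edgeSet (A := A \ I.faulty) l.toFinset fun j hj => by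
    refine ne_top_of_le_ne_top (h3 ▸ h) (List.single_le_sum (fun _ _ => zero_le) _
      (List.mem_map_of_mem (List.mem_toFinset.1 hj)))
  rw [List.sum_toFinset _ hl, h3] at hc
  refine ⟨R, hR.trans Finset.sdiff_subset, fun F hF _ => ?_, hc⟩
  have : R \ F = R := Finset.sdiff_eq_self_of_disjoint (Finset.disjoint_left.2 fun e he heF =>
    (Finset.mem_sdiff.1 (hR he)).2 (hF heF))
  rw [this]
  refine conn_of_net_walk h1 fun j hjl => ?_
  obtain ⟨e, he, x, y, g1, g2, g3, -⟩ := hj j (List.mem_toFinset.2 hjl)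
  exact ⟨e, he, x, y, g1, g2, g3⟩

/-- The flow may use both arcs of an undirected edge, so no pair of disjoint paths is extracted.
Instead, at least two arcs of the flow leave every cut, and they belong to different edges, because
opposite arcs cannot both leave it; one failure spares one of them. -/
theorem exists_robConn_of_pairVal {A : Finset (Fin I.m)} {u v : Fin I.n}
    (h : I.net.pairVal (I.netCost A) u v ≠ ⊤) :
    ∃ R ⊆ A, I.RobConn R u v ∧ (I.cost R : ℝ≥0∞) ≤ I.net.pairVal (I.netCost A) u v := by
  classical
  obtain ⟨B, hB, hBc⟩ := Arcs.exists_pairVal_eq (finite_netCost A) h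
  obtain ⟨R, hR, hc, hj⟩ := exists_edgeSet (A := A) B fun j hj =>
    ne_top_of_le_ne_top (hBc ▸ h) (Finset.single_le_sum (f := I.netCost A) (fun _ _ => zero_le) hj)
  rw [hBc] at hc
  refine ⟨R, hR, fun F hF hFc X hu hv => ?_, hc⟩
  have hcard := hB.le_card_cut (Fin.val '' X) ⟨u, hu, rfl⟩
    (fun ⟨x, hx, hxv⟩ => hv (Fin.ext hxv ▸ hx))
  obtain ⟨j, hjm, k, hkm, hjk⟩ := Finset.one_lt_card.1 (lt_of_lt_of_le one_lt_two hcard)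
  obtain ⟨hjB, ⟨x, hx, hxj⟩, hj2⟩ := Finset.mem_filter.1 hjm
  obtain ⟨hkB, ⟨y, hy, hyk⟩, hk2⟩ := Finset.mem_filter.1 hkm
  obtain ⟨e, he, a, b, h1, h2, h3, h4⟩ := hj j hjB
  obtain ⟨f, hf, c, d, g1, g2, g3, g4⟩ := hj k hkB
  obtain rfl : x = a := Fin.ext (hxj.trans h2)
  obtain rfl : y = c := Fin.ext (hyk.trans g2)
  by_cases heF : e ∈ F
  · by_cases hfF : f ∈ F
    · have hef := Finset.card_le_one.1 hFc e heF f hfF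
      subst hef
      exfalso
      -- Two distinct arcs of the same edge are `j` and `m + j`, which are opposite.
      have hopp : I.net.hd k = I.net.tl j := by
        have h5 := h4.trans g4.symm
        simp only [arcEdge] at h5
        simp only [net]
        split_ifs at h5 ⊢ with k1 k2 k2
        · exact absurd h5 hjk
        · rw [h5]
        · rw [h5]
        · exact absurd (by omega) hjk
      exact hk2 ⟨x, hx, hxj.trans hopp.symm⟩
    · exact ⟨f, Finset.mem_sdiff.2 ⟨hf, hfF⟩, y, hy, d, fun hd => hk2 ⟨d, hd, g3.symm⟩, g1⟩
  · exact ⟨e, Finset.mem_sdiff.2 ⟨he, heF⟩, x, hx, b, fun hb => hj2 ⟨b, hb, h3.symm⟩, h1⟩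

/-! ### The optimal value within a set of edges -/

variable (I) in
/-- The length of the pair `u`, `v` in the subgraph with edge set `A`. -/
noncomputable def linkVal (A : Finset (Fin I.m)) (u v : ℕ) : ℝ≥0∞ :=
  min (I.net.dist (I.netCost (A \ I.faulty)) u v) (I.net.pairVal (I.netCost A) u v)

/-- The complete graph on `n` vertices: arc `u * n + v` leads from `u` to `v`. -/
def completeNet (n : ℕ) : Arcs ℕ ℕ where
  tl k := k / n
  hd k := k % n

variable (I) in
/-- The cost of the arcs of the complete graph. -/
noncomputable def linkCost (A : Finset (Fin I.m)) (k : ℕ) : ℝ≥0∞ :=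
  if k < I.n * I.n then I.linkVal A (k / I.n) (k % I.n) else ⊤

variable (I) in
/-- The optimal value within the subgraph with edge set `A`. -/
noncomputable def optVal (A : Finset (Fin I.m)) : ℝ≥0∞ :=
  (completeNet I.n).dist (I.linkCost A) I.s I.t

theorem leLinks_linkVal (A : Finset (Fin I.m)) : I.LeLinks A fun u v => I.linkVal A u v where
  secure _ _ _ h hA := (min_le_left _ _).trans (net_dist_le h.1 fun _ he =>
    Finset.mem_sdiff.2 ⟨hA he, Finset.disjoint_left.1 h.2 he⟩)
  pair _ _ _ _ h hp hq := (min_le_right _ _).trans (net_pairVal_le h hp hq)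

theorem exists_completeNet_walk (A : Finset (Fin I.m)) (u : Fin I.n) (vs : List (Fin I.n)) :
    ∃ l, (completeNet I.n).Walk u l ((u :: vs).getLast (List.cons_ne_nil u vs)) ∧
      (l.map (I.linkCost A)).sum = pathSum (fun u v => I.linkVal A u v) u vs := by
  induction vs generalizing u with
  | nil => exact ⟨[], rfl, rfl⟩
  | cons v vs ih =>
    obtain ⟨l, h1, h2⟩ := ih v
    have hn : 0 < I.n := u.pos
    have e1 : (u * I.n + v : ℕ) / I.n = u := by
      rw [mul_comm, Nat.mul_add_div hn, Nat.div_eq_of_lt v.2, add_zero]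
    have e2 : (u * I.n + v : ℕ) % I.n = v := by
      rw [mul_comm, Nat.mul_add_mod, Nat.mod_eq_of_lt v.2]
    refine ⟨(u * I.n + v) :: l, ⟨e1, ?_⟩, ?_⟩
    · rw [List.getLast_cons (List.cons_ne_nil _ _)]
      change (completeNet I.n).Walk ((u * I.n + v : ℕ) % I.n) l _
      rw [e2]; exact h1
    · have hlt : (u * I.n + v : ℕ) < I.n * I.n := by
        calc (u * I.n + v : ℕ) < u * I.n + I.n := by have := v.2; omega
          _ = (u + 1) * I.n := by ring
          _ ≤ I.n * I.n := Nat.mul_le_mul_right _ u.2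
      rw [List.map_cons, List.sum_cons, h2, linkCost, if_pos hlt, e1, e2, pathSum]

/-- The bipath decomposition applied to `linkVal` inside `A`; simplicity of the path in the complete
graph is no longer needed. -/
theorem optVal_le {A S : Finset (Fin I.m)} (hS : I.IsFeasible 1 S) (hSA : S ⊆ A) :
    I.optVal A ≤ I.cost S := by
  obtain ⟨vs, h1, h2⟩ := (leLinks_linkVal A).exists_completePath_of_isFeasible hS hSA
  obtain ⟨l, h3, h4⟩ := exists_completeNet_walk A I.s vs
  rw [h1.2] at h3
  exact (Arcs.dist_le h3).trans (h4.trans_le h2)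

theorem exists_robConn_of_linkVal {A : Finset (Fin I.m)} {u v : Fin I.n}
    (h : I.linkVal A u v ≠ ⊤) :
    ∃ R ⊆ A, I.RobConn R u v ∧ (I.cost R : ℝ≥0∞) ≤ I.linkVal A u v := by
  rcases min_choice (I.net.dist (I.netCost (A \ I.faulty)) u v)
    (I.net.pairVal (I.netCost A) u v) with h1 | h1
  · have e : I.linkVal A u v = I.net.dist (I.netCost (A \ I.faulty)) u v := h1
    rw [e] at h ⊢
    exact exists_robConn_of_dist h
  · have e : I.linkVal A u v = I.net.pairVal (I.netCost A) u v := h1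
    rw [e] at h ⊢
    exact exists_robConn_of_pairVal h

theorem exists_robConn_of_completeNet_walk {A : Finset (Fin I.m)} {u v : Fin I.n} {l : List ℕ}
    (h : (completeNet I.n).Walk u l v) (hs : (l.map (I.linkCost A)).sum ≠ ⊤) :
    ∃ S ⊆ A, I.RobConn S u v ∧ (I.cost S : ℝ≥0∞) ≤ (l.map (I.linkCost A)).sum := by
  induction l generalizing u with
  | nil =>
    obtain rfl : u = v := Fin.ext h
    exact ⟨∅, by simp, robConn_self _ _, by simp [cost]⟩
  | cons k l ih =>
    rw [List.map_cons, List.sum_cons, ENNReal.add_ne_top] at hs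
    have hk : k < I.n * I.n := by
      by_contra hc
      exact hs.1 (if_neg hc)
    have hw : (completeNet I.n).Walk (⟨k % I.n, Nat.mod_lt _ u.pos⟩ : Fin I.n) l v := h.2
    have hu : k / I.n = u := h.1
    obtain ⟨S, h1, h2, h3⟩ := ih hw hs.2
    have hc : I.linkCost A k = I.linkVal A u (⟨k % I.n, Nat.mod_lt _ u.pos⟩ : Fin I.n) := by
      rw [linkCost, if_pos hk, hu]
    obtain ⟨R, g1, g2, g3⟩ := exists_robConn_of_linkVal (hc ▸ hs.1)
    refine ⟨R ∪ S, Finset.union_subset g1 h1, (g2.mono Finset.subset_union_left).trans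
      (h2.mono Finset.subset_union_right), ?_⟩
    rw [List.map_cons, List.sum_cons, hc]
    refine (ENNReal.coe_le_coe.2 (cost_union_le _ _)).trans ?_
    rw [ENNReal.coe_add]
    exact add_le_add g3 h3

/-- Replace each arc of a shortest walk in the complete graph by a set realizing its link, and take
the union. -/
theorem exists_isFeasible_of_optVal {A : Finset (Fin I.m)} (h : I.optVal A ≠ ⊤) :
    ∃ S ⊆ A, I.IsFeasible 1 S ∧ (I.cost S : ℝ≥0∞) ≤ I.optVal A := by
  obtain ⟨l, h1, -, h3⟩ := Arcs.exists_dist_eq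
    ((Set.finite_lt_nat (I.n * I.n)).subset fun k hk => by
      by_contra hc
      exact hk (if_neg hc)) h
  obtain ⟨S, g1, g2, g3⟩ := exists_robConn_of_completeNet_walk h1 (A := A) (by
    rw [h3]; exact h)
  exact ⟨S, g1, isFeasible_iff.2 g2, g3.trans h3.le⟩

/-- A feasible set that attains the value within `A` also competes within `A'`, so the components of
`linkVal` need not be compared. -/
theorem optVal_anti {A A' : Finset (Fin I.m)} (h : A ⊆ A') : I.optVal A' ≤ I.optVal A := by
  by_cases hA : I.optVal A = ⊤
  · rw [hA]; exact le_top
  · obtain ⟨S, h1, h2, h3⟩ := exists_isFeasible_of_optVal hA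
    exact (optVal_le h2 (h1.trans h)).trans h3

theorem not_isFeasible_of_optVal_eq_top (h : I.optVal Finset.univ = ⊤) :
    ¬ ∃ S, I.IsFeasible 1 S := fun ⟨S, hS⟩ => by
  have := optVal_le hS (Finset.subset_univ S)
  rw [h, top_le_iff] at this
  exact ENNReal.coe_ne_top this

/-- `A` contains a feasible `S` of cost at most the optimum. Its own value is then no larger, so
minimality forces `S = A`. This is why greedy deletion ends with a solution. -/
theorem isOptimal_of_minimal {A : Finset (Fin I.m)} (h : I.optVal Finset.univ ≠ ⊤)
    (hA : Minimal (fun A => I.optVal A ≤ I.optVal Finset.univ) A) : I.IsOptimal 1 A := by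
  obtain ⟨S, h1, h2, h3⟩ := exists_isFeasible_of_optVal (ne_top_of_le_ne_top h hA.1)
  have hSA : S = A := le_antisymm h1
    (hA.2 (((optVal_le h2 le_rfl).trans h3).trans hA.1 : I.optVal S ≤ _) h1)
  subst hSA
  exact ⟨h2, fun T hT => ENNReal.coe_le_coe.1
    ((h3.trans hA.1).trans (optVal_le hT (Finset.subset_univ T)))⟩

end Instance

/-! ### Reasoning about programs -/

namespace Prog

/-- A bound on the running time, if every loop makes at most `B` iterations. -/
def time (B : ℕ) : Prog → ℕ
  | skip => 1
  | setNat _ i x => i.steps + x.steps + 1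
  | setWt _ i x => i.steps + x.steps + 1
  | seq P Q => P.time B + Q.time B
  | ite b P Q => b.steps + (P.time B + Q.time B)
  | loop b P => (B + 1) * (b.steps + P.time B)

/-- The running time bound as a polynomial. -/
noncomputable def timePoly : Prog → Polynomial ℕ
  | skip => 1
  | setNat _ i x => .C (i.steps + x.steps + 1)
  | setWt _ i x => .C (i.steps + x.steps + 1)
  | seq P Q => P.timePoly + Q.timePoly
  | ite b P Q => .C b.steps + (P.timePoly + Q.timePoly)
  | loop b P => (.X + 1) * (.C b.steps + P.timePoly)

theorem eval_timePoly (B : ℕ) (P : Prog) : P.timePoly.eval B = P.time B := by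
  induction P <;> simp_all [timePoly, time]

/-- The program assigns to the array `a` of natural numbers. -/
def writesNat (a : ℕ) : Prog → Bool
  | skip => false
  | setNat b _ _ => a == b
  | setWt _ _ _ => false
  | seq P Q => P.writesNat a || Q.writesNat a
  | ite _ P Q => P.writesNat a || Q.writesNat a
  | loop _ P => P.writesNat a

/-- The program assigns to the array `a` of real numbers. -/
def writesWt (a : ℕ) : Prog → Bool
  | skip => false
  | setNat _ _ _ => false
  | setWt b _ _ => a == b
  | seq P Q => P.writesWt a || Q.writesWt a
  | ite _ P Q => P.writesWt a || Q.writesWt a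
  | loop _ P => P.writesWt a

end Prog

namespace State

variable (σ : State)

@[simp] theorem setNat_nat (a i x b j : ℕ) :
    (σ.setNat a i x).nat b j = if b = a ∧ j = i then x else σ.nat b j := by
  by_cases h : b = a
  · subst h; by_cases h' : j = i <;> simp [setNat, h']
  · simp [setNat, h]

@[simp] theorem setNat_wt (a i x : ℕ) : (σ.setNat a i x).wt = σ.wt := rfl

@[simp] theorem setWt_nat (a i : ℕ) (x : ℝ) : (σ.setWt a i x).nat = σ.nat := rfl

@[simp] theorem setWt_wt (a i b j : ℕ) (x : ℝ) :
    (σ.setWt a i x).wt b j = if b = a ∧ j = i then x else σ.wt b j := by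
  by_cases h : b = a
  · subst h; by_cases h' : j = i <;> simp [setWt, h']
  · simp [setWt, h]

theorem setNat_nat_of_ne {a b : ℕ} (h : b ≠ a) (i x : ℕ) :
    (σ.setNat a i x).nat b = σ.nat b := by
  funext j; simp [h]

theorem setWt_wt_of_ne {a b : ℕ} (h : b ≠ a) (i : ℕ) (x : ℝ) :
    (σ.setWt a i x).wt b = σ.wt b := by
  funext j; simp [h]

end State

/-- The states `σ` and `τ` agree on the arrays to which `P` does not assign. -/
structure Frame (P : Prog) (σ τ : State) : Prop where
  nat : ∀ a, P.writesNat a = false → τ.nat a = σ.nat a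
  wt : ∀ a, P.writesWt a = false → τ.wt a = σ.wt a

theorem Frame.refl (P : Prog) (σ : State) : Frame P σ σ := ⟨fun _ _ => rfl, fun _ _ => rfl⟩

theorem Frame.trans {P : Prog} {σ τ ρ : State} (h : Frame P σ τ) (h' : Frame P τ ρ) :
    Frame P σ ρ :=
  ⟨fun a ha => (h'.nat a ha).trans (h.nat a ha), fun a ha => (h'.wt a ha).trans (h.wt a ha)⟩

theorem Frame.of_imp {P Q : Prog} {σ τ : State} (h : Frame P σ τ)
    (hn : ∀ a, Q.writesNat a = false → P.writesNat a = false)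
    (hw : ∀ a, Q.writesWt a = false → P.writesWt a = false) : Frame Q σ τ :=
  ⟨fun a ha => h.nat a (hn a ha), fun a ha => h.wt a (hw a ha)⟩

/-- The syntactic frame rule. Most preservation facts below reduce to evaluating `writesNat` or
`writesWt`, often by `rfl`. -/
theorem Run.frame {P : Prog} {σ τ : State} {c : ℕ} (h : Run P σ c τ) : Frame P σ τ := by
  induction h with
  | skip σ => exact Frame.refl _ _
  | setNat σ a i x =>
    refine ⟨fun b hb => σ.setNat_nat_of_ne ?_ _ _, fun _ _ => rfl⟩
    simpa [Prog.writesNat] using hb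
  | setWt σ a i x =>
    refine ⟨fun _ _ => rfl, fun b hb => σ.setWt_wt_of_ne ?_ _ _⟩
    simpa [Prog.writesWt] using hb
  | seq _ _ h1 h2 =>
    refine (h1.of_imp ?_ ?_).trans (h2.of_imp ?_ ?_) <;>
      simp +contextual [Prog.writesNat, Prog.writesWt]
  | ite_true _ _ h1 =>
    refine h1.of_imp ?_ ?_ <;> simp +contextual [Prog.writesNat, Prog.writesWt]
  | ite_false _ _ h1 =>
    refine h1.of_imp ?_ ?_ <;> simp +contextual [Prog.writesNat, Prog.writesWt]
  | loop_true _ _ _ h1 h2 =>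
    exact (h1.of_imp (fun _ h => h) (fun _ h => h) : Frame (.loop _ _) _ _).trans h2
  | loop_false _ => exact Frame.refl _ _

/-- Started in `σ`, the program `P` halts within its time bound, in a state that satisfies `R`. -/
def Exec (B : ℕ) (P : Prog) (σ : State) (R : State → Prop) : Prop :=
  ∃ c τ, Run P σ c τ ∧ c ≤ P.time B ∧ R τ

namespace Exec

variable {B : ℕ} {P Q : Prog} {σ : State} {R : State → Prop}

theorem imp {R' : State → Prop} (h : Exec B P σ R) (hR : ∀ τ, Frame P σ τ → R τ → R' τ) :
    Exec B P σ R' := by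
  obtain ⟨c, τ, h1, h2, h3⟩ := h
  exact ⟨c, τ, h1, h2, hR τ h1.frame h3⟩

theorem skip (h : R σ) : Exec B .skip σ R := ⟨1, σ, .skip σ, le_rfl, h⟩

theorem setNat {a : ℕ} {i x : NExpr} (h : R (σ.setNat a (i.eval σ) (x.eval σ))) :
    Exec B (.setNat a i x) σ R := ⟨_, _, .setNat σ a i x, le_rfl, h⟩

theorem setWt {a : ℕ} {i : NExpr} {x : WExpr} (h : R (σ.setWt a (i.eval σ) (x.eval σ))) :
    Exec B (.setWt a i x) σ R := ⟨_, _, .setWt σ a i x, le_rfl, h⟩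

theorem seq (h : Exec B P σ fun τ => Exec B Q τ R) : Exec B (.seq P Q) σ R := by
  obtain ⟨c, τ, h1, h2, d, ρ, h3, h4, h5⟩ := h
  exact ⟨c + d, ρ, .seq h1 h3, Nat.add_le_add h2 h4, h5⟩

theorem ite {b : Test} (h : b.Holds σ → Exec B P σ R) (h' : ¬ b.Holds σ → Exec B Q σ R) :
    Exec B (.ite b P Q) σ R := by
  by_cases hb : b.Holds σ
  · obtain ⟨c, τ, h1, h2, h3⟩ := h hb
    exact ⟨_, τ, .ite_true hb h1, by simp only [Prog.time]; omega, h3⟩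
  · obtain ⟨c, τ, h1, h2, h3⟩ := h' hb
    exact ⟨_, τ, .ite_false hb h1, by simp only [Prog.time]; omega, h3⟩

end Exec

/-- The first cell of an array of natural numbers. -/
def rd (a : ℕ) : NExpr := .read a (.const 0)

/-- The first cell of an array of real numbers. -/
def rdW (a : ℕ) : WExpr := .read a (.const 0)

@[simp] theorem eval_rd (σ : State) (a : ℕ) : (rd a).eval σ = σ.nat a 0 := rfl

@[simp] theorem eval_rdW (σ : State) (a : ℕ) : (rdW a).eval σ = σ.wt a 0 := rfl

/-- Execute `P` with the variable `k` running from `0` to `N - 1`. -/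
def forLoop (k : ℕ) (N : NExpr) (P : Prog) : Prog :=
  .seq (.setNat k (.const 0) (.const 0))
    (.loop (.natLt (rd k) N) (.seq P (.setNat k (.const 0) (.add (rd k) (.const 1)))))

/-- The invariant rule. The body must not touch the counter, the bound must keep its value, and `hJ`
makes the invariant insensitive to counter updates. -/
theorem Exec.forLoop {B k : ℕ} {N : NExpr} {P : Prog} {σ : State} {M : ℕ} (hM : M ≤ B)
    (J : ℕ → State → Prop) (hk : P.writesNat k = false)
    (hN : ∀ τ, Frame (forLoop k N P) σ τ → N.eval τ = M)
    (hJ : ∀ i τ x, J i τ → J i (τ.setNat k 0 x)) (h0 : J 0 σ)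
    (hs : ∀ i < M, ∀ τ, Frame (FTP.forLoop k N P) σ τ → τ.nat k 0 = i → J i τ →
      Exec B P τ (J (i + 1))) :
    Exec B (FTP.forLoop k N P) σ (J M) := by
  have hset : ∀ (τ : State) (x : ℕ), Frame (FTP.forLoop k N P) τ (τ.setNat k 0 x) := by
    intro τ x
    refine ⟨fun a ha => τ.setNat_nat_of_ne ?_ _ _, fun _ _ => rfl⟩
    rintro rfl
    simp [FTP.forLoop, Prog.writesNat] at ha
  have hframe : ∀ τ ρ, Frame P τ ρ → Frame (FTP.forLoop k N P) τ ρ := by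
    intro τ ρ h
    refine h.of_imp ?_ ?_ <;>
      simp +contextual [FTP.forLoop, Prog.writesNat, Prog.writesWt]
  -- Induction on the number `d` of remaining iterations; the final summand pays for the last,
  -- failing test.
  have key : ∀ (d i : ℕ) (τ : State), i + d = M → Frame (FTP.forLoop k N P) σ τ →
      τ.nat k 0 = i → J i τ → ∃ c ρ, Run (.loop (.natLt (rd k) N)
        (.seq P (.setNat k (.const 0) (.add (rd k) (.const 1))))) τ c ρ ∧
        c ≤ d * ((Test.natLt (rd k) N).steps +
          (Prog.seq P (.setNat k (.const 0) (.add (rd k) (.const 1)))).time B) +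
          (Test.natLt (rd k) N).steps ∧ J M ρ := by
    intro d
    induction d with
    | zero =>
      intro i τ hi hf hτ hJi
      refine ⟨_, τ, .loop_false ?_, by omega, ?_⟩
      · simp [Test.Holds, hN τ hf, hτ]; omega
      · rwa [← hi, add_zero]
    | succ d ih =>
      intro i τ hi hf hτ hJi
      obtain ⟨c, ρ, h1, h2, h3⟩ := hs i (by omega) τ hf hτ hJi
      have hρk : ρ.nat k = τ.nat k := h1.frame.nat k hk
      have hρ := h1.frame
      obtain ⟨c', ρ', g1, g2, g3⟩ := ih (i + 1) (ρ.setNat k 0 (i + 1)) (by omega)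
        ((hf.trans (hframe _ _ hρ)).trans (hset _ _)) (by simp) (hJ _ _ _ h3)
      have hb : (Test.natLt (rd k) N).Holds τ := by
        simp [Test.Holds, hN τ hf, hτ]; omega
      have hset' : Run (.setNat k (.const 0) (.add (rd k) (.const 1))) ρ
          ((NExpr.const 0).steps + (NExpr.add (rd k) (.const 1)).steps + 1) (ρ.setNat k 0 (i + 1)) := by
        have := Run.setNat ρ k (.const 0) (.add (rd k) (.const 1))
        simpa [NExpr.eval, hρk, hτ] using this
      refine ⟨_, ρ', .loop_true hb (.seq h1 hset') g1, ?_, g3⟩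
      simp only [Prog.time] at g2 ⊢
      rw [Nat.add_mul]
      omega
  obtain ⟨c, ρ, h1, h2, h3⟩ := key M 0 (σ.setNat k 0 0) (by omega) (hset _ _) (by simp)
    (hJ _ _ _ h0)
  refine ⟨_, ρ, .seq (.setNat σ k (.const 0) (.const 0)) h1, ?_, h3⟩
  simp only [FTP.forLoop, Prog.time] at h2 ⊢
  refine Nat.add_le_add_left (h2.trans ?_) _
  set T := (Test.natLt (rd k) N).steps +
    (P.time B + (NExpr.steps (.const 0) + (NExpr.add (rd k) (.const 1)).steps + 1)) with hT
  calc M * T + (Test.natLt (rd k) N).steps ≤ B * T + T :=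
        Nat.add_le_add (Nat.mul_le_mul_right _ hM) (by omega)
    _ = (B + 1) * T := by ring

/-! ### Extended nonnegative numbers in memory -/

/-- The flag `f` and the number `d` represent `v`: the flag tells whether `v` is finite. -/
def Rep (f : ℕ) (d : ℝ) (v : ℝ≥0∞) : Prop :=
  (f = 1 ∧ 0 ≤ d ∧ v = ENNReal.ofReal d) ∨ (f ≠ 1 ∧ v = ⊤)

namespace Rep

variable {f g : ℕ} {d e : ℝ} {v w : ℝ≥0∞}

theorem eq_one_iff (h : Rep f d v) : f = 1 ↔ v ≠ ⊤ := by
  rcases h with ⟨h1, _, h2⟩ | ⟨h1, h2⟩ <;> simp [h1, h2]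

theorem nonneg (h : Rep f d v) (hf : f = 1) : 0 ≤ d := by
  rcases h with ⟨_, h1, _⟩ | ⟨h1, _⟩
  · exact h1
  · exact absurd hf h1

theorem eq_ofReal (h : Rep f d v) (hf : f = 1) : v = ENNReal.ofReal d := by
  rcases h with ⟨_, _, h1⟩ | ⟨h1, _⟩
  · exact h1
  · exact absurd hf h1

theorem eq_top (h : Rep f d v) (hf : f ≠ 1) : v = ⊤ := by
  rcases h with ⟨h1, _⟩ | ⟨_, h1⟩
  · exact absurd h1 hf
  · exact h1

theorem of_ofReal (h : 0 ≤ d) : Rep 1 d (ENNReal.ofReal d) := Or.inl ⟨rfl, h, rfl⟩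

theorem of_ne (h : f ≠ 1) : Rep f d ⊤ := Or.inr ⟨h, rfl⟩

/-- Nonnegativity of the stored numbers makes the real comparison faithful, since `ENNReal.ofReal`
identifies all negative numbers with `0`. -/
theorem lt_iff (h : Rep f d v) (h' : Rep g e w) (hf : f = 1) (hg : g = 1) : d < e ↔ v < w := by
  rw [h.eq_ofReal hf, h'.eq_ofReal hg]
  constructor
  · intro hlt
    exact (ENNReal.ofReal_lt_ofReal_iff (lt_of_le_of_lt (h.nonneg hf) hlt)).2 hlt
  · intro hlt
    by_contra hc
    exact absurd hlt (not_lt.2 (ENNReal.ofReal_le_ofReal (not_lt.1 hc)))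

theorem add (h : Rep f d v) (h' : Rep g e w) (hf : f = 1) (hg : g = 1) : Rep 1 (d + e) (v + w) := by
  rw [h.eq_ofReal hf, h'.eq_ofReal hg, ← ENNReal.ofReal_add (h.nonneg hf) (h'.nonneg hg)]
  exact of_ofReal (add_nonneg (h.nonneg hf) (h'.nonneg hg))

end Rep

/-- The arrays `tl`, `hd` of natural numbers and the arrays `al`, `cw` of flags and of real numbers
hold the tails, heads, and costs of the first `M` arcs of `G`. The other arcs have infinite cost,
and all vertices are less than `n`. -/
structure Loaded (σ : State) (n M tl hd al cw : ℕ) (G : Arcs ℕ ℕ) (c : ℕ → ℝ≥0∞) : Prop where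
  tl_eq : ∀ j < M, σ.nat tl j = G.tl j
  hd_eq : ∀ j < M, σ.nat hd j = G.hd j
  tl_lt : ∀ j < M, G.tl j < n
  hd_lt : ∀ j < M, G.hd j < n
  rep : ∀ j < M, Rep (σ.nat al j) (σ.wt cw j) (c j)
  top : ∀ j, M ≤ j → c j = ⊤

theorem Loaded.congr {σ τ : State} {n M tl hd al cw : ℕ} {G : Arcs ℕ ℕ} {c : ℕ → ℝ≥0∞}
    (h : Loaded σ n M tl hd al cw G c) (h1 : τ.nat tl = σ.nat tl) (h2 : τ.nat hd = σ.nat hd)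
    (h3 : τ.nat al = σ.nat al) (h4 : τ.wt cw = σ.wt cw) : Loaded τ n M tl hd al cw G c := by
  refine ⟨?_, ?_, h.tl_lt, h.hd_lt, ?_, h.top⟩
  · rw [h1]; exact h.tl_eq
  · rw [h2]; exact h.hd_eq
  · rw [h3, h4]; exact h.rep

/-! ### The algorithm of Bellman and Ford -/

/-- Relax the arc whose index is in the variable `22`. -/
def relax (tl hd al cw : ℕ) : Prog :=
  let t := NExpr.read tl (rd 22)
  let h := NExpr.read hd (rd 22)
  let new := WExpr.add (.read 20 t) (.read cw (rd 22))
  let upd := Prog.seq (.setNat 20 h (.const 1)) (.setWt 20 h new)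
  .ite (.natEq (.read al (rd 22)) (.const 1))
    (.ite (.natEq (.read 20 t) (.const 1))
      (.ite (.natEq (.read 20 h) (.const 1))
        (.ite (.wtLt new (.read 20 h)) upd .skip)
        upd)
      .skip)
    .skip

/-- Compute the distances from the vertex in the variable `u`. The number of arcs is in the variable
`K`, and the distances are returned in the arrays `20`. -/
def bellmanFord (tl hd al cw K u : ℕ) : Prog :=
  .seq (forLoop 21 (rd 0) (.setNat 20 (rd 21) (.const 0)))
    (.seq (.setNat 20 (rd u) (.const 1))
      (.seq (.setWt 20 (rd u) .zero)
        (forLoop 21 (rd 0) (forLoop 22 (rd K) (relax tl hd al cw)))))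

/-- The arrays `20` represent the labels `lab`. -/
def Labels (σ : State) (n : ℕ) (lab : ℕ → ℝ≥0∞) : Prop :=
  ∀ x < n, Rep (σ.nat 20 x) (σ.wt 20 x) (lab x)

theorem Labels.update {σ τ : State} {n : ℕ} {lab : ℕ → ℝ≥0∞} (h : Labels σ n lab) {y : ℕ}
    {w : ℝ≥0∞} (hy : Rep (τ.nat 20 y) (τ.wt 20 y) w)
    (hx : ∀ x, x ≠ y → τ.nat 20 x = σ.nat 20 x ∧ τ.wt 20 x = σ.wt 20 x) :
    Labels τ n (Function.update lab y w) := by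
  intro x hxn
  by_cases hxy : x = y
  · subst hxy; rwa [Function.update_self]
  · rw [Function.update_of_ne hxy, (hx x hxy).1, (hx x hxy).2]
    exact h x hxn

/-- An absent arc or an unreached tail makes the candidate infinite, and an unreached head makes it
no worse than the old label; only the remaining case compares numbers. -/
theorem relax_exec {B : ℕ} {σ : State} {n M tl hd al cw : ℕ} {G : Arcs ℕ ℕ} {c : ℕ → ℝ≥0∞}
    (hL : Loaded σ n M tl hd al cw G c) (htl : tl ≠ 20) (hhd : hd ≠ 20)
    {lab : ℕ → ℝ≥0∞} (hlab : Labels σ n lab) {j : ℕ} (hj : σ.nat 22 0 = j) (hjM : j < M) :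
    Exec B (relax tl hd al cw) σ fun τ => Labels τ n
      (Function.update lab (G.hd j) (min (lab (G.hd j)) (lab (G.tl j) + c j))) := by
  have ht := hL.tl_eq j hjM
  have hh := hL.hd_eq j hjM
  have hrt := hlab _ (hL.tl_lt j hjM)
  have hrh := hlab _ (hL.hd_lt j hjM)
  have hrc := hL.rep j hjM
  have hskip : lab (G.hd j) ≤ lab (G.tl j) + c j → Labels σ n
      (Function.update lab (G.hd j) (min (lab (G.hd j)) (lab (G.tl j) + c j))) := by
    intro hle
    rwa [min_eq_left hle, Function.update_eq_self]
  have hupd : lab (G.tl j) + c j ≤ lab (G.hd j) → σ.nat al j = 1 → σ.nat 20 (G.tl j) = 1 →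
      Exec B (.seq (.setNat 20 (.read hd (rd 22)) (.const 1)) (.setWt 20 (.read hd (rd 22))
        (.add (.read 20 (.read tl (rd 22))) (.read cw (rd 22))))) σ fun τ => Labels τ n
        (Function.update lab (G.hd j) (min (lab (G.hd j)) (lab (G.tl j) + c j))) := by
    intro hle ha hf
    rw [min_eq_right hle]
    refine Exec.seq (Exec.setNat (Exec.setWt (hlab.update ?_ fun x hx => ?_)))
    · simpa [NExpr.eval, WExpr.eval, hj, ht, hh, htl, hhd] using hrt.add hrc hf ha
    · simp [NExpr.eval, WExpr.eval, hj, ht, hh, hhd, hx]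
  refine Exec.ite (fun h1 => Exec.ite (fun h2 => Exec.ite (fun h3 => Exec.ite (fun h4 => ?_)
    fun h4 => Exec.skip ?_) fun h3 => ?_) fun h2 => Exec.skip ?_) fun h1 => Exec.skip ?_
  all_goals simp only [Test.Holds, NExpr.eval, WExpr.eval, eval_rd, hj, ht, hh] at *
  · refine hupd ?_ h1 h2
    exact ((hrt.add hrc h2 h1).lt_iff hrh rfl h3).1 h4 |>.le
  · refine hskip ?_
    rw [(hrt.add hrc h2 h1).lt_iff hrh rfl h3] at h4
    exact not_lt.1 h4
  · exact hupd (by rw [hrh.eq_top h3]; exact le_top) h1 h2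
  · exact hskip (by rw [hrt.eq_top h2, top_add]; exact le_top)
  · exact hskip (by rw [hrc.eq_top h1, add_top]; exact le_top)

variable {B : ℕ} {σ : State} {n M tl hd al cw K u : ℕ} {G : Arcs ℕ ℕ} {c : ℕ → ℝ≥0∞}

/-- The labels `lab` are upper bounds of the distances from `s`, and at most the cost of each walk
with at most `r` arcs. -/
structure Bounds (G : Arcs ℕ ℕ) (c : ℕ → ℝ≥0∞) (s r : ℕ) (lab : ℕ → ℝ≥0∞) : Prop where
  dist_le : ∀ x, G.dist c s x ≤ lab x
  le_sum : ∀ l, l.length ≤ r → ∀ x, G.Walk s l x → lab x ≤ (l.map c).sum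

/-- Labels are updated in place and only decrease, so values from earlier in the round can only
improve the bounds. A walk with `r + 1` arcs is handled when its last arc is relaxed. -/
theorem relaxAll_exec {s r : ℕ} (hMB : M ≤ B) (hK : σ.nat K 0 = M) (hKn : 22 < K)
    (hL : Loaded σ n M tl hd al cw G c) (htl : 22 < tl) (hhd : 22 < hd) (hal : 22 < al)
    (hcw : 20 < cw) (hlab : ∃ lab, Labels σ n lab ∧ Bounds G c s r lab) :
    Exec B (forLoop 22 (rd K) (relax tl hd al cw)) σ fun τ =>
      ∃ lab, Labels τ n lab ∧ Bounds G c s (r + 1) lab := by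
  have hw : ∀ a, 22 < a → (forLoop 22 (rd K) (relax tl hd al cw)).writesNat a = false := by
    intro a ha
    simp [forLoop, relax, Prog.writesNat]; omega
  have hww : ∀ a, 20 < a → (forLoop 22 (rd K) (relax tl hd al cw)).writesWt a = false := by
    intro a ha
    simp [forLoop, relax, Prog.writesWt]; omega
  -- The extra clause records the gain for the arcs `j < i` relaxed so far in this round.
  refine (Exec.forLoop hMB (fun i τ => ∃ lab, Labels τ n lab ∧ Bounds G c s r lab ∧
    ∀ j < i, ∀ l, l.length ≤ r → G.Walk s l (G.tl j) → lab (G.hd j) ≤ (l.map c).sum + c j)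
    rfl ?_ ?_ ?_ ?_).imp ?_
  · intro τ hf
    rw [eval_rd, hf.nat K (hw K hKn), hK]
  · rintro i τ x ⟨lab, h1, h2⟩
    exact ⟨lab, fun y hy => by simpa using h1 y hy, h2⟩
  · obtain ⟨lab, h1, h2⟩ := hlab
    exact ⟨lab, h1, h2, fun j hj => absurd hj (Nat.not_lt_zero j)⟩
  · rintro j hj τ hf hτ ⟨lab, h1, h2, h3⟩
    have hL' := hL.congr (hf.nat _ (hw _ htl)) (hf.nat _ (hw _ hhd)) (hf.nat _ (hw _ hal))
      (hf.wt _ (hww _ hcw))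
    refine (relax_exec hL' (by omega) (by omega) h1 hτ hj).imp fun ρ _ hρ => ⟨_, hρ, ?_⟩
    set lab' := Function.update lab (G.hd j) (min (lab (G.hd j)) (lab (G.tl j) + c j)) with hlab'
    have hle : ∀ x, lab' x ≤ lab x := by
      intro x
      by_cases hx : x = G.hd j
      · subst hx; rw [hlab', Function.update_self]; exact min_le_left _ _
      · rw [hlab', Function.update_of_ne hx]
    refine ⟨⟨fun x => ?_, fun l hl x hx => (hle x).trans (h2.le_sum l hl x hx)⟩, ?_⟩
    · by_cases hx : x = G.hd j
      · subst hx
        rw [hlab', Function.update_self]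
        exact le_min (h2.dist_le _) ((Arcs.dist_hd_le s j).trans
          (add_le_add (h2.dist_le _) le_rfl))
      · rw [hlab', Function.update_of_ne hx]; exact h2.dist_le x
    · intro i hi l hl hwalk
      rcases Nat.lt_succ_iff_lt_or_eq.1 hi with hi | rfl
      · exact (hle _).trans (h3 i hi l hl hwalk)
      · rw [hlab', Function.update_self]
        exact (min_le_right _ _).trans (add_le_add (h2.le_sum l hl _ hwalk) le_rfl)
  · rintro τ - ⟨lab, h1, h2, h3⟩
    refine ⟨lab, h1, h2.dist_le, fun l hl x hx => ?_⟩
    rcases List.eq_nil_or_concat' l with rfl | ⟨l', j, rfl⟩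
    · exact h2.le_sum [] (by simp) x hx
    · obtain ⟨y, hy, hy'⟩ := hx.split
      obtain rfl : G.tl j = y := hy'.1
      obtain rfl : G.hd j = x := hy'.2
      rw [List.map_append, List.sum_append]
      by_cases hj : j < M
      · simpa using h3 j hj l' (by simpa using hl) hy
      · simp [hL.top j (not_lt.1 hj)]

/-- A walk of finite cost shortens to a path using arcs below `M` only. Its vertices are distinct
and less than `n`, so it has fewer than `n` arcs and `n` rounds suffice. -/
theorem Bounds.eq_dist {s : ℕ} {lab : ℕ → ℝ≥0∞} (h : Bounds G c s n lab) (hs : s < n)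
    (hd_lt : ∀ j < M, G.hd j < n) (htop : ∀ j, M ≤ j → c j = ⊤) (x : ℕ) :
    lab x = G.dist c s x := by
  refine le_antisymm (le_iInf₂ fun l hl => ?_) (h.dist_le x)
  by_cases hsum : (l.map c).sum = ⊤
  · rw [hsum]; exact le_top
  obtain ⟨l', h1, h2, h3⟩ := hl.exists_path
  refine (h.le_sum l' ?_ x h2).trans ((h1.map c).sum_le_sum fun _ _ => zero_le)
  have hsub : (s :: l'.map G.hd).toFinset ⊆ Finset.range n := by
    intro y hy
    rw [Finset.mem_range]
    rcases List.mem_cons.1 (List.mem_toFinset.1 hy) with rfl | hy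
    · exact hs
    · obtain ⟨j, hj, rfl⟩ := List.mem_map.1 hy
      refine hd_lt j ?_
      by_contra hc
      have : c j ≤ (l.map c).sum :=
        List.single_le_sum (fun _ _ => zero_le) _ (List.mem_map_of_mem (h1.subset hj))
      rw [htop j (not_lt.1 hc), top_le_iff] at this
      exact hsum this
  have := Finset.card_le_card hsub
  rw [List.toFinset_card_of_nodup h3, Finset.card_range] at this
  simp at this
  omega

theorem bellmanFord_exec {s : ℕ} (hnB : n ≤ B) (hMB : M ≤ B) (hn : σ.nat 0 0 = n)
    (hK : σ.nat K 0 = M) (hu : σ.nat u 0 = s) (hs : s < n)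
    (hL : Loaded σ n M tl hd al cw G c) (htl : 22 < tl) (hhd : 22 < hd) (hal : 22 < al)
    (hcw : 20 < cw) (hKn : 22 < K) (hun : 22 < u) :
    Exec B (bellmanFord tl hd al cw K u) σ fun τ => Labels τ n (G.dist c s) := by
  have hw : ∀ a, 22 < a → (forLoop 21 (rd 0) (.setNat 20 (rd 21) (.const 0))).writesNat a = false := by
    intro a ha
    simp [forLoop, Prog.writesNat]; omega
  have hw' : ∀ a, 22 < a → (forLoop 21 (rd 0) (forLoop 22 (rd K)
      (relax tl hd al cw))).writesNat a = false := by
    intro a ha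
    simp [forLoop, relax, Prog.writesNat]; omega
  have hww' : ∀ a, 20 < a → (forLoop 21 (rd 0) (forLoop 22 (rd K)
      (relax tl hd al cw))).writesWt a = false := by
    intro a ha
    simp [forLoop, relax, Prog.writesWt]; omega
  refine Exec.seq ((Exec.forLoop hnB (fun i τ => ∀ x < i, τ.nat 20 x = 0) rfl ?_ ?_ ?_ ?_).imp ?_)
  · intro τ hf
    rw [eval_rd, hf.nat 0 rfl, hn]
  · intro i τ x h y hy
    simpa using h y hy
  · intro x hx
    exact absurd hx (Nat.not_lt_zero x)
  · intro i hi τ hf hτ h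
    refine Exec.setNat fun x hx => ?_
    by_cases hxi : x = i
    · simp [NExpr.eval, hτ, hxi]
    · simpa [NExpr.eval, hτ, hxi] using h x (by omega)
  intro τ hf hclear
  have hτu : τ.nat u 0 = s := by rw [hf.nat u (hw u hun), hu]
  have hτn : τ.nat 0 0 = n := by rw [hf.nat 0 rfl, hn]
  have hτK : τ.nat K 0 = M := by rw [hf.nat K (hw K hKn), hK]
  have hτL := hL.congr (hf.nat _ (hw _ htl)) (hf.nat _ (hw _ hhd)) (hf.nat _ (hw _ hal))
      (hf.wt cw rfl)
  refine Exec.seq (Exec.setNat (Exec.seq (Exec.setWt ?_)))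
  have hu20 : u ≠ 20 := by omega
  simp only [NExpr.eval, WExpr.eval, eval_rd, hτu, State.setNat_nat, hu20, false_and, if_false]
  set ρ := (τ.setNat 20 s 1).setWt 20 s 0 with hρ
  have hρn : ∀ a, 22 < a → ρ.nat a = τ.nat a := fun a ha =>
    τ.setNat_nat_of_ne (by omega) _ _
  have hρw : ∀ a, 20 < a → ρ.wt a = τ.wt a := fun a ha =>
    (τ.setNat 20 s 1).setWt_wt_of_ne (by omega) _ _
  have hρL := hτL.congr (hρn _ htl) (hρn _ hhd) (hρn _ hal) (hρw _ hcw)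
  have hρ0 : ρ.nat 0 0 = n := by simp [hρ, hτn]
  refine (Exec.forLoop hnB (fun i τ => ∃ lab, Labels τ n lab ∧ Bounds G c s i lab)
    rfl ?_ ?_ ?_ ?_).imp ?_
  · intro π hf
    rw [eval_rd, hf.nat 0 rfl, hρ0]
  · rintro i π x ⟨lab, h1, h2⟩
    exact ⟨lab, fun y hy => by simpa using h1 y hy, h2⟩
  -- The initial labels are exact for the empty walk, the only one with at most `0` arcs.
  · refine ⟨fun x => if x = s then 0 else ⊤, fun x hx => ?_, fun x => ?_, fun l hl x hx => ?_⟩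
    · by_cases hxs : x = s
      · simpa [hρ, hxs] using Rep.of_ofReal (le_refl (0 : ℝ))
      · simpa [hρ, hxs, hclear x hx] using Rep.of_ne (f := 0) (d := τ.wt 20 x) (by norm_num)
    · split_ifs with h
      · rw [h, Arcs.dist_self]
      · exact le_top
    · obtain rfl : l = [] := List.length_eq_zero_iff.1 (Nat.le_zero.1 hl)
      obtain rfl : s = x := hx
      simp
  · rintro i hi π hf hπ hlab
    exact relaxAll_exec hMB (by rw [hf.nat K (hw' K hKn), hρn K hKn, hτK]) hKn
      (hρL.congr (hf.nat _ (hw' _ htl)) (hf.nat _ (hw' _ hhd)) (hf.nat _ (hw' _ hal))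
      (hf.wt _ (hww' _ hcw))) htl hhd hal hcw hlab
  · rintro π - ⟨lab, h1, h2⟩ x hx
    rw [← h2.eq_dist hs hL.hd_lt hL.top x]
    exact h1 x hx

/-! ### Greedy deletion -/

/-- The indices below `M` that are marked by `1` in the array `X`. -/
def onSet (σ : State) (X M : ℕ) : Finset ℕ := (Finset.range M).filter fun i => σ.nat X i = 1

theorem mem_onSet {σ : State} {X M i : ℕ} : i ∈ onSet σ X M ↔ i < M ∧ σ.nat X i = 1 := by
  simp [onSet]

theorem onSet_congr {σ τ : State} {X M : ℕ} (h : τ.nat X = σ.nat X) :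
    onSet τ X M = onSet σ X M := by
  simp [onSet, h]

/-- Delete the indices `0, …, N - 1` one after the other from the set with indicator vector `X`, but
restore those whose deletion makes `P` set the flag `fl` to a number different from `1`. -/
def greedy (k : ℕ) (N : NExpr) (X fl : ℕ) (P : Prog) : Prog :=
  forLoop k N (.ite (.natEq (.read X (rd k)) (.const 1))
    (.seq (.setNat X (rd k) (.const 0))
      (.seq P (.ite (.natEq (rd fl) (.const 1)) .skip (.setNat X (rd k) (.const 1)))))
    .skip)

/-- One pass suffices since `good` is inherited by supersets: an index that could not be deleted
from a larger set cannot be deleted later from a smaller one. The bound `1` on the cells is kept for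
the truncated differences in `fillAlive`. -/
theorem greedy_exec {B k X fl M : ℕ} {N : NExpr} {P : Prog} {σ : State} {good : Finset ℕ → Prop}
    (hmono : ∀ S T, S ⊆ T → good S → good T) (hM : M ≤ B) (hkX : k ≠ X) (hfX : fl ≠ X)
    (hk : P.writesNat k = false) (hX : P.writesNat X = false)
    (hN : ∀ τ, Frame (greedy k N X fl P) σ τ → N.eval τ = M)
    (h01 : ∀ i < M, σ.nat X i ≤ 1) (h0 : good (onSet σ X M))
    (hP : ∀ τ, Frame (greedy k N X fl P) σ τ → (∀ i < M, τ.nat X i ≤ 1) →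
      onSet τ X M ⊆ onSet σ X M →
      Exec B P τ fun ρ => ρ.nat fl 0 = 1 ↔ good (onSet τ X M)) :
    Exec B (greedy k N X fl P) σ fun τ => (∀ i < M, τ.nat X i ≤ 1) ∧
      onSet τ X M ⊆ onSet σ X M ∧ Minimal good (onSet τ X M) := by
  have hset : ∀ (τ : State) (i x : ℕ), Frame (greedy k N X fl P) τ (τ.setNat X i x) := by
    intro τ i x
    refine ⟨fun a ha => τ.setNat_nat_of_ne ?_ _ _, fun _ _ => rfl⟩
    rintro rfl
    simp [greedy, forLoop, Prog.writesNat] at ha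
  refine (Exec.forLoop hM (fun i τ => (∀ i < M, τ.nat X i ≤ 1) ∧
    onSet τ X M ⊆ onSet σ X M ∧ good (onSet τ X M) ∧
    ∀ e < i, e ∈ onSet τ X M → ¬ good ((onSet τ X M).erase e)) ?_ hN ?_ ?_ ?_).imp ?_
  · simp [Prog.writesNat, hk, hkX]
  · intro i τ x h
    have e : (τ.setNat k 0 x).nat X = τ.nat X := τ.setNat_nat_of_ne hkX.symm _ _
    rw [onSet_congr e]
    simpa only [e] using h
  · exact ⟨h01, subset_rfl, h0, fun e he => absurd he (Nat.not_lt_zero e)⟩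
  · rintro i hi τ hf hτ ⟨h1, h2, h3, h4⟩
    refine Exec.ite (fun hXi => ?_) fun hXi => Exec.skip ⟨h1, h2, h3, fun e he heS => ?_⟩
    · simp only [Test.Holds, NExpr.eval, eval_rd, hτ] at hXi
      refine Exec.seq (Exec.setNat ?_)
      simp only [NExpr.eval, eval_rd, hτ]
      set τ₁ := τ.setNat X i 0 with hτ₁
      have e1 : onSet τ₁ X M = (onSet τ X M).erase i := by
        ext j
        simp only [mem_onSet, Finset.mem_erase, hτ₁, State.setNat_nat]
        by_cases hj : j = i <;> simp [hj]
      have hle1 : ∀ j < M, τ₁.nat X j ≤ 1 := by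
        intro j hj
        simp only [hτ₁, State.setNat_nat]
        split_ifs
        · omega
        · exact h1 j hj
      have hsub : onSet τ₁ X M ⊆ onSet σ X M := by
        rw [e1]; exact (Finset.erase_subset _ _).trans h2
      refine Exec.seq ((hP τ₁ (hf.trans (hset _ _ _)) hle1 hsub).imp fun ρ hfρ hρ => ?_)
      have hρX : ρ.nat X = τ₁.nat X := hfρ.nat X hX
      have hρk : ρ.nat k 0 = i := by
        rw [hfρ.nat k hk, hτ₁, State.setNat_nat_of_ne _ hkX, hτ]
      refine Exec.ite (fun hb => Exec.skip ?_) fun hb => Exec.setNat ?_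
      · rw [onSet_congr hρX, hρX]
        refine ⟨hle1, hsub, hρ.1 hb, fun e he heS hg => ?_⟩
        rw [e1] at heS hg
        rw [Finset.mem_erase] at heS
        exact h4 e (by have := heS.1; omega) heS.2
          (hmono _ _ (Finset.erase_subset_erase _ (Finset.erase_subset _ _)) hg)
      · simp only [NExpr.eval, eval_rd, hρk]
        -- The cell held `1` before the trial deletion, so restoring it recovers the whole array.
        have e2 : (ρ.setNat X i 1).nat X = τ.nat X := by
          funext j
          simp only [State.setNat_nat, hρX, hτ₁, true_and]
          by_cases hj : j = i <;> simp [hj, hXi]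
        rw [onSet_congr e2, e2]
        refine ⟨h1, h2, h3, fun e he heS hg => ?_⟩
        rcases Nat.lt_succ_iff_lt_or_eq.1 he with he | rfl
        · exact h4 e he heS hg
        · rw [← e1] at hg
          exact hb (hρ.2 hg)
    · simp only [Test.Holds, NExpr.eval, eval_rd, hτ] at hXi
      rcases Nat.lt_succ_iff_lt_or_eq.1 he with he | rfl
      · exact h4 e he heS
      · exact absurd (mem_onSet.1 heS).2 hXi
  · rintro τ - ⟨h1, h2, h3, h4⟩
    refine ⟨h1, h2, h3, fun T hT hTS => ?_⟩
    by_contra hc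
    obtain ⟨e, he, heT⟩ := Finset.not_subset.1 hc
    exact h4 e (mem_onSet.1 he).1 he (hmono _ _ (Finset.subset_erase.2 ⟨hTS, heT⟩) hT)

/-! ### Shortest paths as minimal arc sets -/

namespace Arcs

variable {V α : Type*} {G : Arcs V α} {c : α → ℝ≥0∞} [DecidableEq α]

/-- The cost function after the deletion of the arcs outside of `T`. -/
def restrict (c : α → ℝ≥0∞) (T : Finset α) (a : α) : ℝ≥0∞ := if a ∈ T then c a else ⊤

omit [DecidableEq α] in
theorem dist_mono {c c' : α → ℝ≥0∞} (h : ∀ a, c a ≤ c' a) (u v : V) :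
    G.dist c u v ≤ G.dist c' u v :=
  le_iInf₂ fun _ hl => (dist_le hl).trans (List.sum_le_sum fun a _ => h a)

theorem dist_restrict_anti {S T : Finset α} (h : S ⊆ T) (u v : V) :
    G.dist (restrict c T) u v ≤ G.dist (restrict c S) u v := by
  refine dist_mono (fun a => ?_) u v
  unfold restrict
  by_cases ha : a ∈ S
  · simp [ha, h ha]
  · simp [ha]

/-- A shortest path in the restricted network uses only arcs of `p`, and its arcs alone preserve the
distance; minimality leaves nothing else in `p`. -/
theorem isFlow_of_minimal {p : Finset α} {u v : V} (hD : G.dist c u v ≠ ⊤)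
    (hp : Minimal (fun T => G.dist (restrict c T) u v ≤ G.dist c u v) p) :
    G.IsFlow p 1 u v ∧ ∑ a ∈ p, c a = G.dist c u v := by
  have hfin : {a | restrict c p a ≠ ⊤}.Finite := p.finite_toSet.subset fun a ha => by
    by_contra hc
    exact ha (if_neg hc)
  have hDp := ne_top_of_le_ne_top hD hp.1
  obtain ⟨l, h1, h2, h3⟩ := exists_dist_eq hfin hDp
  have hl : l.Nodup := (List.nodup_cons.1 h2).2.of_map
  have hlp : ∀ a ∈ l, a ∈ p := by
    intro a ha
    by_contra hc
    have : restrict c p a ≤ (l.map (restrict c p)).sum :=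
      List.single_le_sum (fun _ _ => zero_le) _ (List.mem_map_of_mem ha)
    rw [h3, restrict, if_neg hc, top_le_iff] at this
    exact hDp this
  have e1 : l.map (restrict c p) = l.map c :=
    List.map_congr_left fun a ha => if_pos (hlp a ha)
  have e2 : l.map (restrict c l.toFinset) = l.map c :=
    List.map_congr_left fun a ha => if_pos (List.mem_toFinset.2 ha)
  rw [e1] at h3
  have hle : G.dist (restrict c l.toFinset) u v ≤ G.dist c u v := by
    refine (dist_le h1).trans ?_
    rw [e2, h3]
    exact hp.1
  obtain rfl : p = l.toFinset :=
    le_antisymm (hp.2 hle fun a ha => hlp a (List.mem_toFinset.1 ha))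
      fun a ha => hlp a (List.mem_toFinset.1 ha)
  refine ⟨h1.isFlow hl, ?_⟩
  rw [List.sum_toFinset _ hl, h3]
  exact le_antisymm hp.1 (h3 ▸ dist_le h1)

end Arcs

/-! ### The length of a pair of vertices -/

/-- The memory holds a network in the arrays `30`, `31`, `34` and two vertices in the variables `40`
and `41`. -/
structure PairCtx (B : ℕ) (σ : State) (n M u v : ℕ) (G : Arcs ℕ ℕ) (c : ℕ → ℝ≥0∞) : Prop where
  n_le : n ≤ B
  M_le : M ≤ B
  n_eq : σ.nat 0 0 = n
  M_eq : σ.nat 32 0 = M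
  u_eq : σ.nat 40 0 = u
  v_eq : σ.nat 41 0 = v
  u_lt : u < n
  v_lt : v < n
  loaded : Loaded σ n M 30 31 34 30 G c
  le_one : ∀ j < M, σ.nat 34 j ≤ 1

variable {B : ℕ} {σ τ : State} {n M u v : ℕ} {G : Arcs ℕ ℕ} {c cs : ℕ → ℝ≥0∞} {P : Prog}

theorem PairCtx.frame (h : PairCtx B σ n M u v G c) (hf : Frame P σ τ)
    (hn : ([0, 30, 31, 32, 34, 40, 41].all fun a => !P.writesNat a) = true)
    (hw : P.writesWt 30 = false) : PairCtx B τ n M u v G c := by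
  have hn' : ∀ a ∈ [0, 30, 31, 32, 34, 40, 41], τ.nat a = σ.nat a := fun a ha =>
    hf.nat a (by simpa using List.all_eq_true.1 hn a ha)
  refine ⟨h.n_le, h.M_le, ?_, ?_, ?_, ?_, h.u_lt, h.v_lt,
    h.loaded.congr (hn' _ (by simp)) (hn' _ (by simp)) (hn' _ (by simp)) (hf.wt _ hw), ?_⟩
  · rw [hn' 0 (by simp)]; exact h.n_eq
  · rw [hn' 32 (by simp)]; exact h.M_eq
  · rw [hn' 40 (by simp)]; exact h.u_eq
  · rw [hn' 41 (by simp)]; exact h.v_eq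
  · rw [hn' 34 (by simp)]; exact h.le_one

theorem PairCtx.finite (h : PairCtx B σ n M u v G c) : {a | c a ≠ ⊤}.Finite :=
  (Set.finite_lt_nat M).subset fun j hj => by
    by_contra hc
    exact hj (h.loaded.top j (not_lt.1 hc))

/-- Store the distance of the vertex in the variable `41` as link length. -/
def storeDist : Prog :=
  .seq (.setNat 46 (.const 0) (.read 20 (rd 41))) (.setWt 34 (.const 0) (.read 20 (rd 41)))

/-- Save the truncated distances as potentials. -/
def savePot : Prog :=
  .seq (.setWt 33 (.const 0) (.read 20 (rd 41)))
    (forLoop 49 (rd 0)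
      (.ite (.natEq (.read 20 (rd 49)) (.const 1))
        (.ite (.wtLt (.read 20 (rd 49)) (rdW 33))
          (.setWt 31 (rd 49) (.read 20 (rd 49)))
          (.setWt 31 (rd 49) (rdW 33)))
        (.setWt 31 (rd 49) (rdW 33))))

/-- Mark all arcs. -/
def markAll : Prog := forLoop 48 (rd 32) (.setNat 35 (rd 48) (.read 34 (rd 48)))

/-- Test whether the marked arcs contain a shortest path. -/
def testPath : Prog :=
  .seq (bellmanFord 30 31 35 30 32 40)
    (.ite (.natEq (.read 20 (rd 41)) (.const 1))
      (.ite (.wtLt (rdW 33) (.read 20 (rd 41)))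
        (.setNat 51 (.const 0) (.const 0))
        (.setNat 51 (.const 0) (.const 1)))
      (.setNat 51 (.const 0) (.const 0)))

/-- Build the residual network with reduced costs. -/
def buildResidual : Prog :=
  forLoop 48 (rd 32)
    (.ite (.natEq (.read 35 (rd 48)) (.const 1))
      (.seq (.setNat 36 (rd 48) (.read 31 (rd 48)))
        (.seq (.setNat 37 (rd 48) (.read 30 (rd 48))) (.setWt 32 (rd 48) .zero)))
      (.seq (.setNat 36 (rd 48) (.read 30 (rd 48)))
        (.seq (.setNat 37 (rd 48) (.read 31 (rd 48)))
          (.setWt 32 (rd 48) (.sub (.add (.read 30 (rd 48)) (.read 31 (.read 30 (rd 48))))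
            (.read 31 (.read 31 (rd 48))))))))

/-- Compare the link length with the cost of a cheapest pair. -/
def storePair : Prog :=
  .ite (.natEq (.read 20 (rd 41)) (.const 1))
    (.seq (.setWt 33 (.const 0) (.add (.add (rdW 33) (rdW 33)) (.read 20 (rd 41))))
      (.ite (.natEq (rd 46) (.const 1))
        (.ite (.wtLt (rdW 33) (rdW 34)) (.setWt 34 (.const 0) (rdW 33)) .skip)
        (.seq (.setNat 46 (.const 0) (.const 1)) (.setWt 34 (.const 0) (rdW 33)))))
    .skip

/-- Compute the length of the pair of vertices in the variables `40`, `41`. -/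
def pairStep : Prog :=
  .seq (bellmanFord 30 31 33 30 32 40)
    (.seq storeDist
      (.seq (bellmanFord 30 31 34 30 32 40)
        (.ite (.natEq (.read 20 (rd 41)) (.const 1))
          (.seq savePot (.seq markAll (.seq (greedy 50 (rd 32) 35 51 testPath)
            (.seq buildResidual (.seq (bellmanFord 36 37 34 32 32 40) storePair)))))
          .skip)))

theorem savePot_exec (h : PairCtx B σ n M u v G c) (hlab : Labels σ n (G.dist c u))
    (hv : σ.nat 20 v = 1) :
    Exec B savePot σ fun τ => Rep 1 (τ.wt 33 0) (G.dist c u v) ∧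
      ∀ x < n, Rep 1 (τ.wt 31 x) (G.pot c u v x) := by
  refine Exec.seq (Exec.setWt ?_)
  simp only [NExpr.eval, WExpr.eval, eval_rd, h.v_eq]
  set ρ := σ.setWt 33 0 (σ.wt 20 v) with hρ
  have hlabρ : Labels ρ n (G.dist c u) := fun x hx => by simpa [hρ] using hlab x hx
  have hD : Rep 1 (ρ.wt 33 0) (G.dist c u v) := by
    have := hlab v h.v_lt
    rw [hv] at this
    simpa [hρ] using this
  refine (Exec.forLoop h.n_le (fun i τ => ∀ x < i, Rep 1 (τ.wt 31 x) (G.pot c u v x)) rfl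
    ?_ ?_ ?_ ?_).imp ?_
  · intro τ hf
    rw [eval_rd, hf.nat 0 rfl]
    exact h.n_eq
  · intro i τ x hx
    exact hx
  · intro x hx
    exact absurd hx (Nat.not_lt_zero x)
  · intro i hi τ hf hτ hJ
    have h20 : τ.nat 20 = ρ.nat 20 := hf.nat 20 rfl
    have hw20 : τ.wt 20 = ρ.wt 20 := hf.wt 20 rfl
    have hw33 : τ.wt 33 = ρ.wt 33 := hf.wt 33 rfl
    have hx := hlabρ i hi
    rw [← h20, ← hw20] at hx
    rw [← hw33] at hD
    have key : ∀ d, Rep 1 d (G.pot c u v i) →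
        ∀ x < i + 1, Rep 1 ((τ.setWt 31 i d).wt 31 x) (G.pot c u v x) := by
      intro d hd x hx
      by_cases hxi : x = i
      · simpa [hxi] using hd
      · simpa [hxi] using hJ x (by omega)
    refine Exec.ite (fun h1 => Exec.ite (fun h2 => Exec.setWt ?_) fun h2 => Exec.setWt ?_)
      fun h1 => Exec.setWt ?_
    all_goals simp only [Test.Holds, NExpr.eval, WExpr.eval, eval_rd, eval_rdW, hτ] at *
    · refine key _ ?_
      rw [hx.lt_iff hD h1 rfl] at h2
      rw [Arcs.pot, min_eq_left h2.le]
      rwa [h1] at hx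
    · refine key _ ?_
      rw [hx.lt_iff hD h1 rfl] at h2
      rw [Arcs.pot, min_eq_right (not_lt.1 h2)]
      exact hD
    · refine key _ ?_
      rw [Arcs.pot, hx.eq_top h1, min_eq_right le_top]
      exact hD
  · intro τ hf hτ
    refine ⟨?_, hτ⟩
    rw [hf.wt 33 rfl]
    exact hD

theorem markAll_exec (h : PairCtx B σ n M u v G c) :
    Exec B markAll σ fun τ => ∀ j < M, τ.nat 35 j = σ.nat 34 j := by
  refine Exec.forLoop h.M_le (fun i τ => ∀ j < i, τ.nat 35 j = σ.nat 34 j) rfl ?_ ?_ ?_ ?_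
  · intro τ hf
    rw [eval_rd, hf.nat 32 rfl, h.M_eq]
  · intro i τ x hJ j hj
    simpa using hJ j hj
  · intro x hx
    exact absurd hx (Nat.not_lt_zero x)
  · intro i hi τ hf hτ hJ
    refine Exec.setNat fun j hj => ?_
    by_cases hji : j = i
    · simp [NExpr.eval, hτ, hji, hf.nat 34 rfl]
    · simpa [NExpr.eval, hτ, hji] using hJ j (by omega)

/-- Array `35` serves as flag array of the restricted network; all else is shared. Containment in
array `34` ensures that marked arcs have finite cost. -/
theorem testPath_exec (h : PairCtx B σ n M u v G c) (hD : Rep 1 (σ.wt 33 0) (G.dist c u v))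
    (hsub : onSet σ 35 M ⊆ onSet σ 34 M) :
    Exec B testPath σ fun τ => τ.nat 51 0 = 1 ↔
      G.dist (Arcs.restrict c (onSet σ 35 M)) u v ≤ G.dist c u v := by
  have hL : Loaded σ n M 30 31 35 30 G (Arcs.restrict c (onSet σ 35 M)) := by
    refine ⟨h.loaded.tl_eq, h.loaded.hd_eq, h.loaded.tl_lt, h.loaded.hd_lt, fun j hj => ?_,
      fun j hj => if_neg fun hc => absurd (mem_onSet.1 hc).1 (not_lt.2 hj)⟩
    by_cases hjs : σ.nat 35 j = 1
    · have hm : j ∈ onSet σ 35 M := mem_onSet.2 ⟨hj, hjs⟩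
      rw [Arcs.restrict, if_pos hm, hjs, ← (mem_onSet.1 (hsub hm)).2]
      exact h.loaded.rep j hj
    · rw [Arcs.restrict, if_neg fun hc => hjs (mem_onSet.1 hc).2]
      exact Rep.of_ne hjs
  refine Exec.seq ((bellmanFord_exec h.n_le h.M_le h.n_eq h.M_eq h.u_eq h.u_lt hL
    (by norm_num) (by norm_num) (by norm_num) (by norm_num) (by norm_num) (by norm_num)).imp
    fun τ hf hτ => ?_)
  have hv := hτ v h.v_lt
  have h41 : τ.nat 41 0 = v := by rw [hf.nat 41 rfl, h.v_eq]
  rw [← hf.wt 33 rfl] at hD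
  refine Exec.ite (fun h1 => Exec.ite (fun h2 => Exec.setNat ?_) fun h2 => Exec.setNat ?_)
      fun h1 => Exec.setNat ?_
  all_goals simp only [Test.Holds, NExpr.eval, eval_rd, h41] at h1
  · simp only [Test.Holds, WExpr.eval, eval_rd, eval_rdW, h41] at h2
    rw [hD.lt_iff hv rfl h1] at h2
    simpa [NExpr.eval] using h2
  · simp only [Test.Holds, WExpr.eval, eval_rd, eval_rdW, h41] at h2
    rw [hD.lt_iff hv rfl h1] at h2
    simpa [NExpr.eval] using h2
  · rw [hv.eq_top h1]
    have := (hD.eq_one_iff).1 rfl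
    simpa [NExpr.eval, lt_top_iff_ne_top] using this

theorem shortestPath_exec (h : PairCtx B σ n M u v G c) (hD : Rep 1 (σ.wt 33 0) (G.dist c u v))
    (hmark : ∀ j < M, σ.nat 35 j = σ.nat 34 j) :
    Exec B (greedy 50 (rd 32) 35 51 testPath) σ fun τ =>
      onSet τ 35 M ⊆ onSet σ 34 M ∧ G.IsFlow (onSet τ 35 M) 1 u v ∧
        ∑ a ∈ onSet τ 35 M, c a = G.dist c u v := by
  have hDt : G.dist c u v ≠ ⊤ := (hD.eq_one_iff).1 rfl
  have hall : onSet σ 35 M = onSet σ 34 M := by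
    ext j
    simp only [mem_onSet]
    exact and_congr_right fun hj => by rw [hmark j hj]
  have hrest : Arcs.restrict c (onSet σ 34 M) = c := by
    funext j
    unfold Arcs.restrict
    split_ifs with hj
    · rfl
    · by_cases hjM : j < M
      · exact ((h.loaded.rep j hjM).eq_top fun hc => hj (mem_onSet.2 ⟨hjM, hc⟩)).symm
      · exact (h.loaded.top j (not_lt.1 hjM)).symm
  refine (greedy_exec (good := fun T => G.dist (Arcs.restrict c T) u v ≤ G.dist c u v)
    (fun S T hST hS => (Arcs.dist_restrict_anti hST u v).trans hS) h.M_le (by norm_num)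
    (by norm_num) rfl rfl ?_ ?_ ?_ ?_).imp ?_
  · intro τ hf
    rw [eval_rd, hf.nat 32 rfl, h.M_eq]
  · intro j hj
    rw [hmark j hj]; exact h.le_one j hj
  · rw [hall, hrest]
  · intro τ hf _ hsub
    refine testPath_exec (h.frame hf rfl rfl) ?_ ?_
    · rw [hf.wt 33 rfl]; exact hD
    · rw [hall] at hsub
      rwa [onSet_congr (hf.nat 34 rfl)]
  · rintro τ - ⟨-, h2, h3⟩
    rw [hall] at h2
    exact ⟨h2, Arcs.isFlow_of_minimal hDt h3⟩

/-- The flags `34` remain valid: arcs of `p` are present, and off `p` the reduced cost is infinite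
exactly for absent arcs. -/
theorem buildResidual_exec (h : PairCtx B σ n M u v G c) (hD : G.dist c u v ≠ ⊤)
    (hpot : ∀ x < n, Rep 1 (σ.wt 31 x) (G.pot c u v x)) (hsub : onSet σ 35 M ⊆ onSet σ 34 M) :
    Exec B buildResidual σ fun τ => Loaded τ n M 36 37 34 32 (G.flip (onSet σ 35 M))
      (G.redCost c u v (onSet σ 35 M)) := by
  have hpt : ∀ x, G.pot c u v x ≠ ⊤ := fun x => ne_top_of_le_ne_top hD (min_le_right _ _)
  refine (Exec.forLoop h.M_le (fun i τ => ∀ j < i, τ.nat 36 j = (G.flip (onSet σ 35 M)).tl j ∧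
    τ.nat 37 j = (G.flip (onSet σ 35 M)).hd j ∧
    Rep (σ.nat 34 j) (τ.wt 32 j) (G.redCost c u v (onSet σ 35 M) j)) rfl ?_ ?_ ?_ ?_).imp ?_
  · intro τ hf
    rw [eval_rd, hf.nat 32 rfl, h.M_eq]
  · intro i τ x hJ j hj
    simpa using hJ j hj
  · intro x hx
    exact absurd hx (Nat.not_lt_zero x)
  · intro i hi τ hf hτ hJ
    have h30 := h.loaded.tl_eq i hi
    have h31 := h.loaded.hd_eq i hi
    rw [← hf.nat 30 rfl] at h30
    rw [← hf.nat 31 rfl] at h31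
    have key : ∀ d, Rep (σ.nat 34 i) d (G.redCost c u v (onSet σ 35 M) i) → ∀ j < i + 1,
        (((τ.setNat 36 i ((G.flip (onSet σ 35 M)).tl i)).setNat 37 i
          ((G.flip (onSet σ 35 M)).hd i)).setWt 32 i d).nat 36 j = (G.flip (onSet σ 35 M)).tl j ∧
        (((τ.setNat 36 i ((G.flip (onSet σ 35 M)).tl i)).setNat 37 i
          ((G.flip (onSet σ 35 M)).hd i)).setWt 32 i d).nat 37 j = (G.flip (onSet σ 35 M)).hd j ∧
        Rep (σ.nat 34 j) ((((τ.setNat 36 i ((G.flip (onSet σ 35 M)).tl i)).setNat 37 i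
          ((G.flip (onSet σ 35 M)).hd i)).setWt 32 i d).wt 32 j)
          (G.redCost c u v (onSet σ 35 M) j) := by
      intro d hd j hj
      by_cases hji : j = i
      · subst hji
        simpa using hd
      · simpa [hji] using hJ j (by omega)
    refine Exec.ite (fun h1 => Exec.seq (Exec.setNat (Exec.seq (Exec.setNat (Exec.setWt ?_)))))
      fun h1 => Exec.seq (Exec.setNat (Exec.seq (Exec.setNat (Exec.setWt ?_))))
    all_goals simp only [Test.Holds, NExpr.eval, eval_rd, hτ, hf.nat 35 rfl] at h1
    · have hm : i ∈ onSet σ 35 M := mem_onSet.2 ⟨hi, h1⟩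
      have hal := (mem_onSet.1 (hsub hm)).2
      have := key 0 (by
        rw [Arcs.redCost, if_pos hm, hal]
        simpa using Rep.of_ofReal (le_refl (0 : ℝ)))
      simpa [NExpr.eval, WExpr.eval, hτ, h30, h31, Arcs.flip, hm] using this
    · have hm : i ∉ onSet σ 35 M := fun hc => h1 (mem_onSet.1 hc).2
      have hrep := h.loaded.rep i hi
      have ht := hpot _ (h.loaded.tl_lt i hi)
      have hh := hpot _ (h.loaded.hd_lt i hi)
      have := key (σ.wt 30 i + σ.wt 31 (G.tl i) - σ.wt 31 (G.hd i)) (by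
        rw [Arcs.redCost, if_neg hm]
        by_cases hal : σ.nat 34 i = 1
        · have hs := hrep.add ht hal rfl
          have hle := Arcs.pot_hd_le (G := G) (c := c) u v i
          -- Feasibility of the potential makes the difference nonnegative, so real and truncated
          -- subtraction agree.
          have hnn : σ.wt 31 (G.hd i) ≤ σ.wt 30 i + σ.wt 31 (G.tl i) := by
            by_contra hc
            exact absurd ((hs.lt_iff hh rfl rfl).1 (not_le.1 hc)) (not_lt.2 hle)
          rw [hs.eq_ofReal rfl, hh.eq_ofReal rfl, ← ENNReal.ofReal_sub _ (hh.nonneg rfl), hal]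
          exact Rep.of_ofReal (by linarith)
        · rw [hrep.eq_top hal, top_add, ENNReal.top_sub (hpt _)]
          exact Rep.of_ne hal)
      have hw30 : τ.wt 30 = σ.wt 30 := hf.wt 30 rfl
      have hw31 : τ.wt 31 = σ.wt 31 := hf.wt 31 rfl
      simpa [NExpr.eval, WExpr.eval, hτ, h30, h31, Arcs.flip, hm, hw30, hw31] using this
  · intro τ hf hτ
    refine ⟨fun j hj => (hτ j hj).1, fun j hj => (hτ j hj).2.1, fun j hj => ?_, fun j hj => ?_,
      fun j hj => ?_, fun j hj => ?_⟩
    · have h1 := h.loaded.tl_lt j hj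
      have h2 := h.loaded.hd_lt j hj
      simp only [Arcs.flip]; split_ifs <;> assumption
    · have h1 := h.loaded.tl_lt j hj
      have h2 := h.loaded.hd_lt j hj
      simp only [Arcs.flip]; split_ifs <;> assumption
    · rw [hf.nat 34 rfl]; exact (hτ j hj).2.2
    · have hm : j ∉ onSet σ 35 M := fun hc => absurd (mem_onSet.1 hc).1 (not_lt.2 hj)
      rw [Arcs.redCost, if_neg hm, h.loaded.top j hj, top_add, ENNReal.top_sub (hpt _)]

theorem storePair_exec {d d' l : ℝ≥0∞} (hv : σ.nat 41 0 = v) (hD : Rep 1 (σ.wt 33 0) d)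
    (hd' : Rep (σ.nat 20 v) (σ.wt 20 v) d') (hl : Rep (σ.nat 46 0) (σ.wt 34 0) l) :
    Exec B storePair σ fun τ => Rep (τ.nat 46 0) (τ.wt 34 0) (min l (d + d + d')) := by
  refine Exec.ite (fun h1 => Exec.seq (Exec.setWt ?_)) fun h1 => Exec.skip ?_
  all_goals simp only [Test.Holds, NExpr.eval, eval_rd, hv] at h1
  · have hs := (hD.add hD rfl rfl).add hd' rfl h1
    simp only [NExpr.eval, WExpr.eval, eval_rd, eval_rdW, hv]
    set s := σ.wt 33 0 + σ.wt 33 0 + σ.wt 20 v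
    refine Exec.ite (fun h2 => Exec.ite (fun h3 => Exec.setWt ?_) fun h3 => Exec.skip ?_)
      fun h2 => Exec.seq (Exec.setNat (Exec.setWt ?_))
    all_goals simp [Test.Holds, NExpr.eval] at h2
    · simp [Test.Holds] at h3
      rw [hs.lt_iff hl rfl h2] at h3
      rw [min_eq_right h3.le]
      simpa [NExpr.eval, WExpr.eval, h2] using hs
    · rw [Test.Holds] at h3
      simp only [eval_rdW, State.setWt_wt] at h3
      norm_num at h3
      rw [← not_lt, hs.lt_iff hl rfl h2] at h3
      rw [min_eq_left (not_lt.1 h3)]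
      simpa using hl
    · rw [hl.eq_top h2, min_eq_right le_top]
      simpa [NExpr.eval, WExpr.eval] using hs
  · rw [hd'.eq_top h1, add_top, min_eq_left le_top]
    exact hl

/-- The secure distance is stored first and then lowered by the value from `Arcs.pairVal_eq`. If `v`
is unreachable there is no flow of value two either, so the second phase is skipped. -/
theorem pairStep_exec (h : PairCtx B σ n M u v G c) (hs : Loaded σ n M 30 31 33 30 G cs) :
    Exec B pairStep σ fun τ =>
      Rep (τ.nat 46 0) (τ.wt 34 0) (min (G.dist cs u v) (G.pairVal c u v)) := by
  refine Exec.seq ((bellmanFord_exec h.n_le h.M_le h.n_eq h.M_eq h.u_eq h.u_lt hs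
    (by norm_num) (by norm_num) (by norm_num) (by norm_num) (by norm_num) (by norm_num)).imp
    fun τ₁ hf₁ hτ₁ => ?_)
  have h₁ := h.frame hf₁ rfl rfl
  refine Exec.seq (Exec.imp (R := fun τ => Rep (τ.nat 46 0) (τ.wt 34 0) (G.dist cs u v))
    (Exec.seq (Exec.setNat (Exec.setWt ?_))) fun τ₂ hf₂ hτ₂ => ?_)
  · have := hτ₁ v h.v_lt
    simpa [NExpr.eval, WExpr.eval, h₁.v_eq] using this
  have h₂ := h₁.frame (P := storeDist) hf₂ rfl rfl
  refine Exec.seq ((bellmanFord_exec h₂.n_le h₂.M_le h₂.n_eq h₂.M_eq h₂.u_eq h₂.u_lt h₂.loaded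
    (by norm_num) (by norm_num) (by norm_num) (by norm_num) (by norm_num) (by norm_num)).imp
    fun τ₃ hf₃ hτ₃ => ?_)
  have h₃ := h₂.frame hf₃ rfl rfl
  have hl₃ : Rep (τ₃.nat 46 0) (τ₃.wt 34 0) (G.dist cs u v) := by
    rw [hf₃.nat 46 rfl, hf₃.wt 34 rfl]; exact hτ₂
  have hv₃ := hτ₃ v h.v_lt
  refine Exec.ite (fun hb => ?_) fun hb => Exec.skip ?_
  all_goals simp only [Test.Holds, NExpr.eval, eval_rd, h₃.v_eq] at hb
  · have hD : G.dist c u v ≠ ⊤ := hv₃.eq_one_iff.1 hb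
    refine Exec.seq ((savePot_exec h₃ hτ₃ hb).imp fun τ₄ hf₄ hτ₄ => ?_)
    have h₄ := h₃.frame hf₄ rfl rfl
    refine Exec.seq ((markAll_exec h₄).imp fun τ₅ hf₅ hτ₅ => ?_)
    have h₅ := h₄.frame hf₅ rfl rfl
    have hD₅ : Rep 1 (τ₅.wt 33 0) (G.dist c u v) := by rw [hf₅.wt 33 rfl]; exact hτ₄.1
    refine Exec.seq ((shortestPath_exec h₅ hD₅ fun j hj => by
      rw [hτ₅ j hj, hf₅.nat 34 rfl]).imp fun τ₆ hf₆ hτ₆ => ?_)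
    have h₆ := h₅.frame hf₆ rfl rfl
    refine Exec.seq ((buildResidual_exec h₆ hD (fun x hx => by
      rw [hf₆.wt 31 rfl, hf₅.wt 31 rfl]; exact hτ₄.2 x hx) (by
      rw [onSet_congr (hf₆.nat 34 rfl)]; exact hτ₆.1)).imp fun τ₇ hf₇ hτ₇ => ?_)
    have h₇ := h₆.frame hf₇ rfl rfl
    refine Exec.seq ((bellmanFord_exec h₇.n_le h₇.M_le h₇.n_eq h₇.M_eq h₇.u_eq h₇.u_lt hτ₇
      (by norm_num) (by norm_num) (by norm_num) (by norm_num) (by norm_num) (by norm_num)).imp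
      fun τ₈ hf₈ hτ₈ => ?_)
    have h₈ := h₇.frame hf₈ rfl rfl
    rw [Arcs.pairVal_eq h.finite hD hτ₆.2.1 hτ₆.2.2]
    refine storePair_exec h₈.v_eq ?_ (hτ₈ v h.v_lt) ?_
    · rw [hf₈.wt 33 rfl, hf₇.wt 33 rfl, hf₆.wt 33 rfl]; exact hD₅
    · rw [hf₈.nat 46 rfl, hf₇.nat 46 rfl, hf₆.nat 46 rfl, hf₅.nat 46 rfl, hf₄.nat 46 rfl,
        hf₈.wt 34 rfl, hf₇.wt 34 rfl, hf₆.wt 34 rfl, hf₅.wt 34 rfl, hf₄.wt 34 rfl]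
      exact hl₃
  · rw [Arcs.pairVal_eq_top_of_dist (hv₃.eq_top hb), min_eq_left le_top]
    exact hl₃

/-! ### The optimal value within a set of edges -/

/-- The number of edges. -/
def numEdges : NExpr := .read 0 (.const 1)

/-- Set up the arcs of the network, and mark all edges in the array `5`. -/
def setup : Prog :=
  .seq (.setNat 32 (.const 0) (.add numEdges numEdges))
    (.seq (.setNat 55 (.const 0) (.read 0 (.const 2)))
      (forLoop 47 numEdges
        (.seq (.setNat 30 (rd 47) (.read 1 (rd 47)))
          (.seq (.setNat 31 (rd 47) (.read 2 (rd 47)))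
            (.seq (.setNat 30 (.add numEdges (rd 47)) (.read 2 (rd 47)))
              (.seq (.setNat 31 (.add numEdges (rd 47)) (.read 1 (rd 47)))
                (.seq (.setWt 30 (rd 47) (.read 0 (rd 47)))
                  (.seq (.setWt 30 (.add numEdges (rd 47)) (.read 0 (rd 47)))
                    (.setNat 5 (rd 47) (.const 1))))))))))

/-- Compute which arcs are present, and which of them are secure, if the edges are those that are
marked in the array `5`. -/
def fillAlive : Prog :=
  forLoop 47 numEdges
    (.seq (.setNat 34 (rd 47) (.read 5 (rd 47)))
      (.seq (.setNat 34 (.add numEdges (rd 47)) (.sub (.read 5 (rd 47)) (.read 0 (.const 4))))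
        (.seq (.setNat 33 (rd 47) (.sub (.read 5 (rd 47)) (.read 3 (rd 47))))
          (.setNat 33 (.add numEdges (rd 47))
            (.sub (.sub (.read 5 (rd 47)) (.read 0 (.const 4))) (.read 3 (rd 47)))))))

/-- Append an arc to the complete graph. -/
def appendLink : Prog :=
  .seq (.setNat 42 (rd 45) (rd 40))
    (.seq (.setNat 43 (rd 45) (rd 41))
      (.seq (.setNat 44 (rd 45) (rd 46))
        (.seq (.setWt 35 (rd 45) (rdW 34)) (.setNat 45 (.const 0) (.add (rd 45) (.const 1))))))

/-- Compute the complete graph with the lengths of all pairs of vertices. -/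
def allLinks : Prog := forLoop 40 (rd 0) (forLoop 41 (rd 0) (.seq pairStep appendLink))

/-- Compute the optimal value within the marked edges. -/
def valProg : Prog :=
  .seq fillAlive (.seq (.setNat 45 (.const 0) (.const 0))
    (.seq allLinks (bellmanFord 42 43 44 35 45 55)))

/-- The flag of the computed value. -/
def valFlag : NExpr := .read 20 (.read 0 (.const 3))

/-- The computed value. -/
def valNum : WExpr := .read 20 (.read 0 (.const 3))

/-- Test whether the marked edges attain the optimal value. -/
def testVal : Prog :=
  .seq valProg
    (.ite (.natEq valFlag (.const 1))
      (.ite (.wtLt (rdW 36) valNum)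
        (.setNat 54 (.const 0) (.const 0))
        (.setNat 54 (.const 0) (.const 1)))
      (.setNat 54 (.const 0) (.const 0)))

/-- The algorithm: compute the optimal value, and delete edges greedily while this does not change
the optimal value. -/
def solver : Prog :=
  .seq setup (.seq valProg
    (.ite (.natEq valFlag (.const 1))
      (.seq (.setWt 36 (.const 0) valNum)
        (.seq (greedy 53 numEdges 5 54 testVal) (.setNat 4 (.const 0) (.const 1))))
      .skip))

namespace Instance

variable {I : Instance} {B : ℕ} {σ τ : State}

/-- The memory after the setup. -/
structure Ready (I : Instance) (B : ℕ) (σ : State) : Prop where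
  n_le : I.n ≤ B
  m_le : I.m + I.m ≤ B
  nn_le : I.n * I.n ≤ B
  input : ∀ a < 4, σ.nat a = I.input.nat a
  arcs_eq : σ.nat 32 0 = I.m + I.m
  s_eq : σ.nat 55 0 = I.s
  tl_eq : ∀ j < I.m + I.m, σ.nat 30 j = I.net.tl j
  hd_eq : ∀ j < I.m + I.m, σ.nat 31 j = I.net.hd j
  cost_eq : ∀ j < I.m + I.m, σ.wt 30 j = I.input.wt 0 (I.arcEdge j)

theorem Ready.frame {P : Prog} (h : Ready I B σ) (hf : Frame P σ τ)
    (hn : ([0, 1, 2, 3, 30, 31, 32, 55].all fun a => !P.writesNat a) = true)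
    (hw : P.writesWt 30 = false) : Ready I B τ := by
  have hn' : ∀ a ∈ [0, 1, 2, 3, 30, 31, 32, 55], τ.nat a = σ.nat a := fun a ha =>
    hf.nat a (by simpa using List.all_eq_true.1 hn a ha)
  refine ⟨h.n_le, h.m_le, h.nn_le, fun a ha => ?_, ?_, ?_, ?_, ?_, ?_⟩
  · rw [hn' a (by simp; omega)]; exact h.input a ha
  · rw [hn' 32 (by simp)]; exact h.arcs_eq
  · rw [hn' 55 (by simp)]; exact h.s_eq
  · rw [hn' 30 (by simp)]; exact h.tl_eq
  · rw [hn' 31 (by simp)]; exact h.hd_eq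
  · rw [hf.wt 30 hw]; exact h.cost_eq

theorem input_n : I.input.nat 0 0 = I.n := rfl

theorem input_m : I.input.nat 0 1 = I.m := rfl

theorem input_s : I.input.nat 0 2 = I.s := rfl

theorem input_t : I.input.nat 0 3 = I.t := rfl

theorem input_directed : I.input.nat 0 4 = I.directed.toNat := rfl

theorem input_faulty (e : Fin I.m) : I.input.nat 3 e = if e ∈ I.faulty then 1 else 0 := by
  simp [input]

theorem Ready.n_eq (h : Ready I B σ) : σ.nat 0 0 = I.n := by
  rw [h.input 0 (by norm_num), input_n]

theorem Ready.numEdges_eval (h : Ready I B σ) : numEdges.eval σ = I.m := by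
  simp only [numEdges, NExpr.eval]
  rw [h.input 0 (by norm_num), input_m]

theorem setup_exec (hn : I.n ≤ B) (hm : I.m + I.m ≤ B) (hnn : I.n * I.n ≤ B) :
    Exec B setup I.input fun τ => Ready I B τ ∧ ∀ e < I.m, τ.nat 5 e = 1 := by
  refine Exec.seq (Exec.setNat (Exec.seq (Exec.setNat ?_)))
  have e1 : (NExpr.add numEdges numEdges).eval I.input = I.m + I.m := rfl
  rw [e1]
  simp only [NExpr.eval]
  set ρ := (I.input.setNat 32 0 (I.m + I.m)).setNat 55 0
    ((I.input.setNat 32 0 (I.m + I.m)).nat 0 2) with hρ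
  have hρa : ∀ a, a ≠ 32 → a ≠ 55 → ρ.nat a = I.input.nat a := by
    intro a h1 h2
    rw [hρ, State.setNat_nat_of_ne _ h2, State.setNat_nat_of_ne _ h1]
  have hρw : ρ.wt = I.input.wt := rfl
  refine (Exec.forLoop (M := I.m) (by omega) (fun i τ => ∀ e < i,
    τ.nat 30 e = I.input.nat 1 e ∧ τ.nat 31 e = I.input.nat 2 e ∧
    τ.nat 30 (I.m + e) = I.input.nat 2 e ∧ τ.nat 31 (I.m + e) = I.input.nat 1 e ∧
    τ.wt 30 e = I.input.wt 0 e ∧ τ.wt 30 (I.m + e) = I.input.wt 0 e ∧ τ.nat 5 e = 1)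
    rfl ?_ ?_ ?_ ?_).imp ?_
  · intro τ hf
    simp only [numEdges, NExpr.eval]
    rw [hf.nat 0 rfl, hρa 0 (by norm_num) (by norm_num), input_m]
  · intro i τ x hJ e he
    simpa using hJ e he
  · intro x hx
    exact absurd hx (Nat.not_lt_zero x)
  · intro i hi τ hf hτ hJ
    have h0 : τ.nat 0 = I.input.nat 0 := (hf.nat 0 rfl).trans (hρa 0 (by norm_num) (by norm_num))
    have h1 : τ.nat 1 = I.input.nat 1 := (hf.nat 1 rfl).trans (hρa 1 (by norm_num) (by norm_num))
    have h2 : τ.nat 2 = I.input.nat 2 := (hf.nat 2 rfl).trans (hρa 2 (by norm_num) (by norm_num))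
    have hw : τ.wt 0 = I.input.wt 0 := hf.wt 0 rfl
    refine Exec.seq (Exec.setNat (Exec.seq (Exec.setNat (Exec.seq (Exec.setNat (Exec.seq
      (Exec.setNat (Exec.seq (Exec.setWt (Exec.seq (Exec.setWt (Exec.setNat ?_))))))))))))
    intro e he
    by_cases hei : e = i
    · subst hei
      -- Needed to tell the cells `e` and `I.m + e` apart.
      have : ¬ I.m = 0 := by omega
      simp [NExpr.eval, WExpr.eval, numEdges, hτ, h0, h1, h2, hw, input_m, this]
    · have := hJ e (by omega)
      have e1 : ¬ e = I.m + i := by omega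
      have e2 : ¬ I.m + e = i := by omega
      simpa [NExpr.eval, WExpr.eval, numEdges, hτ, h0, h1, h2, hw, input_m, hei, e1, e2] using this
  · intro τ hf hτ
    have hτa : ∀ a < 4, τ.nat a = I.input.nat a := by
      intro a ha
      refine (hf.nat a ?_).trans (hρa a (by omega) (by omega))
      simp [forLoop, Prog.writesNat]; omega
    refine ⟨⟨hn, hm, hnn, hτa, ?_, ?_, fun j hj => ?_, fun j hj => ?_, fun j hj => ?_⟩,
      fun e he => (hτ e he).2.2.2.2.2.2⟩
    · rw [hf.nat 32 rfl]; simp [hρ]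
    · rw [hf.nat 55 rfl]; simp [hρ, input_s]
    all_goals
      by_cases hjm : j < I.m
      · have := hτ j hjm
        simp [net, arcEdge, hjm, this]
      · have := hτ (j - I.m) (by omega)
        rw [Nat.add_sub_cancel' (not_lt.1 hjm)] at this
        simp [net, arcEdge, hjm, this]

variable (I) in
/-- The marked edges. -/
def marked (σ : State) : Finset (Fin I.m) := Finset.univ.filter fun e => σ.nat 5 e.val = 1

theorem net_tl_lt {j : ℕ} (hj : j < I.m + I.m) : I.net.tl j < I.n := by
  simp only [net]
  split_ifs with h
  · rw [show j = (⟨j, h⟩ : Fin I.m).val from rfl, input_src]; exact Fin.is_lt _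
  · rw [show j - I.m = (⟨j - I.m, by omega⟩ : Fin I.m).val from rfl, input_dst]; exact Fin.is_lt _

theorem net_hd_lt {j : ℕ} (hj : j < I.m + I.m) : I.net.hd j < I.n := by
  simp only [net]
  split_ifs with h
  · rw [show j = (⟨j, h⟩ : Fin I.m).val from rfl, input_dst]; exact Fin.is_lt _
  · rw [show j - I.m = (⟨j - I.m, by omega⟩ : Fin I.m).val from rfl, input_src]; exact Fin.is_lt _

theorem Ready.loaded (h : Ready I B σ) {al : ℕ} {A : Finset (Fin I.m)}
    (hal : ∀ j < I.m + I.m, σ.nat al j = 1 ↔ I.ArcIn A j) :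
    Loaded σ I.n (I.m + I.m) 30 31 al 30 I.net (I.netCost A) := by
  refine ⟨h.tl_eq, h.hd_eq, fun j hj => net_tl_lt hj, fun j hj => net_hd_lt hj, fun j hj => ?_,
    fun j hj => ?_⟩
  · by_cases hj1 : I.ArcIn A j
    · obtain ⟨e, -, he⟩ := hj1.1
      rw [netCost, if_pos hj1, (hal j hj).2 hj1, h.cost_eq j hj]
      refine Rep.of_ofReal ?_
      rw [← he, input_weight]
      exact NNReal.coe_nonneg _
    · rw [netCost, if_neg hj1]
      exact Rep.of_ne fun hc => hj1 ((hal j hj).1 hc)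
  · refine if_neg fun hc => ?_
    obtain ⟨e, -, he⟩ := hc.1
    have := e.2
    rw [he, arcEdge] at this
    split_ifs at this <;> omega

/-- On flags in `{0, 1}`, truncated subtraction is conjunction with a negation: it yields `1` only
if the edge is marked and the subtracted flags vanish. -/
theorem fillAlive_exec (h : Ready I B σ) (h5 : ∀ e < I.m, σ.nat 5 e ≤ 1) :
    Exec B fillAlive σ fun τ =>
      (∀ j < I.m + I.m, τ.nat 34 j ≤ 1) ∧
      (∀ j < I.m + I.m, τ.nat 34 j = 1 ↔ I.ArcIn (I.marked σ) j) ∧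
      (∀ j < I.m + I.m, τ.nat 33 j = 1 ↔ I.ArcIn (I.marked σ \ I.faulty) j) := by
  refine (Exec.forLoop (M := I.m) (by have := h.m_le; omega) (fun i τ => ∀ e < i,
    τ.nat 34 e = σ.nat 5 e ∧ τ.nat 34 (I.m + e) = σ.nat 5 e - I.directed.toNat ∧
    τ.nat 33 e = σ.nat 5 e - I.input.nat 3 e ∧
    τ.nat 33 (I.m + e) = σ.nat 5 e - I.directed.toNat - I.input.nat 3 e) rfl ?_ ?_ ?_ ?_).imp ?_
  · intro τ hf
    exact (h.frame hf rfl rfl).numEdges_eval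
  · intro i τ x hJ e he
    simpa using hJ e he
  · intro x hx
    exact absurd hx (Nat.not_lt_zero x)
  · intro i hi τ hf hτ hJ
    have h' := h.frame hf rfl rfl
    have h0 := h'.input 0 (by norm_num)
    have h3 := h'.input 3 (by norm_num)
    have h5' : τ.nat 5 = σ.nat 5 := hf.nat 5 rfl
    refine Exec.seq (Exec.setNat (Exec.seq (Exec.setNat (Exec.seq (Exec.setNat (Exec.setNat ?_))))))
    intro e he
    by_cases hei : e = i
    · subst hei
      have : ¬ I.m = 0 := by omega
      simp [NExpr.eval, numEdges, hτ, h0, h3, h5', input_m, input_directed, this]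
    · have := hJ e (by omega)
      have e1 : ¬ e = I.m + i := by omega
      have e2 : ¬ I.m + e = i := by omega
      simpa [NExpr.eval, numEdges, hτ, h0, h3, h5', input_m, input_directed, hei, e1, e2] using this
  · intro τ hf hτ
    have key : ∀ j < I.m + I.m, ∃ e : Fin I.m, I.arcEdge j = e ∧
        τ.nat 34 j = σ.nat 5 e - (if j < I.m then 0 else I.directed.toNat) ∧
        τ.nat 33 j = σ.nat 5 e - (if j < I.m then 0 else I.directed.toNat) -
          (if e ∈ I.faulty then 1 else 0) := by
      intro j hj
      by_cases hjm : j < I.m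
      · refine ⟨⟨j, hjm⟩, by simp [arcEdge, hjm], ?_⟩
        obtain ⟨h1, h2, h3, h4⟩ := hτ j hjm
        rw [show I.input.nat 3 j = _ from input_faulty ⟨j, hjm⟩] at h3
        simp [hjm, h1, h3]
      · refine ⟨⟨j - I.m, by omega⟩, by simp [arcEdge, hjm], ?_⟩
        obtain ⟨h1, h2, h3, h4⟩ := hτ (j - I.m) (by omega)
        rw [Nat.add_sub_cancel' (not_lt.1 hjm)] at h2 h4
        rw [show I.input.nat 3 (j - I.m) = _ from input_faulty ⟨j - I.m, by omega⟩] at h4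
        simp [hjm, h2, h4]
    have harc : ∀ (A : Finset (Fin I.m)) (j : ℕ) (e : Fin I.m), I.arcEdge j = e →
        (I.ArcIn A j ↔ e ∈ A ∧ (j < I.m ∨ I.directed = false)) := by
      intro A j e he
      rw [ArcIn, he]
      refine and_congr_left fun _ => ⟨?_, fun h => ⟨e, h, rfl⟩⟩
      rintro ⟨f, hf, hfe⟩
      rwa [← Fin.ext hfe]
    refine ⟨fun j hj => ?_, fun j hj => ?_, fun j hj => ?_⟩
    all_goals
      obtain ⟨e, he, h1, h2⟩ := key j hj
      have h5e := h5 e e.2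
    · omega
    · rw [harc _ j e he, h1, marked, Finset.mem_filter]
      by_cases hjm : j < I.m <;> cases hd : I.directed <;> simp [hjm]; omega
    · rw [harc _ j e he, h2, marked, Finset.mem_sdiff, Finset.mem_filter]
      by_cases hjm : j < I.m <;> cases hd : I.directed <;> by_cases hef : e ∈ I.faulty <;>
        simp [hjm, hef] <;> omega

/-- The first `k` arcs of the complete graph are in memory. -/
def Links (A : Finset (Fin I.m)) (k : ℕ) (σ : State) : Prop :=
  σ.nat 45 0 = k ∧ ∀ i < k, σ.nat 42 i = i / I.n ∧ σ.nat 43 i = i % I.n ∧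
    Rep (σ.nat 44 i) (σ.wt 35 i) (I.linkVal A (i / I.n) (i % I.n))

theorem appendLink_exec {A : Finset (Fin I.m)} {u v : ℕ} (hJ : Links A (u * I.n + v) σ)
    (hu : σ.nat 40 0 = u) (hv : σ.nat 41 0 = v) (hvn : v < I.n)
    (hl : Rep (σ.nat 46 0) (σ.wt 34 0) (I.linkVal A u v)) :
    Exec B appendLink σ (Links A (u * I.n + v + 1)) := by
  obtain ⟨h1, h2⟩ := hJ
  have e1 : (u * I.n + v) / I.n = u := by
    rw [mul_comm, Nat.mul_add_div (by omega), Nat.div_eq_of_lt hvn, add_zero]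
  have e2 : (u * I.n + v) % I.n = v := by
    rw [mul_comm, Nat.mul_add_mod, Nat.mod_eq_of_lt hvn]
  refine Exec.seq (Exec.setNat (Exec.seq (Exec.setNat (Exec.seq (Exec.setNat (Exec.seq
    (Exec.setWt (Exec.setNat ⟨?_, ?_⟩))))))))
  · simp [NExpr.eval, h1]
  · intro i hi
    by_cases hiu : i = u * I.n + v
    · rw [hiu, e1, e2]
      simpa [NExpr.eval, WExpr.eval, h1, hu, hv] using hl
    · have := h2 i (by omega)
      simpa [NExpr.eval, WExpr.eval, h1, hiu] using this

theorem allLinks_exec (h : Ready I B σ) {A : Finset (Fin I.m)} (h45 : σ.nat 45 0 = 0)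
    (h1 : ∀ j < I.m + I.m, σ.nat 34 j ≤ 1)
    (h2 : ∀ j < I.m + I.m, σ.nat 34 j = 1 ↔ I.ArcIn A j)
    (h3 : ∀ j < I.m + I.m, σ.nat 33 j = 1 ↔ I.ArcIn (A \ I.faulty) j) :
    Exec B allLinks σ (Links A (I.n * I.n)) := by
  refine Exec.forLoop h.n_le (fun i => Links A (i * I.n)) rfl ?_ ?_ ?_ ?_
  · intro τ hf
    exact (h.frame hf rfl rfl).n_eq
  · intro i τ x hJ
    simpa [Links] using hJ
  · rw [zero_mul]
    exact ⟨h45, fun i hi => absurd hi (Nat.not_lt_zero i)⟩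
  · intro u hu τ hf hτ hJ
    have h' := h.frame hf rfl rfl
    -- A full inner pass takes the number of stored links from `u * n` to `u * n + n`.
    rw [Nat.add_mul, one_mul]
    refine Exec.forLoop h.n_le (fun i => Links A (u * I.n + i)) rfl ?_ ?_ hJ ?_
    · intro ρ hg
      exact (h'.frame hg rfl rfl).n_eq
    · intro i ρ x hJ
      simpa [Links] using hJ
    · intro v hv ρ hg hρ hJρ
      have h'' := h'.frame hg rfl rfl
      have e34 : ρ.nat 34 = σ.nat 34 := (hg.nat 34 rfl).trans (hf.nat 34 rfl)
      have e33 : ρ.nat 33 = σ.nat 33 := (hg.nat 33 rfl).trans (hf.nat 33 rfl)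
      have hu' : ρ.nat 40 0 = u := by rw [hg.nat 40 rfl, hτ]
      have hctx : PairCtx B ρ I.n (I.m + I.m) u v I.net (I.netCost A) :=
        ⟨h.n_le, h.m_le, h''.n_eq, h''.arcs_eq, hu', hρ, hu, hv,
          h''.loaded (by rw [e34]; exact h2), by rw [e34]; exact h1⟩
      refine Exec.seq ((pairStep_exec hctx (h''.loaded (by rw [e33]; exact h3))).imp
        fun π hp hπ => ?_)
      refine appendLink_exec ?_ ?_ ?_ hv hπ
      · unfold Links
        rw [hp.nat 45 rfl, hp.nat 42 rfl, hp.nat 43 rfl, hp.nat 44 rfl, hp.wt 35 rfl]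
        exact hJρ
      · rw [hp.nat 40 rfl, hu']
      · rw [hp.nat 41 rfl, hρ]

theorem valProg_exec (h : Ready I B σ) (h5 : ∀ e < I.m, σ.nat 5 e ≤ 1) :
    Exec B valProg σ fun τ =>
      Rep (valFlag.eval τ) (valNum.eval τ) (I.optVal (I.marked σ)) := by
  refine Exec.seq ((fillAlive_exec h h5).imp fun τ₁ hf₁ hτ₁ => ?_)
  have h₁ := h.frame hf₁ rfl rfl
  refine Exec.seq (Exec.imp (R := fun τ => τ.nat 45 0 = 0) (Exec.setNat (by simp [NExpr.eval]))
    fun τ₂ hf₂ hτ₂ => ?_)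
  have h₂ := h₁.frame hf₂ rfl rfl
  refine Exec.seq ((allLinks_exec h₂ (A := I.marked σ) hτ₂ (by rw [hf₂.nat 34 rfl]; exact hτ₁.1)
    (by rw [hf₂.nat 34 rfl]; exact hτ₁.2.1) (by rw [hf₂.nat 33 rfl]; exact hτ₁.2.2)).imp
    fun τ₃ hf₃ hτ₃ => ?_)
  have h₃ := h₂.frame hf₃ rfl rfl
  have hL : Loaded τ₃ I.n (I.n * I.n) 42 43 44 35 (completeNet I.n) (I.linkCost (I.marked σ)) := by
    refine ⟨fun k hk => (hτ₃.2 k hk).1, fun k hk => (hτ₃.2 k hk).2.1,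
      fun k hk => Nat.div_lt_of_lt_mul hk, fun k _ => Nat.mod_lt _ I.s.pos, fun k hk => ?_,
      fun k hk => if_neg (not_lt.2 hk)⟩
    rw [linkCost, if_pos hk]
    exact (hτ₃.2 k hk).2.2
  refine (bellmanFord_exec h₃.n_le h₃.nn_le h₃.n_eq hτ₃.1 h₃.s_eq I.s.2 hL
    (by norm_num) (by norm_num) (by norm_num) (by norm_num) (by norm_num) (by norm_num)).imp
    fun τ₄ hf₄ hτ₄ => ?_
  have h₄ := h₃.frame hf₄ rfl rfl
  have := hτ₄ I.t I.t.2
  simp only [valFlag, valNum, NExpr.eval, WExpr.eval]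
  rw [h₄.input 0 (by norm_num), input_t]
  exact this

theorem testVal_exec (h : Ready I B σ) (h5 : ∀ e < I.m, σ.nat 5 e ≤ 1)
    {d : ℝ≥0∞} (hd : Rep 1 (σ.wt 36 0) d) :
    Exec B testVal σ fun τ => τ.nat 54 0 = 1 ↔ I.optVal (I.marked σ) ≤ d := by
  refine Exec.seq ((valProg_exec h h5).imp fun τ hf hτ => ?_)
  rw [← hf.wt 36 rfl] at hd
  refine Exec.ite (fun h1 => Exec.ite (fun h2 => Exec.setNat ?_) fun h2 => Exec.setNat ?_)
    fun h1 => Exec.setNat ?_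
  · have := (hd.lt_iff hτ rfl h1).1 h2
    simpa [NExpr.eval] using this
  · have := mt (hd.lt_iff hτ rfl h1).2 h2
    simpa [NExpr.eval] using this
  · rw [hτ.eq_top h1]
    have := hd.eq_one_iff.1 rfl
    simpa [NExpr.eval, lt_top_iff_ne_top] using this

/-! ### Greedy deletion of edges and correctness of the algorithm -/

variable (I) in
/-- The edges with indices in `T`. -/
def edgesOf (T : Finset ℕ) : Finset (Fin I.m) := Finset.univ.filter fun e => e.val ∈ T

theorem edgesOf_mono {S T : Finset ℕ} (h : S ⊆ T) : I.edgesOf S ⊆ I.edgesOf T := by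
  intro e he
  simp only [edgesOf, Finset.mem_filter, Finset.mem_univ, true_and] at he ⊢
  exact h he

theorem edgesOf_onSet (σ : State) : I.edgesOf (onSet σ 5 I.m) = I.marked σ := by
  ext e
  simp [edgesOf, marked, mem_onSet]

/-- The greedy procedure works on indices. A competing edge set below `edgesOf T` comes from its own
set of indices, which lies in `T`. -/
theorem minimal_edgesOf {good : Finset (Fin I.m) → Prop} {T : Finset ℕ}
    (h : Minimal (fun T => good (I.edgesOf T)) T) : Minimal good (I.edgesOf T) := by
  refine ⟨h.1, fun A hA hAT => ?_⟩
  have e : I.edgesOf (A.map Fin.valEmbedding) = A := by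
    ext x
    simp [edgesOf, Fin.val_inj]
  have hsub : A.map Fin.valEmbedding ≤ T := by
    intro x hx
    obtain ⟨y, hy, rfl⟩ := Finset.mem_map.1 hx
    exact (Finset.mem_filter.1 (hAT hy)).2
  have := h.2 (y := A.map Fin.valEmbedding) (by simpa only [e] using hA) hsub
  rw [← e]
  exact edgesOf_mono this

theorem solver_exec (hn : I.n ≤ B) (hm : I.m + I.m ≤ B) (hnn : I.n * I.n ≤ B) :
    Exec B solver I.input fun τ =>
      (∀ S, I.output τ = some S → I.IsOptimal 1 S) ∧
        (I.output τ = none → ¬ ∃ S, I.IsFeasible 1 S) := by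
  refine Exec.seq ((setup_exec hn hm hnn).imp fun τ₁ hf₁ hτ₁ => ?_)
  obtain ⟨h₁, h5₁⟩ := hτ₁
  have hall : I.marked τ₁ = Finset.univ := by
    ext e; simp [marked, h5₁ e e.2]
  refine Exec.seq ((valProg_exec h₁ fun e he => (h5₁ e he).le).imp fun τ₂ hf₂ hτ₂ => ?_)
  rw [hall] at hτ₂
  have h₂ := h₁.frame hf₂ rfl rfl
  have h5₂ : τ₂.nat 5 = τ₁.nat 5 := hf₂.nat 5 rfl
  refine Exec.ite (fun hb => ?_) fun hb => Exec.skip ?_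
  · replace hb : valFlag.eval τ₂ = 1 := hb
    have hopt := hτ₂.eq_one_iff.1 hb
    rw [hb] at hτ₂
    refine Exec.seq (Exec.imp (R := fun τ => Rep 1 (τ.wt 36 0) (I.optVal Finset.univ))
      (Exec.setWt (by simpa [NExpr.eval] using hτ₂)) fun τ₃ hf₃ hτ₃ => ?_)
    have h₃ := h₂.frame hf₃ rfl rfl
    have h5₃ : ∀ e < I.m, τ₃.nat 5 e = 1 := by
      rw [hf₃.nat 5 rfl, h5₂]; exact h5₁
    have hall₃ : I.marked τ₃ = Finset.univ := by
      ext e; simp [marked, h5₃ e e.2]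
    refine Exec.seq ((greedy_exec
      (good := fun T => I.optVal (I.edgesOf T) ≤ I.optVal Finset.univ)
      (fun S T hST hS => (optVal_anti (edgesOf_mono hST)).trans hS) (M := I.m) (by omega)
      (by norm_num) (by norm_num) rfl rfl
      (fun τ hf => (h₃.frame hf rfl rfl).numEdges_eval) (fun e he => (h5₃ e he).le)
      (by rw [edgesOf_onSet, hall₃]) (fun τ hf hle _ => ?_)).imp fun τ₄ _ hτ₄ => ?_)
    · rw [edgesOf_onSet]
      refine testVal_exec (h₃.frame hf rfl rfl) hle ?_
      rw [hf.wt 36 rfl]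
      exact hτ₃
    · refine Exec.setNat ?_
      have hmin := minimal_edgesOf (good := fun A => I.optVal A ≤ I.optVal Finset.univ) hτ₄.2.2
      rw [edgesOf_onSet] at hmin
      have hout : I.output (τ₄.setNat 4 ((NExpr.const 0).eval τ₄) ((NExpr.const 1).eval τ₄)) =
          some (I.marked τ₄) := by
        simp [output, marked, NExpr.eval]
      rw [hout]
      refine ⟨fun S hS => ?_, fun h => by simp at h⟩
      obtain rfl := Option.some.inj hS
      exact isOptimal_of_minimal hopt hmin
  -- Array `4` is zero in the input and is written only after the greedy deletion.
  · have h4 : τ₂.nat 4 0 = 0 := by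
      rw [hf₂.nat 4 rfl, hf₁.nat 4 rfl]; rfl
    have hout : I.output τ₂ = none := by simp [output, h4]
    rw [hout]
    exact ⟨fun S hS => by simp at hS, fun _ => not_isFeasible_of_optVal_eq_top (hτ₂.eq_top hb)⟩

end Instance

/-- Every loop makes at most `n`, `2 * m` or `n * n` iterations. With `N = n + m`, the number `N * N
+ N + N` dominates all three, and substituting this polynomial into `timePoly` gives the bound. -/
theorem solver_solvesInPolyTime : SolvesInPolyTime 1 solver := by
  refine ⟨solver.timePoly.comp (.X * .X + .X + .X), fun I => ?_⟩
  obtain ⟨c, τ, h1, h2, h3⟩ := Instance.solver_exec (I := I)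
    (B := (I.n + I.m) * (I.n + I.m) + (I.n + I.m) + (I.n + I.m)) (by omega) (by omega)
    (by nlinarith)
  refine ⟨c, τ, h1, ?_, h3⟩
  rw [Polynomial.eval_comp, Prog.eval_timePoly]
  simpa using h2

end FTP

theorem theorem1 :
    -- there is a polynomial-time algorithm for fault bound one
    (∃ P : FTP.Prog, FTP.SolvesInPolyTime 1 P) ∧
    ∀ I : FTP.Instance,
      -- every minimal feasible solution is a robust bipath, and robust bipaths are feasible
      (∀ S, Minimal (fun T => I.IsFeasible 1 T) S → I.IsRobustBipath S) ∧
      (∀ Q, I.IsRobustBipath Q → I.IsFeasible 1 Q) ∧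
      -- the optimal cost is the least cost of a robust bipath and the distance with respect to `len`
      (⨅ (S) (_ : I.IsFeasible 1 S), (I.cost S : ENNReal)) = I.lenDist ∧
      (⨅ (Q) (_ : I.IsRobustBipath Q), (I.cost Q : ENNReal)) = I.lenDist ∧
      -- a shortest path with respect to `len` yields an optimal solution that contains an optimal bipath
      (∀ vs Q, I.IsShortest vs → I.Realizes I.s vs Q →
        I.IsOptimal 1 Q ∧ ∃ B ⊆ Q, I.IsRobustBipath B ∧ (I.cost B : ENNReal) = I.lenDist) ∧
      ((∃ S, I.IsFeasible 1 S) →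
        (∃ vs, I.IsShortest vs) ∧ ∀ vs, I.IsShortest vs → ∃ Q, I.Realizes I.s vs Q) :=
  ⟨⟨FTP.solver, FTP.solver_solvesInPolyTime⟩, fun _ =>
    ⟨fun _ => FTP.Instance.isRobustBipath_of_minimal, fun _ hQ => hQ.isFeasible,
      FTP.Instance.iInf_feasible_eq, FTP.Instance.iInf_robustBipath_eq,
      fun _ _ hvs hQ => hvs.realizes hQ,
      fun ⟨_, hS⟩ => ⟨FTP.Instance.exists_isShortest, fun _ hvs => hvs.exists_realizes hS⟩⟩⟩
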